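/- Let $m,p\ge 1$, $n=m+p$, $\epsilon>0$. Let $\Lambda=\mathrm{diag}(\lambda_1,\dots,\lambda_n)$ with $\lambda_i\in C^1([0,\infty)\times[0,1])$, $\lambda_i$ and $\partial_x\lambda_i$ bounded, and, for all $t\ge 0$, $x\in[0,1]$, $$\lambda_1(t,x)<\dots<\lambda_m(t,x)<-\epsilon<0<\epsilon<\lambda_{m+1}(t,x)<\dots<\lambda_n(t,x),\qquad \lambda_{i+1}(t,x)-\lambda_i(t,x)>\epsilon\quad(1\le i<n).$$ Let $M^1=(m^1_{ij}):[0,\infty)\times[0,1]\to\mathbb R^{n\times n}$ be continuous and bounded with $m^1_{ii}=0$ for all $i$, and let $Q^1:[0,\infty)\to\mathbb R^{p\times m}$ be continuous and bounded. Write $A=\begin{pmatrix}A_{--}&A_{-+}\\A_{+-}&A_{++}\end{pmatrix}$ for the block decomposition of an $n\times n$ matrix with $A_{--}\in\mathbb R^{m\times m}$, and let $$\mathcal T=\{(t,x,\xi):\ t>0,\ 0<\xi<x<1\}.$$ **Theorem 2.3.** There exists a matrix-valued function $K=(k_{ij})_{1\le i,j\le n}$ on $\overline{\mathcal T}$ such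 that: 1. $K$ is bounded. 2. For all $i,j\in\{1,\dots,n\}$ with $j\notin\{i+1,\dots,m\}$, $k_{ij}\in C^0(\overline{\mathcal T})$. 3. For all $1\le i<j\le m$ there is a function $\psi_{ij}\in C^1([0,\infty)\times[0,1])$ with values in $[0,1]$ satisfying, for all $t\ge0$, $x\in[0,1]$, $$\partial_t\psi_{ij}(t,x)+\lambda_i(t,x)\,\partial_x\psi_{ij}(t,x)-\lambda_j(t,\psi_{ij}(t,x))=0,\qquad \psi_{ij}(t,0)=0,$$ such that $k_{ij}\in C^0(\overline{\mathcal T^-_{ij}})\cap C^0(\overline{\mathcal T^+_{ij}})$, where $\mathcal T^-_{ij}=\{(t,x,\xi)\in\mathcal T:\xi<\psi_{ij}(t,x)\}$ and $\mathcal T^+_{ij}=\{(t,x,\xi)\in\mathcal T:\xi>\psi_{ij}(t,x)\}$; that is, the restrictions of $k_{ij}$ to the two sides $\{\xi<\psi_{ij}(t,x)\}$ and $\{\xi>\psi_{ij}(t,x)\}$ of $\overline{\mathcal T}$ extend continuously to $\overline{\mathcal T^-_{ij}}$ and $\overline{\mathcal T^+_{ij}}$. On the surface $\xi=\psi_{ij}(t,x)$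 itself (in particular at $(t,0,0)$), $k_{ij}$ is given the value of the extension from $\mathcal T^-_{ij}$. 4. $K$ is a broad solution in $\mathcal T$ of the kernel equations $$\partial_tK(t,x,\xi)+\Lambda(t,x)\partial_xK(t,x,\xi)+\partial_\xi K(t,x,\xi)\Lambda(t,\xi)+K(t,x,\xi)\big(\partial_\xi\Lambda(t,\xi)+M^1(t,\xi)\big)=0,$$ $$K(t,x,x)\Lambda(t,x)-\Lambda(t,x)K(t,x,x)=-M^1(t,x).$$ This means that for all $i,j$, for all $0\le s_1\le s_2$ and all $X,Y:[s_1,s_2]\to[0,1]$ with $X'(s)=\lambda_i(s,X(s))$, $Y'(s)=\lambda_j(s,Y(s))$ and $(s,X(s),Y(s))\in\overline{\mathcal T}$ on $[s_1,s_2]$, the integrand below is integrable and $$k_{ij}(s_2,X(s_2),Y(s_2))=k_{ij}(s_1,X(s_1),Y(s_1))-\int_{s_1}^{s_2}\Big(K(s,X(s),Y(s))\big(\partial_\xi\Lambda(s,Y(s))+M^1(s,Y(s))\big)\Big)_{ij}\,ds,$$ and that the second equation holds for all $t\ge0$ and $x\in(0,1]$. 5. The matrix $$G^2_{--}(t,x)=-K_{--}(t,x,0)\Lambda_{--}(t,0)-K_{-+}(t,x,0)\Lambda_{++}(t,0)Q^1(t)$$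 is strictly lower triangular for all $t\ge0$, $x\in[0,1]$ (its entries with $i\le j$ vanish), and it is continuous on $[0,\infty)\times[0,1]$. -/

import Mathlib

open Set

namespace VolterraKernel

/-- The closed strip `[0, ∞) × [0, 1]` of times and positions `(t, x)`. -/
def strip : Set (ℝ × ℝ) := Ici 0 ×ˢ Icc 0 1

/-- The infinite triangular prism `{(t, x, ξ) : t > 0, 0 < ξ < x < 1}`. -/
def prism : Set (ℝ × ℝ × ℝ) :=
  {q | 0 < q.1 ∧ q.2.1 ∈ Ioo (0 : ℝ) 1 ∧ q.2.2 ∈ Ioo (0 : ℝ) 1 ∧ q.2.2 < q.2.1}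

/-- The part of the prism strictly below the surface `ξ = ψ(t, x)`. -/
def prismBelow (ψ : ℝ → ℝ → ℝ) : Set (ℝ × ℝ × ℝ) :=
  {q | q ∈ prism ∧ q.2.2 < ψ q.1 q.2.1}

/-- The part of the prism strictly above the surface `ξ = ψ(t, x)`. -/
def prismAbove (ψ : ℝ → ℝ → ℝ) : Set (ℝ × ℝ × ℝ) :=
  {q | q ∈ prism ∧ ψ q.1 q.2.1 < q.2.2}

/-- Assumptions on the speeds `lam i = λ_i`: they are `C¹` on `[0, ∞) × [0, 1]`, bounded together
with their `x`-derivatives, the first `m` are `< -ε`, the last `p` are `> ε`, and consecutive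
speeds are separated by more than `ε`. -/
structure AdmissibleSpeeds {m p : ℕ} (ε : ℝ) (lam : Fin (m + p) → ℝ → ℝ → ℝ) : Prop where
  contDiffOn : ∀ i, ContDiffOn ℝ 1 (fun q : ℝ × ℝ => lam i q.1 q.2) strip
  bounded : ∃ C : ℝ, ∀ i, ∀ t x : ℝ, (t, x) ∈ strip →
    |lam i t x| ≤ C ∧ |derivWithin (fun y => lam i t y) (Icc 0 1) x| ≤ C
  neg : ∀ i : Fin m, ∀ t x : ℝ, (t, x) ∈ strip → lam (Fin.castAdd p i) t x < -ε
  pos : ∀ i : Fin p, ∀ t x : ℝ, (t, x) ∈ strip → ε < lam (Fin.natAdd m i) t x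
  gap : ∀ i j : Fin (m + p), i < j → ∀ t x : ℝ, (t, x) ∈ strip → ε < lam j t x - lam i t x

/-- Assumptions on the in-domain coupling `M`: continuous and bounded on `[0, ∞) × [0, 1]`, with
zero diagonal. -/
structure AdmissibleCoupling {n : ℕ} (M : ℝ → ℝ → Matrix (Fin n) (Fin n) ℝ) : Prop where
  continuousOn : ContinuousOn (fun q : ℝ × ℝ => M q.1 q.2) strip
  bounded : ∃ C : ℝ, ∀ t x : ℝ, (t, x) ∈ strip → ∀ i j, |M t x i j| ≤ C
  diag_zero : ∀ t x : ℝ, (t, x) ∈ strip → ∀ i, M t x i i = 0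

/-- Assumptions on the boundary coupling `Q`: continuous and bounded on `[0, ∞)`. -/
structure AdmissibleBoundary {m p : ℕ} (Q : ℝ → Matrix (Fin p) (Fin m) ℝ) : Prop where
  continuousOn : ContinuousOn Q (Ici 0)
  bounded : ∃ C : ℝ, ∀ t : ℝ, 0 ≤ t → ∀ i j, |Q t i j| ≤ C

/-- The diagonal matrix `Λ(t, x)` of the speeds. -/
def speedMatrix {n : ℕ} (lam : Fin n → ℝ → ℝ → ℝ) (t x : ℝ) : Matrix (Fin n) (Fin n) ℝ :=
  Matrix.diagonal fun i => lam i t x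

/-- The diagonal matrix `∂_x Λ(t, x)`, the derivative being one-sided at `x = 0` and `x = 1`. -/
noncomputable def speedMatrixDeriv {n : ℕ} (lam : Fin n → ℝ → ℝ → ℝ) (t x : ℝ) :
    Matrix (Fin n) (Fin n) ℝ :=
  Matrix.diagonal fun i => derivWithin (fun y => lam i t y) (Icc 0 1) x

/-- `X` is a characteristic of `∂_t + lamᵢ(t, x) ∂_x` in `[0, 1]` on the time interval
`[s₁, s₂]`. -/
def IsCharacteristic (lami : ℝ → ℝ → ℝ) (s₁ s₂ : ℝ) (X : ℝ → ℝ) : Prop :=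
  ∀ s ∈ Icc s₁ s₂, X s ∈ Icc (0 : ℝ) 1 ∧ HasDerivWithinAt X (lami s (X s)) (Icc s₁ s₂) s

/-- `K` is a broad solution (solution along the characteristics) of
`∂_t K + Λ(t,x) ∂_x K + ∂_ξ K Λ(t,ξ) + K (∂_ξ Λ(t,ξ) + M(t,ξ)) = 0` in the prism: for all `i, j`,
along every segment `s ↦ (s, X s, Y s)` contained in the closed prism of a characteristic curve of
`∂_t + λ_i(t,x) ∂_x + λ_j(t,ξ) ∂_ξ`, the equation for the entry `k_ij` holds in integrated form. -/
def SolvesAlongCharacteristics {n : ℕ} (lam : Fin n → ℝ → ℝ → ℝ)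
    (M : ℝ → ℝ → Matrix (Fin n) (Fin n) ℝ) (K : ℝ → ℝ → ℝ → Matrix (Fin n) (Fin n) ℝ) : Prop :=
  ∀ (i j : Fin n) (s₁ s₂ : ℝ) (X Y : ℝ → ℝ), s₁ ≤ s₂ →
    IsCharacteristic (lam i) s₁ s₂ X → IsCharacteristic (lam j) s₁ s₂ Y →
    (∀ s ∈ Icc s₁ s₂, (s, X s, Y s) ∈ closure prism) →
    IntervalIntegrable
      (fun s => (K s (X s) (Y s) * (speedMatrixDeriv lam s (Y s) + M s (Y s))) i j)
      MeasureTheory.volume s₁ s₂ ∧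
    K s₂ (X s₂) (Y s₂) i j = K s₁ (X s₁) (Y s₁) i j -
      ∫ s in s₁..s₂, (K s (X s) (Y s) * (speedMatrixDeriv lam s (Y s) + M s (Y s))) i j

/-- `K` is a broad solution of the kernel equations: it solves the hyperbolic system along the
characteristics, and `K(t,x,x) Λ(t,x) - Λ(t,x) K(t,x,x) = -M(t,x)` on the diagonal `ξ = x`
(away from the edge `x = 0`, where entries of `K` may have two different traces). -/
structure IsBroadSolution {n : ℕ} (lam : Fin n → ℝ → ℝ → ℝ)
    (M : ℝ → ℝ → Matrix (Fin n) (Fin n) ℝ) (K : ℝ → ℝ → ℝ → Matrix (Fin n) (Fin n) ℝ) : Prop where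
  alongChar : SolvesAlongCharacteristics lam M K
  diagonal : ∀ t x : ℝ, 0 ≤ t → x ∈ Ioc (0 : ℝ) 1 →
    K t x x * speedMatrix lam t x - speedMatrix lam t x * K t x x = -M t x

/-- `k` is continuous on the closure of each of the two parts of the prism cut out by the surface
`ξ = ψ(t, x)`: on the closed prism it coincides with a function continuous on the closure of the
lower part where `ξ ≤ ψ(t, x)`, and with a function continuous on the closure of the upper part
where `ξ > ψ(t, x)` (on the surface itself, `k` takes the value of the trace from below). -/
def PiecewiseContinuous (ψ : ℝ → ℝ → ℝ) (k : ℝ → ℝ → ℝ → ℝ) : Prop :=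
  ∃ f g : ℝ × ℝ × ℝ → ℝ,
    ContinuousOn f (closure (prismBelow ψ)) ∧ ContinuousOn g (closure (prismAbove ψ)) ∧
    ∀ q ∈ closure prism,
      (q.2.2 ≤ ψ q.1 q.2.1 → k q.1 q.2.1 q.2.2 = f q) ∧
      (ψ q.1 q.2.1 < q.2.2 → k q.1 q.2.1 q.2.2 = g q)

/-- `ψ ∈ C¹([0, ∞) × [0, 1])`, with values in `[0, 1]`, solves
`∂_t ψ + λ_i(t, x) ∂_x ψ - λ_j(t, ψ) = 0`, `ψ(t, 0) = 0`. -/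
structure IsInterface (lami lamj : ℝ → ℝ → ℝ) (ψ : ℝ → ℝ → ℝ) : Prop where
  contDiffOn : ContDiffOn ℝ 1 (fun q : ℝ × ℝ => ψ q.1 q.2) strip
  mem_Icc : ∀ t x : ℝ, (t, x) ∈ strip → ψ t x ∈ Icc (0 : ℝ) 1
  equation : ∀ t x : ℝ, (t, x) ∈ strip →
    derivWithin (fun s => ψ s x) (Ici 0) t + lami t x * derivWithin (fun y => ψ t y) (Icc 0 1) x
      - lamj t (ψ t x) = 0
  zero : ∀ t : ℝ, 0 ≤ t → ψ t 0 = 0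

section Blocks

variable {m p : ℕ}

/-- The block `A₋₋` (first `m` rows, first `m` columns). -/
def blockMM (A : Matrix (Fin (m + p)) (Fin (m + p)) ℝ) : Matrix (Fin m) (Fin m) ℝ :=
  A.submatrix (Fin.castAdd p) (Fin.castAdd p)

/-- The block `A₋₊` (first `m` rows, last `p` columns). -/
def blockMP (A : Matrix (Fin (m + p)) (Fin (m + p)) ℝ) : Matrix (Fin m) (Fin p) ℝ :=
  A.submatrix (Fin.castAdd p) (Fin.natAdd m)

/-- The block `A₊₊` (last `p` rows, last `p` columns). -/
def blockPP (A : Matrix (Fin (m + p)) (Fin (m + p)) ℝ) : Matrix (Fin p) (Fin p) ℝ :=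
  A.submatrix (Fin.natAdd m) (Fin.natAdd m)

/-- `G₋₋(t,x) = -K₋₋(t,x,0) Λ₋₋(t,0) - K₋₊(t,x,0) Λ₊₊(t,0) Q(t)`. -/
def gainMM (lam : Fin (m + p) → ℝ → ℝ → ℝ) (Q : ℝ → Matrix (Fin p) (Fin m) ℝ)
    (K : ℝ → ℝ → ℝ → Matrix (Fin (m + p)) (Fin (m + p)) ℝ) (t x : ℝ) :
    Matrix (Fin m) (Fin m) ℝ :=
  -(blockMM (K t x 0) * blockMM (speedMatrix lam t 0))
    - blockMP (K t x 0) * blockPP (speedMatrix lam t 0) * Q t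

end Blocks

end VolterraKernel

open VolterraKernel

open Set Filter Topology MeasureTheory

namespace VolterraKernel

/-! The kernel equations act on `K` by right multiplication, so each row `i` can be solved on its
own. Along a curve `s ↦ (s, X s, Y s)`, with `X` and `Y` trajectories of the speeds `λ_i` and `λ_j`,
the equation for `k_ij` is an ordinary integral equation. Its value is fixed where the curve reaches
the diagonal, by `m_ij / (λ_i - λ_j)`, or the face `ξ = 0`, where the vanishing of the gain
expresses `k_ij` through the entries of positive speed. The coefficients are extended to all real
times and positions, so trajectories are global and no data at `t = 0` is needed.

In a row of negative speed, `j` with smaller speed is transported from the diagonal, reached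
backward in time; `j` with positive speed from the diagonal, reached forward; `j = i` from the face.
For `i < j ≤ m` both origins occur. The choice depends on whether `Y` reaches `0` before `X`, that
is, on the sign of `hit (l i) t x - hit (l j) t ξ`. The zero set of this difference is the graph of
`interface`, and the two transported values need not agree there.

The function `hit l` labels the trajectories of `l`. It is `C¹`, and along a trajectory of another
speed it varies monotonically at a rate at least `sepRate`, by the gap between the speeds. This
gives unique meeting times, transversality to the interfaces and the regularity of `interface`.

A row is a fixed point of `rowStep`. The weight `exp (L * clock)` makes this map a contraction, as
`clock` decreases along every characteristic in its direction of transport; a factor `R` in the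
weight absorbs the coupling on the face (`rowStep_contract`). Continuity off the interfaces survives
the iteration because a `j`-characteristic crosses the interface of an entry `q ≠ j` at most once
(`ae_continuousWithinAt_path`). An interface of the `j`-th entry itself may contain whole
`j`-characteristics, so that entry must not occur in its own source: `m_jj = 0`, and the term with
`∂_ξ λ_j` is removed by the integrating factor `amp` (`exists_isKernelRow`).

Rows of positive speed become negative under time reversal. Nothing is prescribed for them on the
face, so the data there can be chosen equal to the diagonal data at the corner, which removes the
jump (`exists_isBroadRow_of_pos`). -/

/-- `l` is a speed of constant sign `σ` on `ℝ × ℝ`, with space derivative `l'` away from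
`x ∈ {0, 1}`, where `l'` may jump. -/
structure Speed (ε C σ : ℝ) (l l' : ℝ → ℝ → ℝ) : Prop where
  pos : 0 < ε
  sq : σ * σ = 1
  cont : Continuous fun q : ℝ × ℝ => l q.1 q.2
  bound : ∀ t x, |l t x| ≤ C
  lip : ∀ t x y, |l t x - l t y| ≤ C * |x - y|
  sgn : ∀ t x, ε ≤ σ * l t x
  hasDeriv : ∀ t x, x ≠ 0 → x ≠ 1 → HasDerivAt (l t) (l' t x) x
  contDeriv : ∀ t x, x ≠ 0 → x ≠ 1 → ContinuousAt (fun q : ℝ × ℝ => l' q.1 q.2) (t, x)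
  contOn : ContinuousOn (fun q : ℝ × ℝ => l' q.1 q.2) (univ ×ˢ Icc 0 1)
  support : ∀ t x, x ∉ Icc (0 : ℝ) 1 → l' t x = 0
  boundDeriv : ∀ t x, |l' t x| ≤ C
  meas : Measurable fun q : ℝ × ℝ => l' q.1 q.2

/-! ### Trajectories of a speed and their hitting times. -/

/-- `X` is a global trajectory of the time-dependent vector field `l`. -/
def IsTraj (l : ℝ → ℝ → ℝ) (X : ℝ → ℝ) : Prop := ∀ s, HasDerivAt X (l s (X s)) s

theorem IsTraj.continuous {l : ℝ → ℝ → ℝ} {X : ℝ → ℝ} (h : IsTraj l X) : Continuous X :=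
  continuous_iff_continuousAt.2 fun s => (h s).continuousAt

/-- The trajectory of `l` through `x` at time `t`. -/
noncomputable def flow (l : ℝ → ℝ → ℝ) (t x : ℝ) : ℝ → ℝ :=
  Classical.epsilon fun X => X t = x ∧ IsTraj l X

/-- The time at which the trajectory of `l` through `(t, x)` reaches `0`. -/
noncomputable def hit (l : ℝ → ℝ → ℝ) (t x : ℝ) : ℝ :=
  Classical.epsilon fun s => flow l t x s = 0

theorem abs_sub_le_of_hasDerivAt {X X' : ℝ → ℝ} {C : ℝ} (h : ∀ s, HasDerivAt X (X' s) s)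
    (hC : ∀ s, |X' s| ≤ C) (a b : ℝ) : |X b - X a| ≤ C * |b - a| := by
  have := Convex.norm_image_sub_le_of_norm_hasDerivWithin_le (f := X) (f' := X') (s := univ)
    (C := C) (x := a) (y := b) (fun s _ => (h s).hasDerivWithinAt) (fun s _ => hC s) convex_univ
    trivial trivial
  simpa using this

theorem sub_ge_of_hasDerivAt {X X' : ℝ → ℝ} {c : ℝ} (h : ∀ s, HasDerivAt X (X' s) s)
    (hc : ∀ s, c ≤ X' s) {a b : ℝ} (hab : a ≤ b) : c * (b - a) ≤ X b - X a := by
  refine Convex.mul_sub_le_image_sub_of_le_deriv convex_univ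
    (continuous_iff_continuousAt.2 fun s => (h s).continuousAt).continuousOn
    (fun s _ => (h s).differentiableAt.differentiableWithinAt) (fun s _ => ?_) a trivial b trivial
    hab
  rw [(h s).deriv]; exact hc s

namespace Speed

variable {ε C σ : ℝ} {l l' : ℝ → ℝ → ℝ} (hl : Speed ε C σ l l')
include hl

theorem C_nonneg : 0 ≤ C := (abs_nonneg _).trans (hl.bound 0 0)

theorem abs_sigma : |σ| = 1 := by
  have := hl.sq
  rw [← abs_mul_abs_self] at this
  nlinarith [abs_nonneg σ]

theorem eps_le (t x : ℝ) : ε ≤ |l t x| := by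
  have := hl.sgn t x
  calc ε ≤ |σ * l t x| := this.trans (le_abs_self _)
    _ = |l t x| := by rw [abs_mul, hl.abs_sigma, one_mul]

theorem ne_zero (t x : ℝ) : l t x ≠ 0 := by
  exact abs_pos.1 (hl.pos.trans_le (hl.eps_le t x))

theorem C_pos : 0 < C := hl.pos.trans_le ((hl.eps_le 0 0).trans (hl.bound 0 0))

theorem lipschitzWith (t : ℝ) : LipschitzWith C.toNNReal (l t) := by
  refine LipschitzWith.of_dist_le_mul fun x y => ?_
  rw [Real.coe_toNNReal _ hl.C_nonneg]
  exact hl.lip t x y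

theorem traj_unique {X Y : ℝ → ℝ} (hX : IsTraj l X) (hY : IsTraj l Y) {t : ℝ} (h : X t = Y t) :
    X = Y :=
  ODE_solution_unique_univ (v := l) (s := fun _ => univ) (K := C.toNNReal)
    (fun t => (hl.lipschitzWith t).lipschitzOnWith) (fun s => ⟨hX s, trivial⟩)
    (fun s => ⟨hY s, trivial⟩) h

theorem exists_traj_Ioo (t x : ℝ) (n : ℕ) : ∃ X : ℝ → ℝ, X t = x ∧
    ∀ s ∈ Ioo (t - (n + 1)) (t + (n + 1)), HasDerivAt X (l s (X s)) s := by
  have hn : (0 : ℝ) < n + 1 := by positivity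
  have ht : t ∈ Icc (t - (n + 1)) (t + (n + 1)) := ⟨by linarith, by linarith⟩
  -- A solution of speed at most `C` moves by at most `C * (n + 1)` in this time. That radius is
  -- allowed because `l` is bounded and Lipschitz on the whole line.
  have hP : IsPicardLindelof l (⟨t, ht⟩ : Icc (t - (n + 1 : ℝ)) (t + (n + 1))) x
      (C * (n + 1)).toNNReal 0 C.toNNReal C.toNNReal := by
    refine ⟨fun s _ => (hl.lipschitzWith s).lipschitzOnWith, fun y _ => ?_, fun s _ y _ => ?_, ?_⟩
    · exact (hl.cont.comp (by fun_prop : Continuous fun s : ℝ => (s, y))).continuousOn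
    · rw [Real.coe_toNNReal _ hl.C_nonneg]; exact hl.bound s y
    · have h0 : 0 ≤ C * (n + 1) := mul_nonneg hl.C_nonneg hn.le
      rw [Real.coe_toNNReal _ hl.C_nonneg, Real.coe_toNNReal _ h0]
      simp
  obtain ⟨X, h0, hX⟩ := hP.exists_eq_forall_mem_Icc_hasDerivWithinAt₀
  exact ⟨X, h0, fun s hs => (hX s (Ioo_subset_Icc_self hs)).hasDerivAt (Icc_mem_nhds hs.1 hs.2)⟩

/-- Solutions on the growing intervals agree by uniqueness. The glued curve uses at time `s` the
solution of index `⌈|s - t|⌉₊`, whose interval contains `s` in its interior. -/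
theorem exists_traj (t x : ℝ) : ∃ X : ℝ → ℝ, X t = x ∧ IsTraj l X := by
  choose Y h0 hY using fun n => hl.exists_traj_Ioo t x n
  have agree : ∀ n m : ℕ, n ≤ m → EqOn (Y n) (Y m) (Ioo (t - (n + 1)) (t + (n + 1))) := by
    intro n m hnm
    have hnm' : (n : ℝ) ≤ m := by exact_mod_cast hnm
    have hn : (0 : ℝ) ≤ n := by positivity
    exact ODE_solution_unique_of_mem_Ioo (v := l) (s := fun _ => univ) (K := C.toNNReal) (t₀ := t)
      (fun s _ => (hl.lipschitzWith s).lipschitzOnWith) ⟨by linarith, by linarith⟩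
      (fun s hs => ⟨hY n s hs, trivial⟩)
      (fun s hs => ⟨hY m s ⟨by linarith [hs.1], by linarith [hs.2]⟩, trivial⟩)
      ((h0 n).trans (h0 m).symm)
  have hmem : ∀ s : ℝ, s ∈ Ioo (t - ((⌈|s - t|⌉₊ : ℕ) + 1)) (t + ((⌈|s - t|⌉₊ : ℕ) + 1)) := by
    intro s
    have := Nat.le_ceil |s - t|
    have := abs_le.1 this
    exact ⟨by linarith [this.1], by linarith [this.2]⟩
  have hglue : ∀ n : ℕ, ∀ s ∈ Ioo (t - ((n : ℝ) + 1)) (t + (n + 1)),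
      Y ⌈|s - t|⌉₊ s = Y n s := by
    intro n s hs
    rcases le_total ⌈|s - t|⌉₊ n with h | h
    · exact agree _ _ h (hmem s)
    · exact (agree _ _ h hs).symm
  refine ⟨fun s => Y ⌈|s - t|⌉₊ s, h0 _, fun s => ?_⟩
  have hs := hmem s
  refine (hY _ s hs).congr_of_eventuallyEq ?_
  filter_upwards [Ioo_mem_nhds hs.1 hs.2] with r hr using hglue _ r hr

theorem flow_spec (t x : ℝ) : flow l t x t = x ∧ IsTraj l (flow l t x) :=
  Classical.epsilon_spec (hl.exists_traj t x)

theorem flow_self (t x : ℝ) : flow l t x t = x := (hl.flow_spec t x).1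

theorem isTraj_flow (t x : ℝ) : IsTraj l (flow l t x) := (hl.flow_spec t x).2

theorem flow_eq {X : ℝ → ℝ} (hX : IsTraj l X) (t : ℝ) : flow l t (X t) = X :=
  hl.traj_unique (hl.isTraj_flow _ _) hX (t := t) (hl.flow_self _ _)

theorem traj_lip {X : ℝ → ℝ} (hX : IsTraj l X) (a b : ℝ) : |X b - X a| ≤ C * |b - a| :=
  abs_sub_le_of_hasDerivAt hX (fun s => hl.bound s _) a b

theorem traj_mono {X : ℝ → ℝ} (hX : IsTraj l X) {a b : ℝ} (hab : a ≤ b) :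
    ε * (b - a) ≤ σ * X b - σ * X a :=
  sub_ge_of_hasDerivAt (X := fun s => σ * X s) (fun s => (hX s).const_mul σ)
    (fun s => hl.sgn s _) hab

theorem traj_expand {X : ℝ → ℝ} (hX : IsTraj l X) (a b : ℝ) : ε * |b - a| ≤ |X b - X a| := by
  have key : ∀ a b : ℝ, a ≤ b → ε * |b - a| ≤ |X b - X a| := by
    intro a b hab
    rw [abs_of_nonneg (sub_nonneg.2 hab)]
    refine (hl.traj_mono hX hab).trans ((le_abs_self _).trans ?_)
    rw [← mul_sub, abs_mul, hl.abs_sigma, one_mul]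
  rcases le_total a b with h | h
  · exact key a b h
  · rw [abs_sub_comm b a, abs_sub_comm (X b)]; exact key b a h

/-- The slope of `l` between two trajectories. -/
theorem traj_sub {X Y : ℝ → ℝ} (hX : IsTraj l X) (hY : IsTraj l Y) {t : ℝ} (h : X t ≠ Y t) :
    (∀ s, X s ≠ Y s) ∧
    Continuous (fun s => (l s (X s) - l s (Y s)) / (X s - Y s)) ∧
    ∀ s, X s - Y s =
      (X t - Y t) * Real.exp (∫ r in t..s, (l r (X r) - l r (Y r)) / (X r - Y r)) := by
  have hne : ∀ s, X s ≠ Y s := fun s hs => h (congrFun (hl.traj_unique hX hY hs) t)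
  have hne' : ∀ s, X s - Y s ≠ 0 := fun s => sub_ne_zero.2 (hne s)
  have hcX := hX.continuous
  have hcY := hY.continuous
  have hc : Continuous (fun s => (l s (X s) - l s (Y s)) / (X s - Y s)) := by
    refine Continuous.div ?_ (hcX.sub hcY) hne'
    exact (hl.cont.comp (continuous_id.prodMk hcX)).sub (hl.cont.comp (continuous_id.prodMk hcY))
  refine ⟨hne, hc, ?_⟩
  set a : ℝ → ℝ := fun s => (l s (X s) - l s (Y s)) / (X s - Y s) with ha
  have hI : ∀ s, HasDerivAt (fun s => ∫ r in t..s, a r) (a s) s := fun s =>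
    intervalIntegral.integral_hasDerivAt_right (hc.intervalIntegrable _ _)
      (hc.stronglyMeasurableAtFilter _ _) hc.continuousAt
  have hW : ∀ s, HasDerivAt (fun s => (X s - Y s) * Real.exp (-∫ r in t..s, a r)) 0 s := by
    intro s
    have := ((hX s).sub (hY s)).mul ((hI s).neg.exp)
    convert! this using 1
    have : l s (X s) - l s (Y s) = a s * (X s - Y s) := by
      simp only [ha]; field_simp [hne' s]
    simp only [Pi.sub_apply, Pi.neg_apply]
    rw [this]; ring
  intro s
  have hconst := is_const_of_deriv_eq_zero (fun s => (hW s).differentiableAt)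
    (fun s => (hW s).deriv) s t
  simp only [intervalIntegral.integral_same, neg_zero, Real.exp_zero, mul_one] at hconst
  rw [← hconst, mul_assoc, ← Real.exp_add]
  simp [ha]

/-- The exponent in `traj_sub` is an integral of secant slopes of `l`, each at most `C` in absolute
value. -/
theorem traj_dist {X Y : ℝ → ℝ} (hX : IsTraj l X) (hY : IsTraj l Y) (t s : ℝ) :
    |X s - Y s| ≤ |X t - Y t| * Real.exp (C * |s - t|) := by
  by_cases h : X t = Y t
  · rw [hl.traj_unique hX hY h]; simp
  obtain ⟨hne, -, hs⟩ := hl.traj_sub hX hY h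
  rw [hs s, abs_mul, Real.abs_exp]
  gcongr
  refine (le_abs_self _).trans ?_
  rw [← Real.norm_eq_abs (∫ r in t..s, _)]
  refine intervalIntegral.norm_integral_le_of_norm_le_const (fun r _ => ?_)
  rw [Real.norm_eq_abs, abs_div, div_le_iff₀ (abs_pos.2 (sub_ne_zero.2 (hne r)))]
  exact hl.lip _ _ _

theorem continuous_flow : Continuous fun q : ℝ × ℝ × ℝ => flow l q.1 q.2.1 q.2.2 := by
  rw [continuous_iff_continuousAt]
  rintro ⟨t₀, x₀, s₀⟩
  set X := flow l t₀ x₀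
  have hX : IsTraj l X := hl.isTraj_flow _ _
  have hXc := hX.continuous
  rw [ContinuousAt, tendsto_iff_dist_tendsto_zero]
  refine squeeze_zero (g := fun q : ℝ × ℝ × ℝ =>
    |q.2.1 - X q.1| * Real.exp (C * |q.2.2 - q.1|) + C * |q.2.2 - s₀|)
    (fun _ => dist_nonneg) ?_ ?_
  · rintro ⟨t, x, s⟩
    simp only [Real.dist_eq]
    have h1 := hl.traj_dist (hl.isTraj_flow t x) hX t s
    rw [hl.flow_self] at h1
    have h2 := hl.traj_lip hX s₀ s
    calc |flow l t x s - X s₀| ≤ |flow l t x s - X s| + |X s - X s₀| := abs_sub_le _ _ _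
      _ ≤ _ := add_le_add h1 h2
  · have : Continuous fun q : ℝ × ℝ × ℝ =>
      |q.2.1 - X q.1| * Real.exp (C * |q.2.2 - q.1|) + C * |q.2.2 - s₀| := by fun_prop
    have h := this.tendsto (t₀, x₀, s₀)
    have hXt : X t₀ = x₀ := hl.flow_self _ _
    simpa [hXt] using h

end Speed

/-! ### Zeros of uniformly increasing functions -/

/-- `f` increases at rate at least `c`. -/
def IncreasesAt (c : ℝ) (f : ℝ → ℝ) : Prop := ∀ a b, a ≤ b → c * (b - a) ≤ f b - f a

theorem IncreasesAt.abs_le {c : ℝ} {f : ℝ → ℝ} (h : IncreasesAt c f) (a b : ℝ) :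
    c * |b - a| ≤ |f b - f a| := by
  rcases le_total a b with hab | hab
  · rw [abs_of_nonneg (sub_nonneg.2 hab)]; exact (h a b hab).trans (le_abs_self _)
  · rw [abs_sub_comm b a, abs_sub_comm (f b), abs_of_nonneg (sub_nonneg.2 hab)]
    exact (h b a hab).trans (le_abs_self _)

theorem IncreasesAt.injective {c : ℝ} (hc : 0 < c) {f : ℝ → ℝ} (h : IncreasesAt c f) :
    Function.Injective f := by
  intro a b hab
  have := h.abs_le a b
  rw [hab, sub_self, abs_zero] at this
  have h2 : |b - a| ≤ 0 := by
    by_contra hh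
    push Not at hh
    nlinarith
  have := abs_nonpos_iff.1 h2
  linarith

theorem IncreasesAt.strictMono {c : ℝ} (hc : 0 < c) {f : ℝ → ℝ} (h : IncreasesAt c f) :
    StrictMono f := by
  intro a b hab
  have := h a b hab.le
  nlinarith

theorem IncreasesAt.exists_zero {c : ℝ} (hc : 0 < c) {f : ℝ → ℝ} (h : IncreasesAt c f)
    (hf : Continuous f) : ∃ s, f s = 0 := by
  have h1 := h (-(|f 0| / c)) 0 (by simp; positivity)
  have h2 := h 0 (|f 0| / c) (by positivity)
  have h3 : c * (|f 0| / c) = |f 0| := by field_simp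
  simp only [sub_neg_eq_add, zero_add, h3, sub_zero] at h1 h2
  have := mem_range_of_exists_le_of_exists_ge hf ⟨_, (by linarith [le_abs_self (f 0)] :
    f (-(|f 0| / c)) ≤ 0)⟩ ⟨_, (by linarith [neg_abs_le (f 0)] : 0 ≤ f (|f 0| / c))⟩
  exact this

/-- The common rate of increase gives `c * |ζ P - ζ P₀| ≤ |z P (ζ P₀)|`, so continuity in `P` at
each frozen `s` is enough. This replaces an implicit function theorem for hitting and meeting times.
-/
theorem continuous_zero {E : Type*} [TopologicalSpace E] {c : ℝ} (hc : 0 < c) {z : E → ℝ → ℝ}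
    (h : ∀ P, IncreasesAt c (z P)) (hz : ∀ s, Continuous fun P => z P s) {ζ : E → ℝ}
    (hζ : ∀ P, z P (ζ P) = 0) : Continuous ζ := by
  rw [continuous_iff_continuousAt]
  intro P₀
  rw [ContinuousAt, tendsto_iff_dist_tendsto_zero]
  refine squeeze_zero (g := fun P => |z P (ζ P₀)| / c) (fun _ => dist_nonneg) ?_ ?_
  · intro P
    have := (h P).abs_le (ζ P₀) (ζ P)
    rw [hζ, zero_sub, abs_neg] at this
    rw [Real.dist_eq, le_div_iff₀ hc]
    linarith
  · have := ((hz (ζ P₀)).abs.div_const c).tendsto P₀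
    simpa [hζ] using this

namespace Speed

variable {ε C σ : ℝ} {l l' : ℝ → ℝ → ℝ} (hl : Speed ε C σ l l')
include hl

theorem increasesAt {X : ℝ → ℝ} (hX : IsTraj l X) : IncreasesAt ε (fun s => σ * X s) :=
  fun _ _ hab => hl.traj_mono hX hab

theorem sigma_ne : σ ≠ 0 := by
  rintro rfl
  simpa using hl.sq

theorem flow_hit (t x : ℝ) : flow l t x (hit l t x) = 0 := by
  refine Classical.epsilon_spec (p := fun s => flow l t x s = 0) ?_
  have hX := hl.isTraj_flow t x
  obtain ⟨s, hs⟩ := (hl.increasesAt hX).exists_zero hl.pos (continuous_const.mul hX.continuous)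
  exact ⟨s, (mul_eq_zero.1 hs).resolve_left hl.sigma_ne⟩

theorem traj_injective {X : ℝ → ℝ} (hX : IsTraj l X) : Function.Injective X := fun a b h =>
  (hl.increasesAt hX).injective hl.pos (by simp [h])

theorem hit_eq {X : ℝ → ℝ} (hX : IsTraj l X) {s : ℝ} (hs : X s = 0) (t : ℝ) :
    hit l t (X t) = s := by
  refine hl.traj_injective hX ?_
  have := hl.flow_hit t (X t)
  rw [hl.flow_eq hX] at this
  rw [this, hs]

/-- The hitting time is a first integral, because it depends only on the trajectory. It serves
throughout as the label of a trajectory. -/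
theorem hit_traj {X : ℝ → ℝ} (hX : IsTraj l X) (t s : ℝ) : hit l t (X t) = hit l s (X s) := by
  refine hl.hit_eq hX ?_ t
  have := hl.flow_hit s (X s)
  rwa [hl.flow_eq hX] at this

theorem traj_hit {X : ℝ → ℝ} (hX : IsTraj l X) (t : ℝ) : X (hit l t (X t)) = 0 := by
  have := hl.flow_hit t (X t)
  rwa [hl.flow_eq hX] at this

theorem hit_zero (t : ℝ) : hit l t 0 = t := by
  have := hl.hit_eq (hl.isTraj_flow t 0) (hl.flow_self t 0) t
  rwa [hl.flow_self] at this

theorem continuous_hit : Continuous fun q : ℝ × ℝ => hit l q.1 q.2 := by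
  refine continuous_zero hl.pos (z := fun q s => σ * flow l q.1 q.2 s)
    (fun q => hl.increasesAt (hl.isTraj_flow _ _)) (fun s => ?_) (fun q => ?_)
  · exact continuous_const.mul (hl.continuous_flow.comp
      (by fun_prop : Continuous fun q : ℝ × ℝ => (q.1, q.2, s)))
  · simp [hl.flow_hit]

theorem abs_hit_sub_le (t x : ℝ) : ε * |hit l t x - t| ≤ |x| := by
  have := hl.traj_expand (hl.isTraj_flow t x) t (hit l t x)
  rwa [hl.flow_hit, hl.flow_self, zero_sub, abs_neg] at this

end Speed

/-! ### Integrals of bounded functions depending on a parameter. -/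

theorem intervalIntegrable_of_bounded {f : ℝ → ℝ} {C : ℝ} (hf : Measurable f)
    (hC : ∀ s, |f s| ≤ C) (a b : ℝ) : IntervalIntegrable f volume a b :=
  (intervalIntegrable_const (c := C)).mono_fun' hf.aestronglyMeasurable
    (Eventually.of_forall hC)

theorem abs_integral_le_of_bounded {f : ℝ → ℝ} {C : ℝ} (hC : ∀ s, |f s| ≤ C) (a b : ℝ) :
    |∫ s in a..b, f s| ≤ C * |b - a| :=
  intervalIntegral.norm_integral_le_of_norm_le_const (f := f) (fun s _ => hC s)

/-- Continuity, within a set, of an integral with moving endpoints and a bounded integrand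
depending on a parameter. -/
theorem continuousWithinAt_integral {E : Type*} [TopologicalSpace E] [FirstCountableTopology E]
    {F : E → ℝ → ℝ} {C : ℝ} (hC : ∀ P s, |F P s| ≤ C) (hF : ∀ P, Measurable (F P)) {D : Set E}
    {P₀ : E} (hc : ∀ᵐ s, ContinuousWithinAt (fun P => F P s) D P₀) {a b : E → ℝ}
    (ha : ContinuousWithinAt a D P₀) (hb : ContinuousWithinAt b D P₀) :
    ContinuousWithinAt (fun P => ∫ s in a P..b P, F P s) D P₀ := by
  have hi : ∀ P u v, IntervalIntegrable (F P) volume u v := fun P u v =>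
    intervalIntegrable_of_bounded (hF P) (hC P) u v
  have h1 : ContinuousWithinAt (fun P => ∫ s in a P₀..b P₀, F P s) D P₀ :=
    intervalIntegral.continuousWithinAt_of_dominated_interval (bound := fun _ => C)
      (Eventually.of_forall fun P => (hF P).aestronglyMeasurable)
      (Eventually.of_forall fun P => Eventually.of_forall fun s _ => hC P s)
      intervalIntegrable_const (hc.mono fun s hs _ => hs)
  have small : ∀ u : E → ℝ, ContinuousWithinAt u D P₀ →
      Tendsto (fun P => ∫ s in u P₀..u P, F P s) (𝓝[D] P₀) (𝓝 0) := by
    intro u hu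
    refine squeeze_zero_norm (fun P => abs_integral_le_of_bounded (hC P) (u P₀) (u P)) ?_
    have := ((hu.sub_const (u P₀)).abs.const_mul C)
    simpa [ContinuousWithinAt] using this
  have h2 := (h1.tendsto.add (small b hb)).sub (small a ha)
  rw [ContinuousWithinAt]
  have e : ∀ P, ∫ s in a P..b P, F P s = (∫ s in a P₀..b P₀, F P s) +
      (∫ s in b P₀..b P, F P s) - ∫ s in a P₀..a P, F P s := by
    intro P
    rw [intervalIntegral.integral_add_adjacent_intervals (hi _ _ _) (hi _ _ _)]
    rw [← intervalIntegral.integral_add_adjacent_intervals (hi P (a P₀) (a P)) (hi P (a P) (b P))]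
    ring
  rw [add_zero, sub_zero] at h2
  exact h2.congr fun P => (e P).symm

/-! ### The integrating factor, and differentiability of flows and hitting times. -/

/-- The solution of `∂ₜ a + l ∂ₓ a + l' a = 0` which equals `1` at `x = 0`. -/
noncomputable def amp (l l' : ℝ → ℝ → ℝ) (t x : ℝ) : ℝ :=
  Real.exp (∫ s in t..hit l t x, l' s (flow l t x s))

theorem amp_pos (l l' : ℝ → ℝ → ℝ) (t x : ℝ) : 0 < amp l l' t x := Real.exp_pos _

namespace Speed

variable {ε C σ : ℝ} {l l' : ℝ → ℝ → ℝ} (hl : Speed ε C σ l l')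
include hl

theorem measurable_deriv_traj {X : ℝ → ℝ} (hX : Continuous X) : Measurable fun s => l' s (X s) :=
  hl.meas.comp (measurable_id.prodMk hX.measurable)

theorem intervalIntegrable_deriv {X : ℝ → ℝ} (hX : Continuous X) (a b : ℝ) :
    IntervalIntegrable (fun s => l' s (X s)) volume a b :=
  intervalIntegrable_of_bounded (hl.measurable_deriv_traj hX) (fun _ => hl.boundDeriv _ _) a b

/-- Since the speed has a constant sign and stays away from zero, a level is met at most once. For
`c = 0` and `c = 1` this makes the jumps of `l'` negligible in integrals along trajectories. -/
theorem ae_traj_ne {X : ℝ → ℝ} (hX : IsTraj l X) (c : ℝ) : ∀ᵐ s, X s ≠ c := by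
  have : Set.Subsingleton {s | X s = c} := fun a ha b hb =>
    hl.traj_injective hX (Eq.trans ha (Eq.symm hb))
  simpa using (measure_eq_zero_iff_ae_notMem.1 (this.measure_zero volume))

theorem continuousAt_deriv_flow (q : ℝ × ℝ) :
    ∀ᵐ s, ContinuousAt (fun q : ℝ × ℝ => l' s (flow l q.1 q.2 s)) q := by
  filter_upwards [hl.ae_traj_ne (hl.isTraj_flow q.1 q.2) 0,
    hl.ae_traj_ne (hl.isTraj_flow q.1 q.2) 1] with s h0 h1
  have hc : Continuous fun q : ℝ × ℝ => (s, flow l q.1 q.2 s) :=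
    continuous_const.prodMk (hl.continuous_flow.comp
      (by fun_prop : Continuous fun q : ℝ × ℝ => (q.1, q.2, s)))
  exact ContinuousAt.comp (f := fun q : ℝ × ℝ => (s, flow l q.1 q.2 s))
    (g := fun q : ℝ × ℝ => l' q.1 q.2) (hl.contDeriv s _ h0 h1) hc.continuousAt

theorem continuous_integral_deriv {E : Type*} [TopologicalSpace E] [FirstCountableTopology E]
    {q : E → ℝ × ℝ} {a b : E → ℝ} (hq : Continuous q) (ha : Continuous a) (hb : Continuous b) :
    Continuous fun P => ∫ s in a P..b P, l' s (flow l (q P).1 (q P).2 s) := by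
  rw [continuous_iff_continuousAt]
  intro P
  rw [← continuousWithinAt_univ]
  refine continuousWithinAt_integral (C := C) (fun _ _ => hl.boundDeriv _ _)
    (fun P => hl.measurable_deriv_traj (hl.isTraj_flow _ _).continuous) ?_
    ha.continuousWithinAt hb.continuousWithinAt
  filter_upwards [hl.continuousAt_deriv_flow (q P)] with s hs
  exact (ContinuousAt.comp (f := q) hs hq.continuousAt).continuousWithinAt

theorem continuous_amp : Continuous fun q : ℝ × ℝ => amp l l' q.1 q.2 :=
  (hl.continuous_integral_deriv continuous_id continuous_fst hl.continuous_hit).rexp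

/-- The integrand vanishes unless `X s ∈ [0, 1]`, and a speed of modulus at least `ε` confines such
times to the window of length `2 / ε` around the hitting time. The bound does not depend on `a` and
`b`, so `amp` is bounded above and away from zero for all times. -/
theorem abs_integral_deriv_le {X : ℝ → ℝ} (hX : IsTraj l X) (a b : ℝ) :
    |∫ s in a..b, l' s (X s)| ≤ 2 * C / ε := by
  set T := hit l 0 (X 0)
  have hT : X T = 0 := hl.traj_hit hX 0
  have hε := hl.pos
  have hb : ∀ s, |l' s (X s)| ≤ (Icc (T - 1 / ε) (T + 1 / ε)).indicator (fun _ => C) s := by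
    intro s
    by_cases hs : s ∈ Icc (T - 1 / ε) (T + 1 / ε)
    · rw [indicator_of_mem hs]; exact hl.boundDeriv _ _
    · rw [indicator_of_notMem hs, hl.support, abs_zero]
      intro hXs
      refine hs ?_
      have h1 := hl.traj_expand hX T s
      rw [hT, sub_zero, abs_of_nonneg hXs.1] at h1
      have h2 : |s - T| ≤ 1 / ε := by
        rw [le_div_iff₀ hε]; linarith [hXs.2]
      have := abs_le.1 h2
      exact ⟨by linarith [this.1], by linarith [this.2]⟩
  have hint : Integrable ((Icc (T - 1 / ε) (T + 1 / ε)).indicator (fun _ => C)) volume :=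
    (integrable_indicator_iff measurableSet_Icc).2 (integrableOn_const (by simp))
  calc |∫ s in a..b, l' s (X s)| ≤ ∫ s in uIoc a b, |l' s (X s)| :=
        intervalIntegral.norm_integral_le_integral_norm_uIoc (f := fun s => l' s (X s))
    _ ≤ ∫ s in uIoc a b, (Icc (T - 1 / ε) (T + 1 / ε)).indicator (fun _ => C) s :=
        integral_mono_of_nonneg (Eventually.of_forall fun _ => abs_nonneg _) hint.integrableOn
          (Eventually.of_forall hb)
    _ ≤ ∫ s, (Icc (T - 1 / ε) (T + 1 / ε)).indicator (fun _ => C) s :=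
        setIntegral_le_integral hint (Eventually.of_forall fun s =>
          indicator_nonneg (fun _ _ => hl.C_nonneg) s)
    _ = 2 * C / ε := by
        rw [integral_indicator measurableSet_Icc, setIntegral_const, measureReal_def,
          Real.volume_Icc, ENNReal.toReal_ofReal (by have : 0 < 1 / ε := by positivity
                                                     linarith), smul_eq_mul]
        ring

theorem amp_le (t x : ℝ) : amp l l' t x ≤ Real.exp (2 * C / ε) :=
  Real.exp_le_exp.2 ((le_abs_self _).trans (hl.abs_integral_deriv_le (hl.isTraj_flow t x) _ _))

theorem le_amp (t x : ℝ) : Real.exp (-(2 * C / ε)) ≤ amp l l' t x :=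
  Real.exp_le_exp.2 (abs_le.1 (hl.abs_integral_deriv_le (hl.isTraj_flow t x) _ _)).1

theorem amp_traj {X : ℝ → ℝ} (hX : IsTraj l X) (s : ℝ) :
    amp l l' s (X s) = Real.exp (∫ r in s..hit l 0 (X 0), l' r (X r)) := by
  rw [amp, hl.flow_eq hX, hl.hit_traj hX s 0]

/-- Along a trajectory the upper limit in `amp` is constant, so only the lower limit moves. -/
theorem hasDerivAt_amp_traj {X : ℝ → ℝ} (hX : IsTraj l X) {s : ℝ} (h0 : X s ≠ 0) (h1 : X s ≠ 1) :
    HasDerivAt (fun s => amp l l' s (X s)) (-l' s (X s) * amp l l' s (X s)) s := by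
  have hc : ContinuousAt (fun s => l' s (X s)) s :=
    ContinuousAt.comp (f := fun s => (s, X s)) (g := fun q : ℝ × ℝ => l' q.1 q.2)
      (hl.contDeriv s _ h0 h1) (continuousAt_id.prodMk hX.continuous.continuousAt)
  have hm := hl.measurable_deriv_traj hX.continuous
  have := (intervalIntegral.integral_hasDerivAt_left
    (hl.intervalIntegrable_deriv hX.continuous s (hit l 0 (X 0)))
    (hm.stronglyMeasurable.stronglyMeasurableAtFilter) hc).exp
  simp_rw [hl.amp_traj hX]
  rw [mul_comm]
  exact this

theorem lipschitz_amp_traj {X : ℝ → ℝ} (hX : IsTraj l X) :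
    ∃ K, LipschitzWith K (fun s => amp l l' s (X s)) := by
  set T := hit l 0 (X 0)
  have hi := hl.intervalIntegrable_deriv hX.continuous
  refine ⟨(Real.exp (2 * C / ε) * C).toNNReal, LipschitzWith.of_dist_le_mul fun a b => ?_⟩
  rw [Real.coe_toNNReal _ (mul_nonneg (Real.exp_pos _).le hl.C_nonneg), Real.dist_eq, Real.dist_eq,
    hl.amp_traj hX, hl.amp_traj hX]
  have hexp : ∀ u ≤ 2 * C / ε, ∀ v ≤ 2 * C / ε,
      |Real.exp u - Real.exp v| ≤ Real.exp (2 * C / ε) * |u - v| := by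
    intro u hu v hv
    have := Convex.norm_image_sub_le_of_norm_hasDerivWithin_le (f := Real.exp) (f' := Real.exp)
      (s := Iic (2 * C / ε)) (C := Real.exp (2 * C / ε)) (x := v) (y := u)
      (fun s _ => (Real.hasDerivAt_exp s).hasDerivWithinAt)
      (fun s hs => by rw [Real.norm_eq_abs, Real.abs_exp]; exact Real.exp_le_exp.2 hs)
      (convex_Iic _) hv hu
    simpa using this
  have hle : ∀ s, ∫ r in s..T, l' r (X r) ≤ 2 * C / ε := fun s =>
    (le_abs_self _).trans (hl.abs_integral_deriv_le hX s T)
  refine (hexp _ (hle a) _ (hle b)).trans ?_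
  rw [mul_assoc]
  gcongr
  rw [← intervalIntegral.integral_add_adjacent_intervals (hi a b) (hi b T), add_sub_cancel_right,
    abs_sub_comm]
  exact abs_integral_le_of_bounded (fun _ => hl.boundDeriv _ _) a b

/-- By `traj_sub` the difference quotient is exactly the exponential of an integral of secant slopes
of `l`. These are bounded by `C` and converge to `l'` at almost every time, so dominated convergence
applies despite the jumps of `l'`. -/
theorem hasDerivAt_flow (t x s : ℝ) : HasDerivAt (fun y => flow l t y s)
    (Real.exp (∫ r in t..s, l' r (flow l t x r))) x := by
  rw [hasDerivAt_iff_tendsto_slope]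
  set X := flow l t x
  have hX : IsTraj l X := hl.isTraj_flow t x
  have hne : ∀ y, y ≠ x → flow l t y t ≠ X t := by
    intro y hy
    rwa [hl.flow_self, show X t = x from hl.flow_self t x]
  have hlim : Tendsto (fun y => ∫ r in t..s,
      (l r (flow l t y r) - l r (X r)) / (flow l t y r - X r)) (𝓝[≠] x)
      (𝓝 (∫ r in t..s, l' r (X r))) := by
    refine intervalIntegral.tendsto_integral_filter_of_dominated_convergence (fun _ => C) ?_ ?_
      intervalIntegrable_const ?_
    · filter_upwards [self_mem_nhdsWithin] with y hy
      exact (hl.traj_sub (hl.isTraj_flow t y) hX (hne y hy)).2.1.aestronglyMeasurable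
    · filter_upwards [self_mem_nhdsWithin] with y hy
      refine Eventually.of_forall fun r _ => ?_
      have := (hl.traj_sub (hl.isTraj_flow t y) hX (hne y hy)).1 r
      rw [Real.norm_eq_abs, abs_div, div_le_iff₀ (abs_pos.2 (sub_ne_zero.2 this))]
      exact hl.lip _ _ _
    · filter_upwards [hl.ae_traj_ne hX 0, hl.ae_traj_ne hX 1] with r h0 h1 _
      have h := (hasDerivAt_iff_tendsto_slope.1 (hl.hasDeriv r _ h0 h1))
      have hcont : Continuous fun y => flow l t y r := hl.continuous_flow.comp
        (by fun_prop : Continuous fun y : ℝ => (t, y, r))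
      have h2 : Tendsto (fun y => flow l t y r) (𝓝[≠] x) (𝓝[≠] (X r)) := by
        refine tendsto_nhdsWithin_iff.2 ⟨hcont.continuousAt.mono_left nhdsWithin_le_nhds, ?_⟩
        filter_upwards [self_mem_nhdsWithin] with y hy
        exact (hl.traj_sub (hl.isTraj_flow t y) hX (hne y hy)).1 r
      refine (h.comp h2).congr fun y => ?_
      simp [slope_def_field]
  refine ((Real.continuous_exp.tendsto _).comp hlim).congr' ?_
  filter_upwards [self_mem_nhdsWithin] with y hy
  have := (hl.traj_sub (hl.isTraj_flow t y) hX (hne y hy)).2.2 s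
  rw [hl.flow_self, show X t = x from hl.flow_self t x] at this
  have hyx : y - x ≠ 0 := sub_ne_zero.2 hy
  rw [slope_def_field, show flow l t x s = X s from rfl, this]
  simp only [Function.comp]
  field_simp

/-- The mean value inequality for `r ↦ flow r - r * l t x`, whose derivative is small near the base
point. The expansion is uniform in the initial time and position, which yields the derivatives in
the initial time and of the hitting time. -/
theorem flow_isLittleO (t x : ℝ) :
    (fun q : ℝ × ℝ × ℝ => flow l q.1 q.2.1 q.2.2 - q.2.1 - (q.2.2 - q.1) * l t x)
      =o[𝓝 (t, x, t)] fun q => q.2.2 - q.1 := by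
  rw [Asymptotics.isLittleO_iff]
  intro η hη
  have hc : Continuous fun q : ℝ × ℝ × ℝ => l q.2.2 (flow l q.1 q.2.1 q.2.2) :=
    hl.cont.comp ((continuous_snd.comp continuous_snd).prodMk hl.continuous_flow)
  have hball : ∀ᶠ q : ℝ × ℝ × ℝ in 𝓝 (t, x, t),
      |l q.2.2 (flow l q.1 q.2.1 q.2.2) - l t x| < η := by
    have := hc.tendsto (t, x, t)
    simp only [hl.flow_self] at this
    have := (tendsto_iff_dist_tendsto_zero.1 this).eventually (gt_mem_nhds hη)
    simpa [Real.dist_eq] using this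
  obtain ⟨δ, hδ, hball⟩ := Metric.eventually_nhds_iff_ball.1 hball
  refine Metric.eventually_nhds_iff_ball.2 ⟨δ, hδ, ?_⟩
  rintro ⟨t', x', s⟩ hq
  rw [← ball_prod_same, ← ball_prod_same] at hq
  obtain ⟨h1, h2, h3⟩ := hq
  have hseg : ∀ r ∈ uIcc t' s, r ∈ Metric.ball t δ := by
    intro r hr
    rw [Real.ball_eq_Ioo] at h1 h3 ⊢
    exact ordConnected_Ioo.uIcc_subset h1 h3 hr
  have hd : ∀ r ∈ uIcc t' s, HasDerivWithinAt (fun r => flow l t' x' r - r * l t x)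
      (l r (flow l t' x' r) - l t x) (uIcc t' s) r := by
    intro r _
    have := (hl.isTraj_flow t' x' r).sub ((hasDerivAt_id r).mul_const (l t x))
    convert! this.hasDerivWithinAt using 1
    simp
  have := Convex.norm_image_sub_le_of_norm_hasDerivWithin_le (C := η) hd (fun r hr => by
    have := hball (t', x', r) (by
      rw [← ball_prod_same, ← ball_prod_same]; exact ⟨h1, h2, hseg r hr⟩)
    exact this.le) (convex_uIcc _ _) left_mem_uIcc right_mem_uIcc
  rw [hl.flow_self] at this
  convert! this using 2
  simp only
  ring

/-- At the time `hit l T y` the flow is zero, so its expansion reads `0 = y + (hit l T y - T) * l T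
0 + o(y)`. -/
theorem hasDerivAt_hit_zero (T : ℝ) : HasDerivAt (hit l T) (-(1 / l T 0)) 0 := by
  have hc : Continuous fun y => hit l T y := hl.continuous_hit.comp
    (by fun_prop : Continuous fun y : ℝ => (T, y))
  have ht : Tendsto (fun y => (T, y, hit l T y)) (𝓝 0) (𝓝 (T, 0, T)) := by
    have : Continuous fun y => (T, y, hit l T y) := by fun_prop
    simpa [hl.hit_zero] using this.tendsto 0
  have h1 := (hl.flow_isLittleO T 0).comp_tendsto ht
  have h2 : (fun y => hit l T y - T) =O[𝓝 0] fun y : ℝ => y := by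
    refine Asymptotics.IsBigO.of_bound (1 / ε) (Eventually.of_forall fun y => ?_)
    have := hl.abs_hit_sub_le T y
    have hε := hl.pos
    rw [Real.norm_eq_abs, Real.norm_eq_abs, one_div, inv_mul_eq_div, le_div_iff₀ hε]
    linarith
  have h3 := (h1.trans_isBigO h2).const_mul_left (-(1 / l T 0))
  rw [hasDerivAt_iff_isLittleO]
  simp only [hl.hit_zero, sub_zero, smul_eq_mul]
  refine h3.congr_left fun y => ?_
  simp only [Function.comp, hl.flow_hit]
  have := hl.ne_zero T 0
  field_simp
  ring

theorem hit_flow (t x s : ℝ) : hit l s (flow l t x s) = hit l t x := by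
  have := hl.hit_traj (hl.isTraj_flow t x) s t
  rwa [hl.flow_self] at this

/-- The label can be read at the time `T` when the trajectory is at `0`. The chain rule then reduces
to `hasDerivAt_hit_zero`, and the derivative of the flow from `t` to `T` is `amp`. -/
theorem hasDerivAt_hit (t x : ℝ) :
    HasDerivAt (hit l t) (-(amp l l' t x / l (hit l t x) 0)) x := by
  set T := hit l t x
  have h0 : flow l t x T = 0 := hl.flow_hit t x
  have h1 := hl.hasDerivAt_hit_zero T
  rw [← h0] at h1
  have h2 := h1.comp x (hl.hasDerivAt_flow t x T)
  have e : (hit l T ∘ fun y => flow l t y T) = hit l t := by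
    funext y
    exact hl.hit_flow t y T
  rw [e, h0] at h2
  convert! h2 using 1
  rw [amp]
  ring

theorem hasFDerivAt_flow_time (t x : ℝ) :
    HasFDerivAt (fun q : ℝ × ℝ => flow l q.1 q.2 t)
      (ContinuousLinearMap.snd ℝ ℝ ℝ - l t x • ContinuousLinearMap.fst ℝ ℝ ℝ) (t, x) := by
  rw [hasFDerivAt_iff_isLittleO]
  have ht : Tendsto (fun q : ℝ × ℝ => (q.1, q.2, t)) (𝓝 (t, x)) (𝓝 (t, x, t)) :=
    (by fun_prop : Continuous fun q : ℝ × ℝ => (q.1, q.2, t)).tendsto _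
  have h1 := (hl.flow_isLittleO t x).comp_tendsto ht
  have h2 : (fun q : ℝ × ℝ => t - q.1) =O[𝓝 (t, x)] fun q => q - (t, x) := by
    refine Asymptotics.IsBigO.of_bound 1 (Eventually.of_forall fun q => ?_)
    rw [one_mul, ← neg_sub, norm_neg]
    exact norm_fst_le (q - (t, x))
  refine (h1.trans_isBigO h2).congr_left fun q => ?_
  simp only [Function.comp, hl.flow_self]
  simp
  ring

/-- The (joint) derivative of the hitting time. -/
theorem hasFDerivAt_hit (t x : ℝ) : HasFDerivAt (fun q : ℝ × ℝ => hit l q.1 q.2)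
    ((-(amp l l' t x / l (hit l t x) 0)) •
      (ContinuousLinearMap.snd ℝ ℝ ℝ - l t x • ContinuousLinearMap.fst ℝ ℝ ℝ)) (t, x) := by
  have h1 := hl.hasDerivAt_hit t x
  have h0 : flow l t x t = x := hl.flow_self t x
  rw [← h0] at h1
  have h2 := HasDerivAt.comp_hasFDerivAt (t, x) h1 (hl.hasFDerivAt_flow_time t x)
  have e : (hit l t ∘ fun q : ℝ × ℝ => flow l q.1 q.2 t) = fun q : ℝ × ℝ => hit l q.1 q.2 := by
    funext q
    exact hl.hit_flow q.1 q.2 t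
  rw [e, h0] at h2
  exact h2

theorem contDiff_hit : ContDiff ℝ 1 fun q : ℝ × ℝ => hit l q.1 q.2 := by
  refine contDiff_one_iff_hasFDerivAt.2 ⟨_, ?_, fun q => hl.hasFDerivAt_hit q.1 q.2⟩
  have h1 := hl.continuous_amp
  have h2 : Continuous fun q : ℝ × ℝ => l (hit l q.1 q.2) 0 :=
    hl.cont.comp (hl.continuous_hit.prodMk continuous_const)
  have h3 := hl.cont
  exact ((h1.div h2 fun q => hl.ne_zero _ _).neg).smul
    (continuous_const.sub (h3.smul continuous_const))

theorem hasDerivAt_hit_comp {Y : ℝ → ℝ} {v s : ℝ} (hY : HasDerivAt Y v s) :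
    HasDerivAt (fun s => hit l s (Y s))
      (-(amp l l' s (Y s) / l (hit l s (Y s)) 0) * (v - l s (Y s))) s := by
  have := (hl.hasFDerivAt_hit s (Y s)).comp_hasDerivAt s ((hasDerivAt_id s).prodMk hY)
  simpa [Function.comp_def] using this

/-- The flow is split at the fixed time `s`: the dependence on the initial point up to time `s` is a
composition of known derivatives, and the short remaining piece is expanded by `flow_isLittleO`. -/
theorem hasFDerivAt_flow (t x s : ℝ) :
    HasFDerivAt (fun q : ℝ × ℝ × ℝ => flow l q.1 q.2.1 q.2.2)
      (Real.exp (∫ r in t..s, l' r (flow l t x r)) •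
        ((ContinuousLinearMap.snd ℝ ℝ ℝ - l t x • ContinuousLinearMap.fst ℝ ℝ ℝ).comp
          ((ContinuousLinearMap.fst ℝ ℝ (ℝ × ℝ)).prod
            ((ContinuousLinearMap.fst ℝ ℝ ℝ).comp (ContinuousLinearMap.snd ℝ ℝ (ℝ × ℝ))))) +
        l s (flow l t x s) •
          ((ContinuousLinearMap.snd ℝ ℝ ℝ).comp (ContinuousLinearMap.snd ℝ ℝ (ℝ × ℝ)))) (t, x, s) := by
  set A := ContinuousLinearMap.snd ℝ ℝ ℝ - l t x • ContinuousLinearMap.fst ℝ ℝ ℝ with hA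
  set p := (ContinuousLinearMap.fst ℝ ℝ (ℝ × ℝ)).prod
    ((ContinuousLinearMap.fst ℝ ℝ ℝ).comp (ContinuousLinearMap.snd ℝ ℝ (ℝ × ℝ))) with hp
  set z := (ContinuousLinearMap.snd ℝ ℝ ℝ).comp (ContinuousLinearMap.snd ℝ ℝ (ℝ × ℝ)) with hz
  have h1 : HasFDerivAt (fun q : ℝ × ℝ × ℝ => flow l q.1 q.2.1 t) (A.comp p) (t, x, s) :=
    HasFDerivAt.comp (g := fun q : ℝ × ℝ => flow l q.1 q.2 t) (f := p) (t, x, s)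
      (hl.hasFDerivAt_flow_time t x) p.hasFDerivAt
  have h2 : HasFDerivAt (fun q : ℝ × ℝ × ℝ => flow l q.1 q.2.1 s)
      (Real.exp (∫ r in t..s, l' r (flow l t x r)) • A.comp p) (t, x, s) := by
    have h3 : HasDerivAt (fun y => flow l t y s) (Real.exp (∫ r in t..s, l' r (flow l t x r)))
      (flow l t x t) := by rw [hl.flow_self]; exact hl.hasDerivAt_flow t x s
    have := HasDerivAt.comp_hasFDerivAt (t, x, s) h3 h1
    refine this.congr_of_eventuallyEq (Eventually.of_forall fun q => ?_)
    simp only [Function.comp]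
    rw [hl.flow_eq (hl.isTraj_flow q.1 q.2.1)]
  have ht : Tendsto (fun q : ℝ × ℝ × ℝ => (s, flow l q.1 q.2.1 s, q.2.2)) (𝓝 (t, x, s))
      (𝓝 (s, flow l t x s, s)) := by
    have hc : Continuous fun q : ℝ × ℝ × ℝ => flow l q.1 q.2.1 s := hl.continuous_flow.comp
      (by fun_prop : Continuous fun q : ℝ × ℝ × ℝ => (q.1, q.2.1, s))
    exact (by fun_prop : Continuous fun q : ℝ × ℝ × ℝ => (s, flow l q.1 q.2.1 s, q.2.2)).tendsto _
  have h3 := (hl.flow_isLittleO s (flow l t x s)).comp_tendsto ht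
  have h4 : (fun q : ℝ × ℝ × ℝ => q.2.2 - s) =O[𝓝 (t, x, s)] fun q => q - (t, x, s) := by
    refine Asymptotics.IsBigO.of_bound 1 (Eventually.of_forall fun q => ?_)
    rw [one_mul]
    exact (norm_snd_le (q - (t, x, s)).2).trans (norm_snd_le (q - (t, x, s)))
  have h5 := (h3.trans_isBigO h4).add h2.isLittleO
  rw [hasFDerivAt_iff_isLittleO]
  refine h5.congr_left fun q => ?_
  simp only [Function.comp]
  rw [hl.flow_eq (hl.isTraj_flow q.1 q.2.1)]
  simp [hz]
  ring

theorem contDiff_flow : ContDiff ℝ 1 fun q : ℝ × ℝ × ℝ => flow l q.1 q.2.1 q.2.2 := by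
  refine contDiff_one_iff_hasFDerivAt.2 ⟨_, ?_, fun q => hl.hasFDerivAt_flow q.1 q.2.1 q.2.2⟩
  have h1 : Continuous fun q : ℝ × ℝ × ℝ =>
      Real.exp (∫ r in q.1..q.2.2, l' r (flow l q.1 q.2.1 r)) :=
    (hl.continuous_integral_deriv (q := fun q : ℝ × ℝ × ℝ => (q.1, q.2.1)) (by fun_prop)
      (by fun_prop) (by fun_prop)).rexp
  have h2 : Continuous fun q : ℝ × ℝ × ℝ => l q.1 q.2.1 :=
    hl.cont.comp (by fun_prop : Continuous fun q : ℝ × ℝ × ℝ => (q.1, q.2.1))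
  have h3 : Continuous fun q : ℝ × ℝ × ℝ => l q.2.2 (flow l q.1 q.2.1 q.2.2) :=
    hl.cont.comp ((continuous_snd.comp continuous_snd).prodMk hl.continuous_flow)
  exact (h1.smul ((continuous_const.sub (h2.smul continuous_const)).clm_comp
    continuous_const)).add (h3.smul continuous_const)

end Speed

/-! ### Weighted contractions and two integral lemmas. -/

/-- A map which halves a weighted distance has a fixed point in every class of functions that is
stable under uniform limits. -/
theorem exists_fixedPoint_of_weight {α : Type*} {S : Set (α → ℝ)}
    (hS : ∀ (u : ℕ → α → ℝ) (v : α → ℝ), (∀ n, u n ∈ S) → TendstoUniformly u v atTop → v ∈ S)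
    {T : (α → ℝ) → α → ℝ} (hT : ∀ u ∈ S, T u ∈ S) {W : α → ℝ} {B : ℝ} (hW : ∀ a, W a ≤ B)
    (hcontr : ∀ u ∈ S, ∀ v ∈ S, ∀ K, 0 ≤ K → (∀ a, |u a - v a| ≤ K * W a) →
      ∀ a, |T u a - T v a| ≤ K / 2 * W a)
    {u₀ : α → ℝ} (h₀ : u₀ ∈ S) {K : ℝ} (hK : 0 ≤ K) (hK₀ : ∀ a, |u₀ a - T u₀ a| ≤ K * W a) :
    ∃ u ∈ S, T u = u := by
  set u : ℕ → α → ℝ := fun n => T^[n] u₀ with hu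
  have hsucc : ∀ n, u (n + 1) = T (u n) := fun n => Function.iterate_succ_apply' T n u₀
  have huS : ∀ n, u n ∈ S := by
    intro n
    induction n with
    | zero => exact h₀
    | succ n ih => rw [hsucc]; exact hT _ ih
  have hstep : ∀ n a, |u n a - u (n + 1) a| ≤ K / 2 ^ n * W a := by
    intro n
    induction n with
    | zero => simpa [hu] using hK₀
    | succ n ih =>
      have := hcontr _ (huS n) _ (huS (n + 1)) _ (by positivity) ih
      intro a
      rw [hsucc, hsucc (n + 1)]
      convert this a using 2
      rw [pow_succ]; field_simp
  have hdist : ∀ a n, dist (u n a) (u (n + 1) a) ≤ (2 * K * B) / 2 / 2 ^ n := by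
    intro a n
    rw [Real.dist_eq]
    refine (hstep n a).trans ?_
    have : K / 2 ^ n * W a ≤ K / 2 ^ n * B := mul_le_mul_of_nonneg_left (hW a) (by positivity)
    refine this.trans (le_of_eq ?_)
    field_simp
  choose v hv using fun a =>
    cauchySeq_tendsto_of_complete (cauchySeq_of_le_geometric_two (hdist a))
  have hlim : ∀ n a, |u n a - v a| ≤ 2 * K * B / 2 ^ n := by
    intro n a
    exact dist_le_of_le_geometric_two_of_tendsto (hdist a) (hv a) n
  have hgeo : Tendsto (fun n : ℕ => 2 * K * B / 2 ^ n) atTop (𝓝 0) := by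
    have := (tendsto_pow_atTop_nhds_zero_of_lt_one (r := (1 / 2 : ℝ)) (by norm_num)
      (by norm_num)).const_mul (2 * K * B)
    simpa [div_eq_mul_inv] using this
  have hunif : TendstoUniformly u v atTop := by
    rw [Metric.tendstoUniformly_iff]
    intro η hη
    filter_upwards [hgeo.eventually (gt_mem_nhds hη)] with n hn a
    rw [dist_comm]
    exact (hlim n a).trans_lt hn
  have hvS : v ∈ S := hS u v huS hunif
  -- The uniform bound `hlim` is not enough here: comparing `T (u n)` with `T v` requires the
  -- distance relative to `W`, and `W` may vanish.
  have hWlim : ∀ n a, |u n a - v a| ≤ 2 * K / 2 ^ n * W a := by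
    intro n a
    have hd : ∀ k, dist (u (n + k) a) (u (n + (k + 1)) a) ≤
        (2 * (K / 2 ^ n * W a)) / 2 / 2 ^ k := by
      intro k
      have := hstep (n + k) a
      rw [Real.dist_eq, ← add_assoc]
      refine this.trans (le_of_eq ?_)
      rw [pow_add]; field_simp
    have := dist_le_of_le_geometric_two_of_tendsto₀ (f := fun k => u (n + k) a) hd
      ((tendsto_add_atTop_iff_nat n).2 (hv a) |>.congr fun k => by rw [add_comm])
    simp only [add_zero, Real.dist_eq] at this
    refine this.trans (le_of_eq ?_)
    ring
  refine ⟨v, hvS, funext fun a => ?_⟩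
  have h1 : ∀ n, |u (n + 1) a - T v a| ≤ 2 * K * B / 2 ^ (n + 1) := by
    intro n
    have := hcontr _ (huS n) _ hvS _ (by positivity) (hWlim n) a
    rw [hsucc]
    refine this.trans ?_
    have : 2 * K / 2 ^ n / 2 * W a ≤ 2 * K / 2 ^ n / 2 * B :=
      mul_le_mul_of_nonneg_left (hW a) (by positivity)
    refine this.trans (le_of_eq ?_)
    rw [pow_succ]; field_simp
  have h2 : Tendsto (fun n => u (n + 1) a) atTop (𝓝 (T v a)) := by
    rw [tendsto_iff_dist_tendsto_zero]
    exact squeeze_zero (fun _ => dist_nonneg) h1 ((tendsto_add_atTop_iff_nat 1).2 hgeo)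
  exact tendsto_nhds_unique h2 ((tendsto_add_atTop_iff_nat 1).2 (hv a))

theorem abs_integral_le_of_exp_decay {f : ℝ → ℝ} {A κ a b : ℝ} (hκ : 0 < κ) (hA : 0 ≤ A)
    (hf : ∀ s ∈ uIoc a b, |f s| ≤ A * Real.exp (-(κ * |s - a|))) :
    |∫ s in a..b, f s| ≤ A / κ := by
  rcases le_total a b with hab | hab
  · have hd : ∀ s ∈ uIcc a b, HasDerivAt (fun s => -(A / κ) * Real.exp (-(κ * (s - a))))
        (A * Real.exp (-(κ * (s - a)))) s := by
      intro s _
      have := ((((hasDerivAt_id s).sub_const a).const_mul κ).neg.exp).const_mul (-(A / κ))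
      convert! this using 1
      simp only [id, Pi.neg_apply]
      field_simp
    have hc : Continuous fun s => A * Real.exp (-(κ * (s - a))) := by fun_prop
    have h := intervalIntegral.norm_integral_le_of_norm_le (f := f) (g := fun s =>
      A * Real.exp (-(κ * (s - a)))) hab (μ := volume) (Eventually.of_forall fun s hs => by
        have := hf s (by rwa [uIoc_of_le hab])
        rwa [abs_of_nonneg (sub_nonneg.2 hs.1.le)] at this) (hc.intervalIntegrable _ _)
    rw [intervalIntegral.integral_eq_sub_of_hasDerivAt hd (hc.intervalIntegrable _ _)] at h
    refine h.trans ?_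
    have : 0 ≤ A / κ * Real.exp (-(κ * (b - a))) := by positivity
    simp only [sub_self, mul_zero, neg_zero, Real.exp_zero]
    linarith
  · have hd : ∀ s ∈ uIcc b a, HasDerivAt (fun s => (A / κ) * Real.exp (κ * (s - a)))
        (A * Real.exp (κ * (s - a))) s := by
      intro s _
      have := ((((hasDerivAt_id s).sub_const a).const_mul κ).exp).const_mul (A / κ)
      convert! this using 1
      simp only [id]
      field_simp
    have hc : Continuous fun s => A * Real.exp (κ * (s - a)) := by fun_prop
    have h := intervalIntegral.norm_integral_le_of_norm_le (f := f) (g := fun s =>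
      A * Real.exp (κ * (s - a))) hab (μ := volume) (Eventually.of_forall fun s hs => by
        have := hf s (by rwa [uIoc_of_ge hab])
        rwa [abs_of_nonpos (sub_nonpos.2 hs.2), mul_neg, neg_neg] at this)
        (hc.intervalIntegrable _ _)
    rw [intervalIntegral.integral_eq_sub_of_hasDerivAt hd (hc.intervalIntegrable _ _)] at h
    rw [intervalIntegral.integral_symm, abs_neg]
    refine h.trans ?_
    have : 0 ≤ A / κ * Real.exp (κ * (b - a)) := by positivity
    simp only [sub_self, mul_zero, Real.exp_zero]
    linarith

/-- Product of a Lipschitz function and a primitive. -/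
theorem mul_sub_mul_eq_integral {g g' v φ : ℝ → ℝ} {a b : ℝ} (hab : a ≤ b)
    {K : NNReal} (hg : LipschitzWith K g)
    (hg' : ∀ᵐ s, s ∈ Icc a b → HasDerivAt g (g' s) s) (hφ : IntervalIntegrable φ volume a b)
    (hv : ∀ s ∈ Icc a b, v s = v a - ∫ r in a..s, φ r) :
    g b * v b - g a * v a = ∫ s in a..b, (g' s * v s - g s * φ s) := by
  set V : ℝ → ℝ := fun s => v a - ∫ r in a..s, φ r
  have hgac : AbsolutelyContinuousOnInterval g a b :=
    (hg.lipschitzOnWith (s := uIcc a b)).absolutelyContinuousOnInterval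
  have hca : AbsolutelyContinuousOnInterval (fun _ : ℝ => v a) a b :=
    ((LipschitzWith.const (v a)).lipschitzOnWith (s := uIcc a b)).absolutelyContinuousOnInterval
  have hVac : AbsolutelyContinuousOnInterval V a b :=
    hca.sub (hφ.absolutelyContinuousOnInterval_intervalIntegral (by simp))
  have h := hgac.integral_deriv_mul_eq_sub hVac
  have e1 : V a = v a := by simp [V]
  have e2 : V b = v b := (hv b ⟨hab, le_rfl⟩).symm
  rw [e1, e2] at h
  rw [← h]
  refine intervalIntegral.integral_congr_ae ?_
  filter_upwards [hg', hφ.ae_hasDerivAt_integral] with s hs1 hs2 hs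
  have hs' : s ∈ uIcc a b := uIoc_subset_uIcc hs
  have hs'' : s ∈ Icc a b := by rwa [uIcc_of_le hab] at hs'
  have hV := (hs2 hs' a (by simp)).const_sub (v a)
  rw [(hs1 hs'').deriv, show deriv V s = -φ s from hV.deriv, hv s hs'']
  ring

/-! ### Transversality of trajectories of separated speeds. -/

/-- The uniform rate at which trajectories of two separated speeds separate. -/
noncomputable def sepRate (ε C : ℝ) : ℝ := Real.exp (-(2 * C / ε)) / C * ε

theorem Speed.sepRate_pos {ε C σ : ℝ} {l l' : ℝ → ℝ → ℝ} (hl : Speed ε C σ l l') :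
    0 < sepRate ε C :=
  mul_pos (div_pos (Real.exp_pos _) hl.C_pos) hl.pos

namespace Speed

variable {ε C σ : ℝ} {l l' : ℝ → ℝ → ℝ} (hl : Speed ε C σ l l')
include hl

theorem le_amp_div (t x : ℝ) :
    Real.exp (-(2 * C / ε)) / C ≤ σ * (amp l l' t x / l (hit l t x) 0) := by
  have h1 := hl.sgn (hit l t x) 0
  have h2 := hl.le_amp t x
  have h3 := hl.pos
  have h4 : σ * l (hit l t x) 0 ≤ C := by
    refine (le_abs_self _).trans ?_
    rw [abs_mul, hl.abs_sigma, one_mul]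
    exact hl.bound _ _
  have h5 : σ * (amp l l' t x / l (hit l t x) 0) = amp l l' t x / (σ * l (hit l t x) 0) := by
    have h8 := hl.sq
    have h6 := hl.ne_zero (hit l t x) 0
    have h7 := hl.sigma_ne
    field_simp
    rw [pow_two, h8, one_mul]
  rw [h5]
  exact div_le_div₀ (amp_pos _ _ _ _).le h2 (by linarith) h4

/-- By `hasDerivAt_hit_comp` the derivative is the speed gap, at least `ε`, times a factor bounded
below by `le_amp_div`. -/
theorem increasesAt_hit_of_gt {m : ℝ → ℝ → ℝ} (h : ∀ t x, l t x + ε ≤ m t x) {Y : ℝ → ℝ}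
    (hY : IsTraj m Y) : IncreasesAt (sepRate ε C) (fun s => -σ * hit l s (Y s)) := by
  intro a b hab
  refine sub_ge_of_hasDerivAt (X := fun s => -σ * hit l s (Y s))
    (fun s => (hl.hasDerivAt_hit_comp (hY s)).const_mul (-σ)) (fun s => ?_) hab
  have h1 := hl.le_amp_div s (Y s)
  have h2 := h s (Y s)
  have h3 := hl.pos
  have h4 : 0 ≤ Real.exp (-(2 * C / ε)) / C := div_nonneg (Real.exp_pos _).le hl.C_nonneg
  have : sepRate ε C ≤ σ * (amp l l' s (Y s) / l (hit l s (Y s)) 0) * (m s (Y s) - l s (Y s)) :=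
    mul_le_mul h1 (by linarith) h3.le (h4.trans h1)
  linarith

theorem increasesAt_hit_of_lt {m : ℝ → ℝ → ℝ} (h : ∀ t x, m t x + ε ≤ l t x) {Y : ℝ → ℝ}
    (hY : IsTraj m Y) : IncreasesAt (sepRate ε C) (fun s => σ * hit l s (Y s)) := by
  intro a b hab
  refine sub_ge_of_hasDerivAt (X := fun s => σ * hit l s (Y s))
    (fun s => (hl.hasDerivAt_hit_comp (hY s)).const_mul σ) (fun s => ?_) hab
  have h1 := hl.le_amp_div s (Y s)
  have h2 := h s (Y s)
  have h3 := hl.pos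
  have h4 : 0 ≤ Real.exp (-(2 * C / ε)) / C := div_nonneg (Real.exp_pos _).le hl.C_nonneg
  have : sepRate ε C ≤ σ * (amp l l' s (Y s) / l (hit l s (Y s)) 0) * (l s (Y s) - m s (Y s)) :=
    mul_le_mul h1 (by linarith) h3.le (h4.trans h1)
  linarith

theorem ae_hit_ne {m : ℝ → ℝ → ℝ}
    (h : (∀ t x, l t x + ε ≤ m t x) ∨ (∀ t x, m t x + ε ≤ l t x)) {Y : ℝ → ℝ}
    (hY : IsTraj m Y) (c : ℝ) : ∀ᵐ s, hit l s (Y s) ≠ c := by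
  have hinj : Function.Injective fun s => hit l s (Y s) := by
    rcases h with h | h
    · intro a b hab
      exact (hl.increasesAt_hit_of_gt h hY).injective hl.sepRate_pos (by simp_all)
    · intro a b hab
      exact (hl.increasesAt_hit_of_lt h hY).injective hl.sepRate_pos (by simp_all)
  have : Set.Subsingleton {s | hit l s (Y s) = c} := fun a ha b hb =>
    hinj (Eq.trans ha (Eq.symm hb))
  simpa using (measure_eq_zero_iff_ae_notMem.1 (this.measure_zero volume))

end Speed

/-! ### Speeds of negative sign -/

namespace Speed

variable {ε C : ℝ} {l l' : ℝ → ℝ → ℝ} (hl : Speed ε C (-1) l l')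
include hl

theorem traj_strictAnti {X : ℝ → ℝ} (hX : IsTraj l X) : StrictAnti X := by
  intro a b hab
  have := (hl.increasesAt hX).strictMono hl.pos hab
  linarith

theorem hit_strictMono (t : ℝ) : StrictMono (hit l t) := by
  intro x y hxy
  have hX := hl.isTraj_flow t x
  have hY := hl.isTraj_flow t y
  have hlt : flow l t x (hit l t x) < flow l t y (hit l t x) := by
    have hne : flow l t y t ≠ flow l t x t := by
      rw [hl.flow_self, hl.flow_self]; exact hxy.ne'
    have := (hl.traj_sub hY hX hne).2.2 (hit l t x)
    rw [hl.flow_self, hl.flow_self] at this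
    have h0 : 0 < flow l t y (hit l t x) - flow l t x (hit l t x) := by
      rw [this]; exact mul_pos (sub_pos.2 hxy) (Real.exp_pos _)
    linarith
  rw [hl.flow_hit, ← hl.flow_hit t y] at hlt
  exact (hl.traj_strictAnti hY).lt_iff_gt.1 hlt

theorem le_hit {t x : ℝ} (hx : 0 ≤ x) : t ≤ hit l t x := by
  have := (hl.hit_strictMono t).monotone hx
  rwa [hl.hit_zero] at this

theorem hit_le {t x : ℝ} (hx : x ≤ 1) : hit l t x ≤ t + 1 / ε := by
  have hε := hl.pos
  rcases le_total 0 x with h | h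
  · have := hl.abs_hit_sub_le t x
    rw [abs_of_nonneg h, abs_of_nonneg (sub_nonneg.2 (hl.le_hit h))] at this
    have : hit l t x - t ≤ 1 / ε := by rw [le_div_iff₀ hε]; linarith
    linarith
  · have h1 := (hl.hit_strictMono t).monotone h
    rw [hl.hit_zero] at h1
    have : 0 < 1 / ε := by positivity
    linarith

end Speed

/-! ### Geometry of the characteristics of one row in the wedge. -/

/-- The wedge `0 ≤ ξ ≤ x ≤ 1`, for all real times. -/
def wedge : Set (ℝ × ℝ × ℝ) := {P | 0 ≤ P.2.2 ∧ P.2.2 ≤ P.2.1 ∧ P.2.1 ≤ 1}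

theorem isClosed_wedge : IsClosed wedge := by
  have h1 : IsClosed {P : ℝ × ℝ × ℝ | 0 ≤ P.2.2} := isClosed_le (by fun_prop) (by fun_prop)
  have h2 : IsClosed {P : ℝ × ℝ × ℝ | P.2.2 ≤ P.2.1} := isClosed_le (by fun_prop) (by fun_prop)
  have h3 : IsClosed {P : ℝ × ℝ × ℝ | P.2.1 ≤ 1} := isClosed_le (by fun_prop) (by fun_prop)
  exact h1.inter (h2.inter h3)

section Row

variable {ι : Type*}

/-- The speed `l j` exceeds `l i` by at least `ε`. -/
def IsAbove (ε : ℝ) (l : ι → ℝ → ℝ → ℝ) (i j : ι) : Prop := ∀ t x, l i t x + ε ≤ l j t x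

/-- A family of pairwise separated speeds, with a distinguished negative one. -/
structure RowSpeeds (ε C : ℝ) (i : ι) (σ : ι → ℝ) (l l' : ι → ℝ → ℝ → ℝ) : Prop where
  speed : ∀ j, Speed ε C (σ j) (l j) (l' j)
  neg : σ i = -1
  gap : ∀ j k, j ≠ k → IsAbove ε l j k ∨ IsAbove ε l k j

/-- The curve `s ↦ (s, X s, Y s)` through `P`, for `X` and `Y` trajectories of `l i` and `l j`. -/
noncomputable def charPath (l : ι → ℝ → ℝ → ℝ) (i j : ι) (P : ℝ × ℝ × ℝ) (s : ℝ) : ℝ × ℝ × ℝ :=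
  (s, flow (l i) P.1 P.2.1 s, flow (l j) P.1 P.2.2 s)

/-- The time at which the curve `charPath l i j P` meets the diagonal. -/
noncomputable def meet (l : ι → ℝ → ℝ → ℝ) (i j : ι) (P : ℝ × ℝ × ℝ) : ℝ :=
  Classical.epsilon fun s => hit (l i) s (flow (l j) P.1 P.2.2 s) = hit (l i) P.1 P.2.1

open Classical in
/-- The sign of `side j P` tells whether the value at `P` is transported from the face `ξ = 0`
(nonnegative sign) or from the diagonal (negative sign). -/
noncomputable def side (ε : ℝ) (σ : ι → ℝ) (l : ι → ℝ → ℝ → ℝ) (i j : ι) (P : ℝ × ℝ × ℝ) : ℝ :=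
  if j = i then 1
  else if IsAbove ε l i j ∧ σ j = -1 then hit (l i) P.1 P.2.1 - hit (l j) P.1 P.2.2
  else -1

/-- A function that grows along the curves `charPath`, in the direction in which the entries are
transported. -/
noncomputable def clock (δ : ℝ) (l : ι → ℝ → ℝ → ℝ) (i : ι) (P : ℝ × ℝ × ℝ) : ℝ :=
  (1 + δ) * (hit (l i) P.1 P.2.1 - P.1) - (hit (l i) P.1 P.2.2 - P.1)

theorem of_side_nonneg {ε : ℝ} {i : ι} {σ : ι → ℝ} {l : ι → ℝ → ℝ → ℝ} {j : ι} {P : ℝ × ℝ × ℝ}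
    (h : 0 ≤ side ε σ l i j P) :
    j = i ∨ (IsAbove ε l i j ∧ σ j = -1) ∧ hit (l j) P.1 P.2.2 ≤ hit (l i) P.1 P.2.1 := by
  unfold side at h
  split_ifs at h with h1 h2
  · exact Or.inl h1
  · exact Or.inr ⟨h2, by linarith⟩
  · norm_num at h

namespace RowSpeeds

variable {ε C : ℝ} {i : ι} {σ : ι → ℝ} {l l' : ι → ℝ → ℝ → ℝ} (H : RowSpeeds ε C i σ l l')
include H

theorem base : Speed ε C (-1) (l i) (l' i) := H.neg ▸ H.speed i

theorem eps_pos : 0 < ε := (H.speed i).pos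

theorem ne_of_isAbove {j k : ι} (h : IsAbove ε l j k) : j ≠ k := by
  rintro rfl
  have := h 0 0
  have := H.eps_pos
  linarith

theorem isAbove_of_pos {k : ι} (hk : σ k = 1) : IsAbove ε l i k := by
  intro t x
  have h1 := (H.speed k).sgn t x
  have h2 := H.base.sgn t x
  have := H.eps_pos
  rw [hk] at h1
  linarith

theorem continuous_path (j : ι) :
    Continuous fun q : (ℝ × ℝ × ℝ) × ℝ => charPath l i j q.1 q.2 := by
  refine continuous_snd.prodMk (Continuous.prodMk ?_ ?_)
  · exact (H.speed i).continuous_flow.comp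
      (by fun_prop : Continuous fun q : (ℝ × ℝ × ℝ) × ℝ => (q.1.1, q.1.2.1, q.2))
  · exact (H.speed j).continuous_flow.comp
      (by fun_prop : Continuous fun q : (ℝ × ℝ × ℝ) × ℝ => (q.1.1, q.1.2.2, q.2))

theorem flow_path_fst (j : ι) (P : ℝ × ℝ × ℝ) (s : ℝ) :
    flow (l i) (charPath l i j P s).1 (charPath l i j P s).2.1 = flow (l i) P.1 P.2.1 :=
  (H.speed i).flow_eq ((H.speed i).isTraj_flow _ _) s

theorem flow_path_snd (j : ι) (P : ℝ × ℝ × ℝ) (s : ℝ) :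
    flow (l j) (charPath l i j P s).1 (charPath l i j P s).2.2 = flow (l j) P.1 P.2.2 :=
  (H.speed j).flow_eq ((H.speed j).isTraj_flow _ _) s

theorem path_path (j : ι) (P : ℝ × ℝ × ℝ) (s : ℝ) :
    charPath l i j (charPath l i j P s) = charPath l i j P := by
  funext r
  unfold charPath
  have h1 := H.flow_path_fst j P s
  have h2 := H.flow_path_snd j P s
  unfold charPath at h1 h2
  rw [h1, h2]

theorem hit_path_fst (j : ι) (P : ℝ × ℝ × ℝ) (s : ℝ) :
    hit (l i) (charPath l i j P s).1 (charPath l i j P s).2.1 = hit (l i) P.1 P.2.1 :=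
  (H.speed i).hit_flow _ _ _

theorem hit_path_snd (j : ι) (P : ℝ × ℝ × ℝ) (s : ℝ) :
    hit (l j) (charPath l i j P s).1 (charPath l i j P s).2.2 = hit (l j) P.1 P.2.2 :=
  (H.speed j).hit_flow _ _ _

theorem meet_path (j : ι) (P : ℝ × ℝ × ℝ) (s : ℝ) :
    meet l i j (charPath l i j P s) = meet l i j P := by
  unfold meet
  rw [H.flow_path_snd, H.hit_path_fst]

theorem side_path (j : ι) (P : ℝ × ℝ × ℝ) (s : ℝ) :
    side ε σ l i j (charPath l i j P s) = side ε σ l i j P := by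
  unfold side
  rw [H.hit_path_fst, H.hit_path_snd]

theorem continuous_side (j : ι) : Continuous (side ε σ l i j) := by
  unfold side
  split_ifs
  · exact continuous_const
  · exact ((H.speed i).continuous_hit.comp
      (by fun_prop : Continuous fun P : ℝ × ℝ × ℝ => (P.1, P.2.1))).sub
      ((H.speed j).continuous_hit.comp
      (by fun_prop : Continuous fun P : ℝ × ℝ × ℝ => (P.1, P.2.2)))
  · exact continuous_const

theorem side_of_split {j : ι} (h : IsAbove ε l i j) (hσ : σ j = -1) (P : ℝ × ℝ × ℝ) :
    side ε σ l i j P = hit (l i) P.1 P.2.1 - hit (l j) P.1 P.2.2 := by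
  unfold side
  rw [if_neg (H.ne_of_isAbove h).symm, if_pos ⟨h, hσ⟩]

theorem side_of_pos {k : ι} (hk : σ k = 1) (P : ℝ × ℝ × ℝ) : side ε σ l i k P = -1 := by
  unfold side
  rw [if_neg, if_neg]
  · rintro ⟨-, h⟩
    rw [hk] at h
    norm_num at h
  · rintro rfl
    rw [H.neg] at hk
    norm_num at hk

theorem ne_of_side_neg {j : ι} {P : ℝ × ℝ × ℝ} (h : side ε σ l i j P < 0) : j ≠ i := by
  rintro rfl
  simp [side] at h
  linarith

theorem sigma_of_side_nonneg {j : ι} {P : ℝ × ℝ × ℝ} (h : 0 ≤ side ε σ l i j P) : σ j = -1 := by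
  rcases of_side_nonneg h with rfl | h
  · exact H.neg
  · exact h.1.2

/-- Position of the `j`-trajectory relative to the `i`-trajectories, increasing case. -/
theorem increasesAt_above {j : ι} (h : IsAbove ε l i j) {Y : ℝ → ℝ} (hY : IsTraj (l j) Y) :
    IncreasesAt (sepRate ε C) fun s => hit (l i) s (Y s) := by
  have := H.base.increasesAt_hit_of_gt h hY
  simpa using this

theorem increasesAt_below {j : ι} (h : IsAbove ε l j i) {Y : ℝ → ℝ} (hY : IsTraj (l j) Y) :
    IncreasesAt (sepRate ε C) fun s => -hit (l i) s (Y s) := by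
  have := H.base.increasesAt_hit_of_lt h hY
  simpa using this

/-- The curve meets the diagonal when the two trajectories have the same `l i`-label. Along the
`j`-trajectory this label is strictly monotone with a uniform rate, so it takes the required value.
-/
theorem meet_spec {j : ι} (hj : j ≠ i) (P : ℝ × ℝ × ℝ) :
    hit (l i) (meet l i j P) (flow (l j) P.1 P.2.2 (meet l i j P)) = hit (l i) P.1 P.2.1 := by
  refine Classical.epsilon_spec
    (p := fun s => hit (l i) s (flow (l j) P.1 P.2.2 s) = hit (l i) P.1 P.2.1) ?_
  have hY := (H.speed j).isTraj_flow P.1 P.2.2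
  have hc : Continuous fun s => hit (l i) s (flow (l j) P.1 P.2.2 s) :=
    H.base.continuous_hit.comp (continuous_id.prodMk hY.continuous)
  rcases H.gap i j hj.symm with h | h
  · have hI := H.increasesAt_above h hY
    obtain ⟨s, hs⟩ := IncreasesAt.exists_zero (f := fun s =>
      hit (l i) s (flow (l j) P.1 P.2.2 s) - hit (l i) P.1 P.2.1) H.base.sepRate_pos
      (fun a b hab => by simpa using hI a b hab) (hc.sub continuous_const)
    exact ⟨s, sub_eq_zero.1 hs⟩
  · have hI := H.increasesAt_below h hY
    obtain ⟨s, hs⟩ := IncreasesAt.exists_zero (f := fun s =>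
      -hit (l i) s (flow (l j) P.1 P.2.2 s) - -hit (l i) P.1 P.2.1) H.base.sepRate_pos
      (fun a b hab => by simpa using hI a b hab) (hc.neg.sub continuous_const)
    exact ⟨s, neg_injective (sub_eq_zero.1 hs)⟩

theorem continuous_meet {j : ι} (hj : j ≠ i) : Continuous (meet l i j) := by
  have hc : ∀ s, Continuous fun P : ℝ × ℝ × ℝ => hit (l i) s (flow (l j) P.1 P.2.2 s) := by
    intro s
    refine H.base.continuous_hit.comp (continuous_const.prodMk ?_)
    exact (H.speed j).continuous_flow.comp
      (by fun_prop : Continuous fun P : ℝ × ℝ × ℝ => (P.1, P.2.2, s))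
  have hc' : Continuous fun P : ℝ × ℝ × ℝ => hit (l i) P.1 P.2.1 :=
    H.base.continuous_hit.comp (by fun_prop : Continuous fun P : ℝ × ℝ × ℝ => (P.1, P.2.1))
  rcases H.gap i j hj.symm with h | h
  · refine continuous_zero H.base.sepRate_pos (z := fun P s =>
      hit (l i) s (flow (l j) P.1 P.2.2 s) - hit (l i) P.1 P.2.1) (fun P a b hab => ?_)
      (fun s => (hc s).sub hc') (fun P => sub_eq_zero.2 (H.meet_spec hj P))
    simpa using H.increasesAt_above h ((H.speed j).isTraj_flow P.1 P.2.2) a b hab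
  · refine continuous_zero H.base.sepRate_pos (z := fun P s =>
      -hit (l i) s (flow (l j) P.1 P.2.2 s) - -hit (l i) P.1 P.2.1) (fun P a b hab => ?_)
      (fun s => (hc s).neg.sub hc'.neg) (fun P => by rw [H.meet_spec hj P, sub_self])
    simpa using H.increasesAt_below h ((H.speed j).isTraj_flow P.1 P.2.2) a b hab

theorem eq_meet {j : ι} (hj : j ≠ i) {P : ℝ × ℝ × ℝ} {s : ℝ}
    (hs : flow (l j) P.1 P.2.2 s = flow (l i) P.1 P.2.1 s) : s = meet l i j P := by
  have hY := (H.speed j).isTraj_flow P.1 P.2.2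
  have h1 : hit (l i) s (flow (l j) P.1 P.2.2 s) = hit (l i) P.1 P.2.1 := by
    rw [hs]; exact H.base.hit_flow _ _ _
  have h2 := H.meet_spec hj P
  rcases H.gap i j hj.symm with h | h
  · exact (H.increasesAt_above h hY).injective H.base.sepRate_pos (h1.trans h2.symm)
  · exact (H.increasesAt_below h hY).injective H.base.sepRate_pos
      (congrArg Neg.neg (h1.trans h2.symm))

theorem meet_diag {j : ι} (hj : j ≠ i) (t x : ℝ) : meet l i j (t, x, x) = t :=
  (H.eq_meet hj (by simp [(H.speed _).flow_self])).symm

theorem le_meet_of_above {j : ι} (h : IsAbove ε l i j) {P : ℝ × ℝ × ℝ} (hP : P.2.2 ≤ P.2.1) :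
    P.1 ≤ meet l i j P := by
  have hY := (H.speed j).isTraj_flow P.1 P.2.2
  have h2 := H.meet_spec (H.ne_of_isAbove h).symm P
  refine ((H.increasesAt_above h hY).strictMono H.base.sepRate_pos).le_iff_le.1 ?_
  simp only [h2, (H.speed j).flow_self]
  exact (H.base.hit_strictMono _).monotone hP

theorem meet_le_of_below {j : ι} (h : IsAbove ε l j i) {P : ℝ × ℝ × ℝ} (hP : P.2.2 ≤ P.2.1) :
    meet l i j P ≤ P.1 := by
  have hY := (H.speed j).isTraj_flow P.1 P.2.2
  have h2 := H.meet_spec (H.ne_of_isAbove h) P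
  refine ((H.increasesAt_below h hY).strictMono H.base.sepRate_pos).le_iff_le.1 ?_
  simp only [h2, (H.speed j).flow_self]
  exact neg_le_neg ((H.base.hit_strictMono _).monotone hP)

/-- On the diagonal, away from `x = 0`, values come from the diagonal. -/
theorem side_diag_neg {j : ι} (hj : j ≠ i) {t x : ℝ} (hx : 0 < x) :
    side ε σ l i j (t, x, x) < 0 := by
  unfold side
  rw [if_neg hj]
  split_ifs with h
  · have hjs : Speed ε C (-1) (l j) (l' j) := h.2 ▸ H.speed j
    have hY := (H.speed j).isTraj_flow t x
    have ht : t < hit (l j) t x := by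
      have := hjs.hit_strictMono t hx
      rwa [hjs.hit_zero] at this
    have := (H.increasesAt_above h.1 hY).strictMono H.base.sepRate_pos ht
    simp only [(H.speed j).flow_self, (H.speed j).flow_hit, H.base.hit_zero] at this
    simpa using this
  · norm_num

theorem clock_forward {j : ι} (hj : j = i ∨ IsAbove ε l i j) (P : ℝ × ℝ × ℝ) {s : ℝ}
    (hs : P.1 ≤ s) : clock (sepRate ε C / 2) l i (charPath l i j P s) ≤
      clock (sepRate ε C / 2) l i P - sepRate ε C / 2 * (s - P.1) := by
  have h1 := H.hit_path_fst j P s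
  have h2 : hit (l i) P.1 P.2.2 ≤ hit (l i) s (flow (l j) P.1 P.2.2 s) := by
    rcases hj with rfl | hj
    · rw [H.base.hit_flow]
    · have := ((H.increasesAt_above hj ((H.speed j).isTraj_flow P.1 P.2.2)).strictMono
        H.base.sepRate_pos).monotone hs
      simpa [(H.speed j).flow_self] using this
  unfold clock
  rw [h1]
  simp only [charPath]
  linarith

/-- Backward in time the term `-δ * t` contained in `clock` grows, while the label of the
`j`-trajectory rises at rate `sepRate`. With `δ` equal to half of `sepRate`, a net decay at rate `δ`
remains, the same as in `clock_forward`. -/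
theorem clock_backward {j : ι} (hj : IsAbove ε l j i) (P : ℝ × ℝ × ℝ) {s : ℝ}
    (hs : s ≤ P.1) : clock (sepRate ε C / 2) l i (charPath l i j P s) ≤
      clock (sepRate ε C / 2) l i P - sepRate ε C / 2 * (P.1 - s) := by
  have h1 := H.hit_path_fst j P s
  have h2 := H.increasesAt_below hj ((H.speed j).isTraj_flow P.1 P.2.2) s P.1 hs
  simp only [(H.speed j).flow_self] at h2
  unfold clock
  rw [h1]
  simp only [charPath]
  linarith

theorem abs_clock_le {P : ℝ × ℝ × ℝ} (hP : P ∈ wedge) :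
    |clock (sepRate ε C / 2) l i P| ≤ (1 + sepRate ε C / 2) * (1 / ε) := by
  obtain ⟨h0, h1, h2⟩ := hP
  have hc := H.base.sepRate_pos
  have hε := H.eps_pos
  have a1 := H.base.le_hit (t := P.1) h0
  have a2 := H.base.le_hit (t := P.1) (h0.trans h1)
  have a3 := H.base.hit_le (t := P.1) (h1.trans h2)
  have a4 := H.base.hit_le (t := P.1) h2
  have hε' : 0 < 1 / ε := by positivity
  unfold clock
  have b1 : (1 + sepRate ε C / 2) * (hit (l i) P.1 P.2.1 - P.1) ≤
    (1 + sepRate ε C / 2) * (1 / ε) := by gcongr; linarith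
  have b2 : 0 ≤ (1 + sepRate ε C / 2) * (hit (l i) P.1 P.2.1 - P.1) := by
    apply mul_nonneg <;> linarith
  have b3 : 1 / ε ≤ (1 + sepRate ε C / 2) * (1 / ε) := by nlinarith
  rw [abs_le]
  constructor <;> linarith

/-- Exit points on the face `ξ = 0` belong to the wedge. -/
theorem exit_mem {j : ι} {P : ℝ × ℝ × ℝ} (hP : P ∈ wedge) (h : 0 ≤ side ε σ l i j P) :
    P.1 ≤ hit (l j) P.1 P.2.2 ∧
      (hit (l j) P.1 P.2.2, flow (l i) P.1 P.2.1 (hit (l j) P.1 P.2.2), 0) ∈ wedge := by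
  have hjs : Speed ε C (-1) (l j) (l' j) := H.sigma_of_side_nonneg h ▸ H.speed j
  obtain ⟨h0, h1, h2⟩ := hP
  have ht := hjs.le_hit (t := P.1) h0
  have hX := (H.speed i).isTraj_flow P.1 P.2.1
  have hanti := (H.base.traj_strictAnti hX).antitone
  refine ⟨ht, le_rfl, ?_, ?_⟩
  · have hle : hit (l j) P.1 P.2.2 ≤ hit (l i) P.1 P.2.1 := by
      rcases of_side_nonneg h with rfl | h
      · exact (H.base.hit_strictMono _).monotone h1
      · exact h.2
    have := hanti hle
    rwa [H.base.flow_hit] at this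
  · have := hanti ht
    rw [H.base.flow_self] at this
    exact this.trans h2

end RowSpeeds

end Row

/-! ### The integral operator of a row and continuity of its values. -/

section Row

variable {ι : Type*}

/-- Coefficients of a row of the kernel equations without diagonal terms: the coupling `m`, the
values `r` on the diagonal, and the data `h`, `b` on the face `ξ = 0`. -/
structure RowData (N : ℝ) (i : ι) (σ : ι → ℝ) (m : ι → ι → ℝ → ℝ → ℝ) (r : ι → ℝ → ℝ → ℝ)
    (h : ι → ℝ → ℝ) (b : ι → ι → ℝ → ℝ) : Prop where
  m_cont : ∀ k j, Continuous fun q : ℝ × ℝ => m k j q.1 q.2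
  m_bound : ∀ k j t x, |m k j t x| ≤ N
  m_diag : ∀ j t x, m j j t x = 0
  r_cont : ∀ j, j ≠ i → Continuous fun q : ℝ × ℝ => r j q.1 q.2
  r_bound : ∀ j, j ≠ i → ∀ t x, |r j t x| ≤ N
  h_cont : ∀ j, Continuous (h j)
  h_bound : ∀ j t, |h j t| ≤ N
  b_cont : ∀ k j, Continuous (b k j)
  b_bound : ∀ k j t, |b k j t| ≤ N
  b_zero : ∀ k j t, σ k ≠ 1 → b k j t = 0

/-- Admissible rows: functions supported in the wedge, bounded, and continuous on both sides of
the interfaces. -/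
structure IsRow (ε : ℝ) (σ : ι → ℝ) (l : ι → ℝ → ℝ → ℝ) (i : ι) (u : ι × (ℝ × ℝ × ℝ) → ℝ) :
    Prop where
  zero : ∀ j, ∀ P ∉ wedge, u (j, P) = 0
  bdd : ∃ B, ∀ a, |u a| ≤ B
  low : ∀ j, ContinuousOn (fun P => u (j, P)) (wedge ∩ {P | 0 ≤ side ε σ l i j P})
  high : ∀ j, ContinuousOn (fun P => u (j, P)) (wedge ∩ {P | side ε σ l i j P < 0})

theorem RowData.nonneg {N : ℝ} {i : ι} {σ : ι → ℝ} {m : ι → ι → ℝ → ℝ → ℝ} {r : ι → ℝ → ℝ → ℝ}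
    {h : ι → ℝ → ℝ} {b : ι → ι → ℝ → ℝ} (F : RowData N i σ m r h b) : 0 ≤ N :=
  (abs_nonneg _).trans (F.h_bound i 0)

namespace RowSpeeds

variable {ε C : ℝ} {i : ι} {σ : ι → ℝ} {l l' : ι → ℝ → ℝ → ℝ} (H : RowSpeeds ε C i σ l l')
  {u : ι × (ℝ × ℝ × ℝ) → ℝ}
include H

theorem measurable_row (hu : IsRow ε σ l i u) (k : ι) : Measurable fun P => u (k, P) := by
  classical
  have hw := isClosed_wedge.measurableSet
  have hs := (H.continuous_side k).measurable
  have h1 : MeasurableSet (wedge ∩ {P | 0 ≤ side ε σ l i k P}) :=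
    hw.inter (measurableSet_le measurable_const hs)
  have h2 : MeasurableSet (wedge ∩ {P | side ε σ l i k P < 0}) :=
    hw.inter (measurableSet_lt hs measurable_const)
  have m1 := (hu.low k).measurable_piecewise (continuousOn_const (c := (0 : ℝ))) h1
  have m2 := (hu.high k).measurable_piecewise (continuousOn_const (c := (0 : ℝ))) h2
  convert! m1.add m2 using 1
  funext P
  by_cases hP : P ∈ wedge
  · by_cases hsd : 0 ≤ side ε σ l i k P
    · simp [Set.piecewise, hP, hsd, not_lt.2 hsd]
    · simp [Set.piecewise, hP, hsd, not_le.1 hsd]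
  · simp [Set.piecewise, hP, hu.zero k P hP]

theorem continuousWithinAt_row (hu : IsRow ε σ l i u) {k : ι} {Q : ℝ × ℝ × ℝ} (hQ : Q ∈ wedge)
    (hside : side ε σ l i k Q ≠ 0) : ContinuousWithinAt (fun P => u (k, P)) wedge Q := by
  have hc := (H.continuous_side k).continuousAt (x := Q)
  rcases lt_or_gt_of_ne hside with hlt | hgt
  · refine (hu.high k Q ⟨hQ, hlt⟩).mono_of_mem_nhdsWithin ?_
    exact inter_mem self_mem_nhdsWithin (mem_nhdsWithin_of_mem_nhds (hc.eventually_lt_const hlt))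
  · refine (hu.low k Q ⟨hQ, hgt.le⟩).mono_of_mem_nhdsWithin ?_
    exact inter_mem self_mem_nhdsWithin (mem_nhdsWithin_of_mem_nhds
      ((hc.eventually_const_lt hgt).mono fun _ h => le_of_lt h))

/-- Along the curve the `i`-label is constant, whereas the `l k`-label of a `j`-trajectory is
injective. The interface of the entry `k` is therefore crossed at most once; this fails for `k = j`,
where `side` is constant along the curve. -/
theorem ae_side_ne {j k : ι} (hjk : k ≠ j) (P : ℝ × ℝ × ℝ) :
    ∀ᵐ s, side ε σ l i k (charPath l i j P s) ≠ 0 := by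
  unfold side
  split_ifs with h1 h2
  · simp
  · filter_upwards [(H.speed k).ae_hit_ne (H.gap k j hjk) ((H.speed j).isTraj_flow P.1 P.2.2)
      (hit (l i) P.1 P.2.1)] with s hs
    rw [H.hit_path_fst]
    exact sub_ne_zero.2 hs.symm
  · simp

theorem ae_ne_diag {j : ι} (hj : j ≠ i) (P : ℝ × ℝ × ℝ) :
    ∀ᵐ s, flow (l j) P.1 P.2.2 s ≠ flow (l i) P.1 P.2.1 s := by
  have : Set.Subsingleton {s | flow (l j) P.1 P.2.2 s = flow (l i) P.1 P.2.1 s} :=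
    fun a ha b hb => (H.eq_meet hj ha).trans (H.eq_meet hj hb).symm
  simpa using (measure_eq_zero_iff_ae_notMem.1 (this.measure_zero volume))

theorem flow_mono {t x y : ℝ} (hxy : x ≤ y) (s : ℝ) : flow (l i) t x s ≤ flow (l i) t y s := by
  refine (H.base.hit_strictMono s).le_iff_le.1 ?_
  rw [H.base.hit_flow, H.base.hit_flow]
  exact (H.base.hit_strictMono t).monotone hxy

/-- Problems arise only at times when the curve meets the interface of `k`, the face `ξ = 0`, the
face `x = 1` or, for `j ≠ i`, the diagonal. Each set of times is null. At other times nearby curves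
stay in the wedge where the row is continuous, or all stay outside it, where the row is zero. -/
theorem ae_continuousWithinAt_path (hu : IsRow ε σ l i u) {j k : ι} (hjk : k ≠ j)
    (P₀ : ℝ × ℝ × ℝ) :
    ∀ᵐ s, ContinuousWithinAt (fun P => u (k, charPath l i j P s)) wedge P₀ := by
  have hX := (H.speed i).isTraj_flow P₀.1 P₀.2.1
  have hY := (H.speed j).isTraj_flow P₀.1 P₀.2.2
  have hdiag : ∀ᵐ s, j ≠ i → flow (l j) P₀.1 P₀.2.2 s ≠ flow (l i) P₀.1 P₀.2.1 s := by
    by_cases hj : j = i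
    · simp [hj]
    · exact (H.ae_ne_diag hj P₀).mono fun s hs _ => hs
  filter_upwards [H.ae_side_ne hjk P₀, (H.speed i).ae_traj_ne hX 1, (H.speed j).ae_traj_ne hY 0,
    hdiag] with s hside h1 h0 hd
  have hc : Continuous fun P => charPath l i j P s :=
    (H.continuous_path j).comp (continuous_id.prodMk continuous_const)
  by_cases hQ : charPath l i j P₀ s ∈ wedge
  · have hin : ∀ᶠ P in 𝓝[wedge] P₀, charPath l i j P s ∈ wedge := by
      have c1 : Continuous fun P => (charPath l i j P s).2.1 :=
        continuous_fst.comp (continuous_snd.comp hc)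
      have c2 : Continuous fun P => (charPath l i j P s).2.2 :=
        continuous_snd.comp (continuous_snd.comp hc)
      have e1 : ∀ᶠ P in 𝓝[wedge] P₀, 0 < (charPath l i j P s).2.2 :=
        nhdsWithin_le_nhds (c2.continuousAt.eventually_const_lt (lt_of_le_of_ne hQ.1 h0.symm))
      have e2 : ∀ᶠ P in 𝓝[wedge] P₀, (charPath l i j P s).2.1 < 1 :=
        nhdsWithin_le_nhds (c1.continuousAt.eventually_lt_const (lt_of_le_of_ne hQ.2.2 h1))
      have e3 : ∀ᶠ P in 𝓝[wedge] P₀,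
          (charPath l i j P s).2.2 ≤ (charPath l i j P s).2.1 := by
        -- For `j = i` a curve starting on the diagonal stays there, so strict inequality may fail
        -- at every time. Order preservation by the flow is used instead.
        by_cases hj : j = i
        · subst hj
          filter_upwards [self_mem_nhdsWithin] with P hP using H.flow_mono hP.2.1 s
        · have : ∀ᶠ P in 𝓝[wedge] P₀, (charPath l i j P s).2.2 < (charPath l i j P s).2.1 :=
            nhdsWithin_le_nhds (c2.continuousAt.eventually_lt c1.continuousAt
              (lt_of_le_of_ne hQ.2.1 (hd hj)))
          exact this.mono fun P hP => hP.le
      filter_upwards [e1, e2, e3] with P a1 a2 a3 using ⟨a1.le, a3, a2.le⟩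
    have ht : Tendsto (fun P => charPath l i j P s) (𝓝[wedge] P₀)
        (𝓝[wedge] (charPath l i j P₀ s)) :=
      tendsto_nhdsWithin_iff.2 ⟨hc.continuousAt.mono_left nhdsWithin_le_nhds, hin⟩
    exact (H.continuousWithinAt_row hu hQ hside).tendsto.comp ht
  · have hout : ∀ᶠ P in 𝓝[wedge] P₀, u (k, charPath l i j P s) = 0 := by
      refine nhdsWithin_le_nhds ?_
      filter_upwards [hc.continuousAt.eventually
        (isClosed_wedge.isOpen_compl.mem_nhds hQ)] with P hP using hu.zero k _ hP
    exact continuousWithinAt_const.congr_of_eventuallyEq hout (hu.zero k _ hQ)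

theorem continuousOn_pos (hu : IsRow ε σ l i u) {k : ι} (hk : σ k = 1) :
    ContinuousOn (fun P => u (k, P)) wedge := by
  refine (hu.high k).mono fun P hP => ⟨hP, ?_⟩
  rw [mem_ofPred_eq, H.side_of_pos hk]
  norm_num

end RowSpeeds

variable [Fintype ι]

/-- The source term of the `j`-th entry along `charPath l i j P`. -/
noncomputable def rowSource (l : ι → ℝ → ℝ → ℝ) (i : ι) (m : ι → ι → ℝ → ℝ → ℝ)
    (u : ι × (ℝ × ℝ × ℝ) → ℝ) (j : ι) (P : ℝ × ℝ × ℝ) (s : ℝ) : ℝ :=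
  ∑ k, u (k, charPath l i j P s) * m k j s (flow (l j) P.1 P.2.2 s)

/-- The point at which `charPath l i j P` reaches the face `ξ = 0`. -/
noncomputable def exitPoint (l : ι → ℝ → ℝ → ℝ) (i j : ι) (P : ℝ × ℝ × ℝ) : ℝ × ℝ × ℝ :=
  (hit (l j) P.1 P.2.2, flow (l i) P.1 P.2.1 (hit (l j) P.1 P.2.2), 0)

/-- The value transported from the face `ξ = 0`. -/
noncomputable def lowValue (l : ι → ℝ → ℝ → ℝ) (i : ι) (m : ι → ι → ℝ → ℝ → ℝ)
    (h : ι → ℝ → ℝ) (b : ι → ι → ℝ → ℝ) (u : ι × (ℝ × ℝ × ℝ) → ℝ) (j : ι) (P : ℝ × ℝ × ℝ) : ℝ :=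
  h j (hit (l j) P.1 P.2.2) + ∑ k, u (k, exitPoint l i j P) * b k j (hit (l j) P.1 P.2.2) +
    ∫ s in P.1..hit (l j) P.1 P.2.2, rowSource l i m u j P s

/-- The value transported from the diagonal. -/
noncomputable def highValue (l : ι → ℝ → ℝ → ℝ) (i : ι) (m : ι → ι → ℝ → ℝ → ℝ)
    (r : ι → ℝ → ℝ → ℝ) (u : ι × (ℝ × ℝ × ℝ) → ℝ) (j : ι) (P : ℝ × ℝ × ℝ) : ℝ :=
  r j (meet l i j P) (flow (l i) P.1 P.2.1 (meet l i j P)) +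
    ∫ s in P.1..meet l i j P, rowSource l i m u j P s

open Classical in
/-- The integral operator of a row of the kernel equations. -/
noncomputable def rowStep (ε : ℝ) (σ : ι → ℝ) (l : ι → ℝ → ℝ → ℝ) (i : ι)
    (m : ι → ι → ℝ → ℝ → ℝ) (r : ι → ℝ → ℝ → ℝ) (h : ι → ℝ → ℝ) (b : ι → ι → ℝ → ℝ)
    (u : ι × (ℝ × ℝ × ℝ) → ℝ) : ι × (ℝ × ℝ × ℝ) → ℝ := fun a =>
  if a.2 ∈ wedge then
    if 0 ≤ side ε σ l i a.1 a.2 then lowValue l i m h b u a.1 a.2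
    else highValue l i m r u a.1 a.2
  else 0

open Classical in
/-- The weight for which `rowStep` is a contraction. -/
noncomputable def rowWeight (δ L R : ℝ) (σ : ι → ℝ) (l : ι → ℝ → ℝ → ℝ) (i : ι)
    (a : ι × (ℝ × ℝ × ℝ)) : ℝ :=
  if a.2 ∈ wedge then (if σ a.1 = 1 then 1 else R) * Real.exp (L * clock δ l i a.2) else 0

namespace RowSpeeds

variable {ε C N : ℝ} {i : ι} {σ : ι → ℝ} {l l' : ι → ℝ → ℝ → ℝ} (H : RowSpeeds ε C i σ l l')
  {m : ι → ι → ℝ → ℝ → ℝ} {r : ι → ℝ → ℝ → ℝ} {h : ι → ℝ → ℝ} {b : ι → ι → ℝ → ℝ}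
  (F : RowData N i σ m r h b) {u v : ι × (ℝ × ℝ × ℝ) → ℝ}
include H

include F in
theorem measurable_source (hu : IsRow ε σ l i u) (j : ι) (P : ℝ × ℝ × ℝ) :
    Measurable (rowSource l i m u j P) := by
  have hY := ((H.speed j).isTraj_flow P.1 P.2.2).continuous
  have hpath : Continuous (charPath l i j P) :=
    (H.continuous_path j).comp (continuous_const.prodMk continuous_id)
  refine Finset.measurable_sum _ fun k _ => ?_
  refine ((H.measurable_row hu k).comp hpath.measurable).mul ?_
  exact ((F.m_cont k j).comp (continuous_id.prodMk hY)).measurable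

omit H in
include F in
theorem abs_source_le {B : ℝ} (hB : ∀ a, |u a| ≤ B) (j : ι) (P : ℝ × ℝ × ℝ) (s : ℝ) :
    |rowSource l i m u j P s| ≤ Fintype.card ι * (B * N) := by
  refine (Finset.abs_sum_le_sum_abs _ _).trans ?_
  refine (Finset.sum_le_card_nsmul _ _ (B * N) fun k _ => ?_).trans (by simp)
  rw [abs_mul]
  exact mul_le_mul (hB _) (F.m_bound _ _ _ _) (abs_nonneg _) ((abs_nonneg _).trans (hB (k, P)))

include F

theorem continuousOn_integral_source (hu : IsRow ε σ l i u) (j : ι) {e : ℝ × ℝ × ℝ → ℝ}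
    (he : Continuous e) :
    ContinuousOn (fun P => ∫ s in P.1..e P, rowSource l i m u j P s) wedge := by
  intro P₀ hP₀
  obtain ⟨B, hB⟩ := hu.bdd
  refine continuousWithinAt_integral (C := Fintype.card ι * (B * N)) (abs_source_le F hB j)
    (H.measurable_source F hu j) ?_ continuous_fst.continuousWithinAt he.continuousWithinAt
  have hk : ∀ k, ∀ᵐ s, k ≠ j → ContinuousWithinAt (fun P => u (k, charPath l i j P s)) wedge P₀ := by
    intro k
    by_cases hkj : k = j
    · simp [hkj]
    · exact (H.ae_continuousWithinAt_path hu hkj P₀).mono fun s hs _ => hs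
  filter_upwards [ae_all_iff.2 hk] with s hs
  unfold rowSource
  refine tendsto_finsetSum _ fun k _ => ?_
  -- The one entry without almost everywhere continuity along the curve drops out because its
  -- coefficient is zero.
  by_cases hkj : k = j
  · subst hkj
    simp only [F.m_diag, mul_zero]
    exact tendsto_const_nhds
  · have hm : Continuous fun P : ℝ × ℝ × ℝ => m k j s (flow (l j) P.1 P.2.2 s) :=
      (F.m_cont k j).comp (continuous_const.prodMk ((H.speed j).continuous_flow.comp
        (by fun_prop : Continuous fun P : ℝ × ℝ × ℝ => (P.1, P.2.2, s))))
    exact (hs k hkj).mul hm.continuousWithinAt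

/-- Only entries of positive speed enter the face condition. These have no interface, so their
values at the exit point depend continuously on `P`. -/
theorem continuousOn_lowValue (hu : IsRow ε σ l i u) (j : ι) :
    ContinuousOn (lowValue l i m h b u j) (wedge ∩ {P | 0 ≤ side ε σ l i j P}) := by
  have hτ : Continuous fun P : ℝ × ℝ × ℝ => hit (l j) P.1 P.2.2 :=
    (H.speed j).continuous_hit.comp (by fun_prop : Continuous fun P : ℝ × ℝ × ℝ => (P.1, P.2.2))
  have hexit : Continuous (exitPoint l i j) := by
    refine hτ.prodMk (Continuous.prodMk ?_ continuous_const)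
    exact (H.speed i).continuous_flow.comp
      (f := fun P : ℝ × ℝ × ℝ => (P.1, P.2.1, hit (l j) P.1 P.2.2)) (by fun_prop)
  refine ContinuousOn.add (ContinuousOn.add ?_ ?_)
    ((H.continuousOn_integral_source F hu j hτ).mono inter_subset_left)
  · exact ((F.h_cont j).comp hτ).continuousOn
  · refine continuousOn_finsetSum _ fun k _ => ?_
    by_cases hk : σ k = 1
    · refine ContinuousOn.mul ?_ ((F.b_cont k j).comp hτ).continuousOn
      exact (H.continuousOn_pos hu hk).comp hexit.continuousOn
        fun P hP => (H.exit_mem hP.1 hP.2).2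
    · simp only [F.b_zero k j _ hk, mul_zero]
      exact continuousOn_const

theorem continuousOn_highValue (hu : IsRow ε σ l i u) {j : ι} (hj : j ≠ i) :
    ContinuousOn (highValue l i m r u j) wedge := by
  have hθ := H.continuous_meet hj
  refine ContinuousOn.add ?_ (H.continuousOn_integral_source F hu j hθ)
  have hX : Continuous fun P : ℝ × ℝ × ℝ => flow (l i) P.1 P.2.1 (meet l i j P) :=
    (H.speed i).continuous_flow.comp
      (f := fun P : ℝ × ℝ × ℝ => (P.1, P.2.1, meet l i j P)) (by fun_prop)
  exact ((F.r_cont j hj).comp (hθ.prodMk hX)).continuousOn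

end RowSpeeds

end Row

/-! ### The contraction estimate and existence of a row. -/

section Row

variable {ι : Type*}

/-- The class of admissible rows is stable under uniform limits. -/
theorem isRow_of_tendstoUniformly {ε : ℝ} {i : ι} {σ : ι → ℝ} {l : ι → ℝ → ℝ → ℝ}
    {w : ℕ → ι × (ℝ × ℝ × ℝ) → ℝ} {v : ι × (ℝ × ℝ × ℝ) → ℝ} (hw : ∀ n, IsRow ε σ l i (w n))
    (hv : TendstoUniformly w v atTop) : IsRow ε σ l i v := by
  have hcomp : ∀ j, TendstoUniformly (fun n P => w n (j, P)) (fun P => v (j, P)) atTop :=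
    fun j => hv.comp fun P => (j, P)
  refine ⟨fun j P hP => ?_, ?_, fun j => ?_, fun j => ?_⟩
  · refine tendsto_nhds_unique (hv.tendsto_at (j, P)) ?_
    simp only [(hw _).zero j P hP]
    exact tendsto_const_nhds
  · obtain ⟨n, hn⟩ := (Metric.tendstoUniformly_iff.1 hv 1 one_pos).exists
    obtain ⟨B, hB⟩ := (hw n).bdd
    refine ⟨B + 1, fun a => ?_⟩
    have h1 := hn a
    rw [Real.dist_eq] at h1
    have h2 := abs_add_le (v a - w n a) (w n a)
    rw [sub_add_cancel] at h2
    linarith [hB a]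
  · exact (hcomp j).tendstoUniformlyOn.continuousOn
      (Frequently.of_forall fun n => (hw n).low j)
  · exact (hcomp j).tendstoUniformlyOn.continuousOn
      (Frequently.of_forall fun n => (hw n).high j)

/-- The entry `j` is transported along `charPath l i j P`, up to the time `e`, in the direction in
which `clock` decreases. -/
def IsExitTime (ε : ℝ) (l : ι → ℝ → ℝ → ℝ) (i j : ι) (P : ℝ × ℝ × ℝ) (e : ℝ) : Prop :=
  ((j = i ∨ IsAbove ε l i j) ∧ P.1 ≤ e) ∨ (IsAbove ε l j i ∧ e ≤ P.1)

namespace RowSpeeds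

variable {ε C : ℝ} {i : ι} {σ : ι → ℝ} {l l' : ι → ℝ → ℝ → ℝ} (H : RowSpeeds ε C i σ l l')
include H

theorem clock_path_le {j : ι} {P : ℝ × ℝ × ℝ} {e : ℝ} (he : IsExitTime ε l i j P e) {s : ℝ}
    (hs : s ∈ uIoc P.1 e) : clock (sepRate ε C / 2) l i (charPath l i j P s) ≤
      clock (sepRate ε C / 2) l i P - sepRate ε C / 2 * |s - P.1| := by
  rcases he with ⟨hj, he⟩ | ⟨hj, he⟩
  · rw [uIoc_of_le he] at hs
    rw [abs_of_nonneg (sub_nonneg.2 hs.1.le)]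
    exact H.clock_forward hj P hs.1.le
  · rw [uIoc_of_ge he] at hs
    rw [abs_of_nonpos (sub_nonpos.2 hs.2), neg_sub]
    exact H.clock_backward hj P hs.2

theorem isExitTime_hit {j : ι} {P : ℝ × ℝ × ℝ} (hP : P ∈ wedge) (hside : 0 ≤ side ε σ l i j P) :
    IsExitTime ε l i j P (hit (l j) P.1 P.2.2) :=
  Or.inl ⟨(of_side_nonneg hside).imp id fun h => h.1.1, (H.exit_mem hP hside).1⟩

theorem isExitTime_meet {j : ι} (hj : j ≠ i) {P : ℝ × ℝ × ℝ} (hP : P ∈ wedge) :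
    IsExitTime ε l i j P (meet l i j P) := by
  rcases H.gap i j hj.symm with h | h
  · exact Or.inl ⟨Or.inr h, H.le_meet_of_above h hP.2.1⟩
  · exact Or.inr ⟨h, H.meet_le_of_below h hP.2.1⟩

theorem exitPoint_eq (j : ι) (P : ℝ × ℝ × ℝ) :
    exitPoint l i j P = charPath l i j P (hit (l j) P.1 P.2.2) := by
  simp [exitPoint, charPath, (H.speed j).flow_hit]

variable [Fintype ι] {N : ℝ} {m : ι → ι → ℝ → ℝ → ℝ} {r : ι → ℝ → ℝ → ℝ} {h : ι → ℝ → ℝ}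
  {b : ι → ι → ℝ → ℝ} (F : RowData N i σ m r h b) {u v : ι × (ℝ × ℝ × ℝ) → ℝ}
include F

omit [Fintype ι] H F in
theorem rowWeight_le {δ L R : ℝ} (hR : 1 ≤ R) (k : ι) (Q : ℝ × ℝ × ℝ) :
    rowWeight δ L R σ l i (k, Q) ≤ R * Real.exp (L * clock δ l i Q) := by
  have hexp := Real.exp_pos (L * clock δ l i Q)
  unfold rowWeight
  split_ifs
  · exact mul_le_mul_of_nonneg_right hR hexp.le
  · exact le_rfl
  · exact mul_nonneg (by linarith) hexp.le

/-- Along the curve the weight is at most `R * E * exp (-L * δ * |s - t|)`, where `δ = sepRate ε C /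
2` and `E` is the exponential of `L * clock` at `P`. Integration gains the factor `1 / (L * δ)`, and
`L` is chosen so that the result is at most `K * E / 4`. -/
theorem abs_integral_source_sub_le (hu : IsRow ε σ l i u) (hv : IsRow ε σ l i v) {L R K : ℝ}
    (hR : 1 ≤ R) (hL : 4 * (Fintype.card ι * N * R) + 1 = L * (sepRate ε C / 2)) (hK : 0 ≤ K)
    (huv : ∀ a, |u a - v a| ≤ K * rowWeight (sepRate ε C / 2) L R σ l i a) {j : ι}
    {P : ℝ × ℝ × ℝ} {e : ℝ} (he : IsExitTime ε l i j P e) :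
    |(∫ s in P.1..e, rowSource l i m u j P s) - ∫ s in P.1..e, rowSource l i m v j P s| ≤
      K / 4 * Real.exp (L * clock (sepRate ε C / 2) l i P) := by
  obtain ⟨B₁, hB₁⟩ := hu.bdd
  obtain ⟨B₂, hB₂⟩ := hv.bdd
  have hN := F.nonneg
  have hδ := H.base.sepRate_pos
  set δ := sepRate ε C / 2
  set n : ℝ := (Fintype.card ι : ℝ)
  have hn : 0 ≤ n := Nat.cast_nonneg _
  have hnNR : 0 ≤ n * N * R := by positivity
  have hLδ : 0 < L * δ := by rw [← hL]; linarith
  have hL0 : 0 < L := by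
    by_contra hneg
    push Not at hneg
    have : L * δ ≤ 0 := mul_nonpos_of_nonpos_of_nonneg hneg (by positivity)
    linarith
  rw [← intervalIntegral.integral_sub
    (intervalIntegrable_of_bounded (H.measurable_source F hu j P) (abs_source_le F hB₁ j P) _ _)
    (intervalIntegrable_of_bounded (H.measurable_source F hv j P) (abs_source_le F hB₂ j P) _ _)]
  set E := Real.exp (L * clock δ l i P) with hE
  have hE0 : 0 < E := Real.exp_pos _
  have hbound : ∀ s ∈ uIoc P.1 e, |rowSource l i m u j P s - rowSource l i m v j P s| ≤
      n * (K * (R * E) * N) * Real.exp (-(L * δ * |s - P.1|)) := by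
    intro s hs
    have hclock := H.clock_path_le he hs
    have hexp : Real.exp (L * clock δ l i (charPath l i j P s)) ≤
        E * Real.exp (-(L * δ * |s - P.1|)) := by
      rw [hE, ← Real.exp_add]
      refine Real.exp_le_exp.2 ?_
      have := mul_le_mul_of_nonneg_left hclock hL0.le
      refine this.trans (le_of_eq ?_)
      ring
    have hterm : ∀ k, |u (k, charPath l i j P s) * m k j s (flow (l j) P.1 P.2.2 s) -
        v (k, charPath l i j P s) * m k j s (flow (l j) P.1 P.2.2 s)| ≤
        K * (R * E) * N * Real.exp (-(L * δ * |s - P.1|)) := by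
      intro k
      rw [← sub_mul, abs_mul]
      have h1 : |u (k, charPath l i j P s) - v (k, charPath l i j P s)| ≤
          K * (R * (E * Real.exp (-(L * δ * |s - P.1|)))) := by
        refine (huv _).trans (mul_le_mul_of_nonneg_left ?_ hK)
        exact (rowWeight_le hR k _).trans (mul_le_mul_of_nonneg_left hexp (by linarith))
      calc _ ≤ K * (R * (E * Real.exp (-(L * δ * |s - P.1|)))) * N :=
            mul_le_mul h1 (F.m_bound _ _ _ _) (abs_nonneg _) ((abs_nonneg _).trans h1)
        _ = _ := by ring
    unfold rowSource
    rw [← Finset.sum_sub_distrib]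
    refine (Finset.abs_sum_le_sum_abs _ _).trans ?_
    refine (Finset.sum_le_card_nsmul _ _ _ fun k _ => hterm k).trans (le_of_eq ?_)
    simp only [Finset.card_univ, nsmul_eq_mul]
    ring
  refine (abs_integral_le_of_exp_decay hLδ (by positivity) hbound).trans ?_
  rw [div_le_iff₀ hLδ, ← hL]
  have : 0 ≤ K * E := by positivity
  nlinarith

/-- The prescribed data cancel in the difference. The face coupling has no small factor from
integration, but it feeds entries of weight `1` into an entry of weight `R`, at a point where
`clock` is no larger; the choice of `R` makes its share `(R - 1) / 4`. -/
theorem rowStep_contract (hu : IsRow ε σ l i u) (hv : IsRow ε σ l i v) {L R K : ℝ}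
    (hR : R = 4 * (Fintype.card ι * N) + 1)
    (hL : 4 * (Fintype.card ι * N * R) + 1 = L * (sepRate ε C / 2)) (hK : 0 ≤ K)
    (huv : ∀ a, |u a - v a| ≤ K * rowWeight (sepRate ε C / 2) L R σ l i a)
    (a : ι × (ℝ × ℝ × ℝ)) :
    |rowStep ε σ l i m r h b u a - rowStep ε σ l i m r h b v a| ≤
      K / 2 * rowWeight (sepRate ε C / 2) L R σ l i a := by
  obtain ⟨j, P⟩ := a
  have hN := F.nonneg
  have hn : (0 : ℝ) ≤ Fintype.card ι := Nat.cast_nonneg _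
  have hR1 : 1 ≤ R := by rw [hR]; nlinarith
  have hδ := H.base.sepRate_pos
  have hL0 : 0 ≤ L := by
    by_contra hneg
    push Not at hneg
    have : L * (sepRate ε C / 2) ≤ 0 := mul_nonpos_of_nonpos_of_nonneg hneg.le (by positivity)
    have : 0 ≤ Fintype.card ι * N * R := by positivity
    linarith
  by_cases hP : P ∈ wedge
  swap
  · simp [rowStep, rowWeight, hP]
  set E := Real.exp (L * clock (sepRate ε C / 2) l i P) with hE
  have hE0 : 0 < E := Real.exp_pos _
  have hKE : 0 ≤ K * E := by positivity
  have hint := fun e => H.abs_integral_source_sub_le F hu hv hR1 hL hK huv (j := j) (P := P)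
    (e := e)
  by_cases hside : 0 ≤ side ε σ l i j P
  · have hσ := H.sigma_of_side_nonneg hside
    have hσ' : σ j ≠ 1 := by rw [hσ]; norm_num
    simp only [rowStep, rowWeight, if_pos hP, if_pos hside, if_neg hσ', ← hE]
    have h1 := hint _ (H.isExitTime_hit hP hside)
    have hexit : clock (sepRate ε C / 2) l i (exitPoint l i j P) ≤
        clock (sepRate ε C / 2) l i P := by
      have ht := (H.exit_mem hP hside).1
      rw [H.exitPoint_eq]
      refine (H.clock_forward ((of_side_nonneg hside).imp id fun h => h.1.1) P ht).trans ?_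
      have : 0 ≤ sepRate ε C / 2 * (hit (l j) P.1 P.2.2 - P.1) :=
        mul_nonneg (by linarith) (by linarith)
      linarith
    have hterm : ∀ k, |u (k, exitPoint l i j P) * b k j (hit (l j) P.1 P.2.2) -
        v (k, exitPoint l i j P) * b k j (hit (l j) P.1 P.2.2)| ≤ K * E * N := by
      intro k
      rw [← sub_mul, abs_mul]
      by_cases hk : σ k = 1
      · have h2 : |u (k, exitPoint l i j P) - v (k, exitPoint l i j P)| ≤ K * E := by
          refine (huv _).trans (mul_le_mul_of_nonneg_left ?_ hK)
          have hmem : exitPoint l i j P ∈ wedge := (H.exit_mem hP hside).2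
          simp only [rowWeight, if_pos hmem, if_pos hk, one_mul, hE]
          exact Real.exp_le_exp.2 (mul_le_mul_of_nonneg_left hexit hL0)
        exact mul_le_mul h2 (F.b_bound _ _ _) (abs_nonneg _) hKE
      · rw [F.b_zero k j _ hk, abs_zero, mul_zero]
        positivity
    have h3 : |∑ k, u (k, exitPoint l i j P) * b k j (hit (l j) P.1 P.2.2) -
        ∑ k, v (k, exitPoint l i j P) * b k j (hit (l j) P.1 P.2.2)| ≤
        Fintype.card ι * (K * E * N) := by
      rw [← Finset.sum_sub_distrib]
      refine (Finset.abs_sum_le_sum_abs _ _).trans ?_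
      refine (Finset.sum_le_card_nsmul _ _ _ fun k _ => hterm k).trans (le_of_eq ?_)
      simp only [Finset.card_univ, nsmul_eq_mul]
    unfold lowValue
    rw [add_sub_add_comm, add_sub_add_left_eq_sub]
    refine (abs_add_le _ _).trans ((add_le_add h3 h1).trans ?_)
    have h4 : Fintype.card ι * (K * E * N) = (R - 1) / 4 * (K * E) := by rw [hR]; ring
    rw [h4]
    nlinarith
  · have hj := H.ne_of_side_neg (not_le.1 hside)
    simp only [rowStep, if_pos hP, if_neg hside]
    have h1 := hint _ (H.isExitTime_meet hj hP)
    unfold highValue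
    rw [add_sub_add_left_eq_sub]
    refine h1.trans ?_
    have h2 : E ≤ rowWeight (sepRate ε C / 2) L R σ l i (j, P) := by
      simp only [rowWeight, if_pos hP, ← hE]
      split_ifs
      · rw [one_mul]
      · nlinarith
    have h3 : K * E ≤ K * rowWeight (sepRate ε C / 2) L R σ l i (j, P) :=
      mul_le_mul_of_nonneg_left h2 hK
    linarith

theorem abs_rowStep_zero_le (a : ι × (ℝ × ℝ × ℝ)) :
    |rowStep ε σ l i m r h b (fun _ => 0) a| ≤ N := by
  have hN := F.nonneg
  unfold rowStep
  split_ifs with h1 h2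
  · simpa [lowValue, rowSource] using F.h_bound _ _
  · simpa [highValue, rowSource] using F.r_bound _ (H.ne_of_side_neg (not_le.1 h2)) _ _
  · simpa using hN

omit [Fintype ι] F in
theorem rowWeight_bounds {L R : ℝ} (hL0 : 0 ≤ L) (hR : 1 ≤ R) :
    ∃ w B, 0 < w ∧ (∀ a, rowWeight (sepRate ε C / 2) L R σ l i a ≤ B) ∧
      (∀ a, 0 ≤ rowWeight (sepRate ε C / 2) L R σ l i a) ∧
      ∀ a : ι × (ℝ × ℝ × ℝ), a.2 ∈ wedge → w ≤ rowWeight (sepRate ε C / 2) L R σ l i a := by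
  set A := (1 + sepRate ε C / 2) * (1 / ε)
  refine ⟨Real.exp (-(L * A)), R * Real.exp (L * A), Real.exp_pos _, fun a => ?_, fun a => ?_,
    fun a ha => ?_⟩
  · by_cases ha : a.2 ∈ wedge
    · refine (rowWeight_le hR a.1 a.2).trans (mul_le_mul_of_nonneg_left ?_ (by linarith))
      exact Real.exp_le_exp.2 (mul_le_mul_of_nonneg_left (abs_le.1 (H.abs_clock_le ha)).2 hL0)
    · simp only [rowWeight, if_neg ha]
      have := Real.exp_pos (L * A)
      nlinarith
  · unfold rowWeight
    have := Real.exp_pos (L * clock (sepRate ε C / 2) l i a.2)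
    split_ifs <;> nlinarith
  · have h1 : Real.exp (-(L * A)) ≤ Real.exp (L * clock (sepRate ε C / 2) l i a.2) := by
      refine Real.exp_le_exp.2 ?_
      have := mul_le_mul_of_nonneg_left (abs_le.1 (H.abs_clock_le ha)).1 hL0
      change L * -A ≤ _ at this
      linarith
    have := Real.exp_pos (-(L * A))
    simp only [rowWeight, if_pos ha]
    split_ifs
    · linarith
    · nlinarith

/-- Existence of a solution of the integral equations of a row. -/
theorem exists_row : ∃ u, IsRow ε σ l i u ∧ rowStep ε σ l i m r h b u = u := by
  have hN := F.nonneg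
  have hn : (0 : ℝ) ≤ Fintype.card ι := Nat.cast_nonneg _
  have hδ := H.base.sepRate_pos
  set R := 4 * (Fintype.card ι * N) + 1 with hR
  have hR1 : 1 ≤ R := by rw [hR]; nlinarith
  set L := (4 * (Fintype.card ι * N * R) + 1) / (sepRate ε C / 2) with hLdef
  have hL : 4 * (Fintype.card ι * N * R) + 1 = L * (sepRate ε C / 2) := by
    rw [hLdef]; field_simp
  have hL0 : 0 ≤ L := by positivity
  obtain ⟨w, B, hw, hB, hW0, hwW⟩ := H.rowWeight_bounds (R := R) hL0 hR1
  have hdom : ∀ (g : ι × (ℝ × ℝ × ℝ) → ℝ) (A : ℝ), 0 ≤ A → (∀ a, |g a| ≤ A) →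
      (∀ a : ι × (ℝ × ℝ × ℝ), a.2 ∉ wedge → g a = 0) →
      ∀ a, |g a| ≤ A / w * rowWeight (sepRate ε C / 2) L R σ l i a := by
    intro g A hA hg hg0 a
    by_cases ha : a.2 ∈ wedge
    · calc |g a| ≤ A := hg a
        _ = A / w * w := by field_simp
        _ ≤ _ := mul_le_mul_of_nonneg_left (hwW a ha) (by positivity)
    · rw [hg0 a ha, abs_zero]
      exact mul_nonneg (by positivity) (hW0 a)
  have hstep0 : ∀ u, ∀ a : ι × (ℝ × ℝ × ℝ), a.2 ∉ wedge → rowStep ε σ l i m r h b u a = 0 :=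
    fun u a ha => by simp [rowStep, ha]
  have hzero : IsRow ε σ l i (fun _ => 0) :=
    ⟨fun _ _ _ => rfl, ⟨0, fun _ => by simp⟩, fun _ => continuousOn_const,
      fun _ => continuousOn_const⟩
  refine exists_fixedPoint_of_weight (S := {u | IsRow ε σ l i u})
    (fun _ _ hw hv => isRow_of_tendstoUniformly hw hv) ?_ hB
    (fun u hu v hv K hK huv => H.rowStep_contract F hu hv hR hL hK huv) hzero
    (K := N / w) (by positivity) ?_
  · intro u hu
    have hu' : IsRow ε σ l i u := hu
    refine ⟨fun j P hP => hstep0 u (j, P) hP, ?_, fun j => ?_, fun j => ?_⟩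
    · obtain ⟨A, hA⟩ := hu'.bdd
      have hA0 : 0 ≤ A := (abs_nonneg _).trans (hA (i, 0))
      -- Boundedness of the image follows from the contraction estimate against the zero row, whose
      -- image is bounded by the data.
      have h1 := H.rowStep_contract F hu' hzero hR hL (K := A / w) (by positivity) (by
        intro a
        rw [sub_zero]
        exact hdom u A hA0 hA (fun a ha => hu'.zero a.1 a.2 ha) a)
      refine ⟨A / w / 2 * B + N, fun a => ?_⟩
      have h2 := h1 a
      have h3 := H.abs_rowStep_zero_le F a
      have h4 : A / w / 2 * rowWeight (sepRate ε C / 2) L R σ l i a ≤ A / w / 2 * B :=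
        mul_le_mul_of_nonneg_left (hB a) (by positivity)
      have h5 := abs_sub_abs_le_abs_sub (rowStep ε σ l i m r h b u a)
        (rowStep ε σ l i m r h b (fun _ => 0) a)
      linarith
    · refine (H.continuousOn_lowValue F hu' j).congr fun P hP => ?_
      have h2 : 0 ≤ side ε σ l i j P := hP.2
      simp only [rowStep]
      rw [if_pos hP.1, if_pos h2]
    · by_cases hj : j = i
      · subst hj
        intro P hP
        exact absurd rfl (H.ne_of_side_neg hP.2)
      · refine ((H.continuousOn_highValue F hu' hj).mono inter_subset_left).congr fun P hP => ?_
        have h2 : ¬ 0 ≤ side ε σ l i j P := not_le.2 hP.2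
        simp only [rowStep]
        rw [if_pos hP.1, if_neg h2]
  · intro a
    rw [zero_sub, abs_neg]
    exact hdom _ N hN (H.abs_rowStep_zero_le F) (hstep0 _) a

end RowSpeeds

end Row

/-! ### Properties of the fixed point, and restoration of the zeroth order term. -/

section Row

variable {ι : Type*} [Fintype ι]

namespace RowSpeeds

variable {ε C : ℝ} {i : ι} {σ : ι → ℝ} {l l' : ι → ℝ → ℝ → ℝ} (H : RowSpeeds ε C i σ l l')
  {N : ℝ} {m : ι → ι → ℝ → ℝ → ℝ} {r : ι → ℝ → ℝ → ℝ} {h : ι → ℝ → ℝ}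
  {b : ι → ι → ℝ → ℝ} (F : RowData N i σ m r h b) {u : ι × (ℝ × ℝ × ℝ) → ℝ}
  (hfix : rowStep ε σ l i m r h b u = u)

omit [Fintype ι] in
theorem continuousOn_of_not_split (hu : IsRow ε σ l i u) {j : ι}
    (hj : ¬ (IsAbove ε l i j ∧ σ j = -1)) : ContinuousOn (fun P => u (j, P)) wedge := by
  by_cases hji : j = i
  · refine (hu.low j).mono fun P hP => ⟨hP, ?_⟩
    simp [side, hji]
  · refine (hu.high j).mono fun P hP => ⟨hP, ?_⟩
    simp [side, hji, hj]

include hfix in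
theorem row_eq_low {j : ι} {P : ℝ × ℝ × ℝ} (hP : P ∈ wedge) (hs : 0 ≤ side ε σ l i j P) :
    u (j, P) = lowValue l i m h b u j P := by
  nth_rw 1 [← hfix]
  simp only [rowStep]
  rw [if_pos hP, if_pos hs]

include hfix in
theorem row_eq_high {j : ι} {P : ℝ × ℝ × ℝ} (hP : P ∈ wedge) (hs : side ε σ l i j P < 0) :
    u (j, P) = highValue l i m r u j P := by
  nth_rw 1 [← hfix]
  simp only [rowStep]
  rw [if_pos hP, if_neg (not_le.2 hs)]

include H

theorem rowSource_path (j : ι) (P : ℝ × ℝ × ℝ) (s : ℝ) :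
    rowSource l i m u j (charPath l i j P s) = rowSource l i m u j P := by
  funext t
  unfold rowSource
  rw [H.path_path, H.flow_path_snd]

include F in
theorem row_along_of_split (hu : IsRow ε σ l i u) {j : ι} {P : ℝ × ℝ × ℝ} {e A : ℝ}
    {s₁ s₂ : ℝ}
    (hval : ∀ s, s = s₁ ∨ s = s₂ → u (j, charPath l i j P s) =
      A + ∫ t in s..e, rowSource l i m u j P t) :
    u (j, charPath l i j P s₂) =
      u (j, charPath l i j P s₁) - ∫ s in s₁..s₂, rowSource l i m u j P s := by
  obtain ⟨B, hB⟩ := hu.bdd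
  have hi : ∀ x y, IntervalIntegrable (rowSource l i m u j P) volume x y := fun x y =>
    intervalIntegrable_of_bounded (H.measurable_source F hu j P) (abs_source_le F hB j P) x y
  rw [hval s₁ (Or.inl rfl), hval s₂ (Or.inr rfl),
    ← intervalIntegral.integral_add_adjacent_intervals (hi s₁ s₂) (hi s₂ e)]
  ring

include F hfix in
-- The side, the exit point and the source depend only on the curve. The values at both times are
-- thus the same boundary value plus integrals up to the same exit time, and these are subtracted.
theorem row_along (hu : IsRow ε σ l i u) {j : ι} {P : ℝ × ℝ × ℝ} {s₁ s₂ : ℝ}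
    (h₁ : charPath l i j P s₁ ∈ wedge) (h₂ : charPath l i j P s₂ ∈ wedge) :
    u (j, charPath l i j P s₂) =
      u (j, charPath l i j P s₁) - ∫ s in s₁..s₂, rowSource l i m u j P s := by
  by_cases hs : 0 ≤ side ε σ l i j P
  · refine H.row_along_of_split F hu (e := hit (l j) P.1 P.2.2)
      (A := h j (hit (l j) P.1 P.2.2) +
        ∑ k, u (k, exitPoint l i j P) * b k j (hit (l j) P.1 P.2.2)) fun s hs' => ?_
    have hmem : charPath l i j P s ∈ wedge := by rcases hs' with rfl | rfl <;> assumption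
    rw [row_eq_low hfix hmem (by rwa [H.side_path]), lowValue, H.hit_path_snd, H.rowSource_path]
    unfold exitPoint
    rw [H.hit_path_snd, H.flow_path_fst]
    rfl
  · refine H.row_along_of_split F hu (e := meet l i j P)
      (A := r j (meet l i j P) (flow (l i) P.1 P.2.1 (meet l i j P))) fun s hs' => ?_
    have hmem : charPath l i j P s ∈ wedge := by rcases hs' with rfl | rfl <;> assumption
    rw [row_eq_high hfix hmem (by rw [H.side_path]; exact not_le.1 hs), highValue, H.meet_path,
      H.rowSource_path, H.flow_path_fst]
    rfl

include hfix in
theorem row_diag {j : ι} (hj : j ≠ i) {t x : ℝ} (hx : x ∈ Icc (0 : ℝ) 1)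
    (hs : side ε σ l i j (t, x, x) < 0) : u (j, (t, x, x)) = r j t x := by
  rw [row_eq_high hfix (P := (t, x, x)) ⟨hx.1, le_rfl, hx.2⟩ hs, highValue, H.meet_diag hj]
  simp [(H.speed i).flow_self]

include hfix in
theorem row_face {j : ι} (hj : j = i ∨ (IsAbove ε l i j ∧ σ j = -1)) {t x : ℝ}
    (hx : x ∈ Icc (0 : ℝ) 1) :
    u (j, (t, x, 0)) = h j t + ∑ k, u (k, (t, x, 0)) * b k j t := by
  have hs : 0 ≤ side ε σ l i j (t, x, 0) := by
    rcases hj with rfl | hj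
    · simp [side]
    · rw [H.side_of_split hj.1 hj.2]
      simp only [(H.speed j).hit_zero]
      linarith [H.base.le_hit (t := t) hx.1]
  rw [row_eq_low hfix (P := (t, x, 0)) ⟨le_rfl, hx.1, hx.2⟩ hs, lowValue]
  simp [exitPoint, (H.speed j).hit_zero, (H.speed i).flow_self]

include F hfix in
-- The formula for transport from the diagonal makes sense and is continuous on the whole wedge,
-- hence it extends the upper piece across the interface.
theorem row_split {j : ι} (hu : IsRow ε σ l i u) (hj : IsAbove ε l i j) :
    ∃ g, ContinuousOn g wedge ∧ ∀ P ∈ wedge, side ε σ l i j P < 0 → u (j, P) = g P :=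
  ⟨_, H.continuousOn_highValue F hu (H.ne_of_isAbove hj).symm,
    fun _ hP hs => row_eq_high hfix hP hs⟩

include F hfix in
-- On the interface both trajectories reach `0` at the same time, so the exit point on the face and
-- the one on the diagonal are the same corner point. The hypothesis says that the two prescribed
-- values agree there.
theorem continuousOn_of_compatible {j : ι} (hu : IsRow ε σ l i u) (hj : IsAbove ε l i j)
    (hσ : σ j = -1) (hcompat : ∀ t, h j t + ∑ k, r k t 0 * b k j t = r j t 0) :
    ContinuousOn (fun P => u (j, P)) wedge := by
  have hji := (H.ne_of_isAbove hj).symm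
  have hz : ∀ P ∈ wedge, side ε σ l i j P = 0 → u (j, P) = highValue l i m r u j P := by
    intro P hP hs
    have hτ : hit (l j) P.1 P.2.2 = hit (l i) P.1 P.2.1 := by
      rw [H.side_of_split hj hσ] at hs
      linarith
    have hX : flow (l i) P.1 P.2.1 (hit (l j) P.1 P.2.2) = 0 := by
      rw [hτ]; exact (H.speed i).flow_hit _ _
    have hθ : hit (l j) P.1 P.2.2 = meet l i j P := by
      refine H.eq_meet hji ?_
      rw [hX]; exact (H.speed j).flow_hit _ _
    rw [row_eq_low hfix hP hs.ge, lowValue, highValue, ← hθ, hX, ← hcompat]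
    unfold exitPoint
    rw [hX]
    congr 2
    refine Finset.sum_congr rfl fun k _ => ?_
    by_cases hk : σ k = 1
    · rw [H.row_diag hfix (H.ne_of_isAbove (H.isAbove_of_pos hk)).symm ⟨le_rfl, zero_le_one⟩]
      rw [H.side_of_pos hk]; norm_num
    · rw [F.b_zero k j _ hk, mul_zero, mul_zero]
  have hc := H.continuous_side j
  have h1 : ContinuousOn (fun P => u (j, P)) (wedge ∩ {P | side ε σ l i j P ≤ 0}) := by
    refine ((H.continuousOn_highValue F hu hji).mono inter_subset_left).congr fun P hP => ?_
    rcases lt_or_eq_of_le (show side ε σ l i j P ≤ 0 from hP.2) with hlt | heq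
    · exact row_eq_high hfix hP.1 hlt
    · exact hz P hP.1 heq
  have hcl1 : IsClosed (wedge ∩ {P | side ε σ l i j P ≤ 0}) :=
    isClosed_wedge.inter (isClosed_le hc continuous_const)
  have hcl2 : IsClosed (wedge ∩ {P | 0 ≤ side ε σ l i j P}) :=
    isClosed_wedge.inter (isClosed_le continuous_const hc)
  refine (h1.union_of_isClosed (hu.low j) hcl1 hcl2).mono fun P hP => ?_
  rcases le_total (side ε σ l i j P) 0 with hs | hs
  · exact Or.inl ⟨hP, hs⟩
  · exact Or.inr ⟨hP, hs⟩

end RowSpeeds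

/-- The properties of a row of the kernel. -/
structure IsKernelRow (ε : ℝ) (i : ι) (σ : ι → ℝ) (l l' : ι → ℝ → ℝ → ℝ)
    (m : ι → ι → ℝ → ℝ → ℝ) (r : ι → ℝ → ℝ → ℝ) (h : ι → ℝ → ℝ) (b : ι → ι → ℝ → ℝ)
    (k : ι → ℝ × ℝ × ℝ → ℝ) : Prop where
  bdd : ∃ B, ∀ j P, |k j P| ≤ B
  cont : ∀ j, ¬ (IsAbove ε l i j ∧ σ j = -1) → ContinuousOn (k j) wedge
  low : ∀ j, IsAbove ε l i j → σ j = -1 → ContinuousOn (k j)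
    (wedge ∩ {P | hit (l j) P.1 P.2.2 ≤ hit (l i) P.1 P.2.1})
  high : ∀ j, IsAbove ε l i j → σ j = -1 → ∃ g, ContinuousOn g wedge ∧ ∀ P ∈ wedge,
    hit (l i) P.1 P.2.1 < hit (l j) P.1 P.2.2 → k j P = g P
  compat : ∀ j, IsAbove ε l i j → σ j = -1 →
    (∀ t, h j t + ∑ q, r q t 0 * b q j t = r j t 0) → ContinuousOn (k j) wedge
  along : ∀ (j : ι) (s₁ s₂ : ℝ) (X Y : ℝ → ℝ), s₁ ≤ s₂ → IsTraj (l i) X → IsTraj (l j) Y →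
    (∀ s ∈ Icc s₁ s₂, (s, X s, Y s) ∈ wedge) →
    IntervalIntegrable (fun s => k j (s, X s, Y s) * l' j s (Y s) +
      ∑ q, k q (s, X s, Y s) * m q j s (Y s)) volume s₁ s₂ ∧
    k j (s₂, X s₂, Y s₂) = k j (s₁, X s₁, Y s₁) - ∫ s in s₁..s₂,
      (k j (s, X s, Y s) * l' j s (Y s) + ∑ q, k q (s, X s, Y s) * m q j s (Y s))
  diag : ∀ j, j ≠ i → ∀ t, ∀ x ∈ Ioc (0 : ℝ) 1, k j (t, x, x) = r j t x
  face : ∀ j, j = i ∨ (IsAbove ε l i j ∧ σ j = -1) → ∀ t, ∀ x ∈ Icc (0 : ℝ) 1,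
    k j (t, x, 0) = h j t + ∑ q, k q (t, x, 0) * b q j t

theorem Speed.amp_zero {ε C σ : ℝ} {l l' : ℝ → ℝ → ℝ} (hl : Speed ε C σ l l') (t : ℝ) :
    amp l l' t 0 = 1 := by
  simp [amp, hl.hit_zero]

namespace RowSpeeds

variable {ε C : ℝ} {i : ι} {σ : ι → ℝ} {l l' : ι → ℝ → ℝ → ℝ} (H : RowSpeeds ε C i σ l l')
  {N : ℝ} {m : ι → ι → ℝ → ℝ → ℝ} {r : ι → ℝ → ℝ → ℝ} {h : ι → ℝ → ℝ}
  {b : ι → ι → ℝ → ℝ} (F : RowData N i σ m r h b)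
include H F

omit [Fintype ι] in
/-- Removal of the zeroth order term by the factors `amp`. -/
theorem rowData_amp : RowData (N * (Real.exp (2 * C / ε) * Real.exp (2 * C / ε))) i σ
    (fun k j t x => m k j t x * (amp (l k) (l' k) t x / amp (l j) (l' j) t x))
    (fun j t x => r j t x / amp (l j) (l' j) t x) h b := by
  have hN := F.nonneg
  have hC : 0 ≤ 2 * C / ε := by
    have := H.eps_pos
    have := H.base.C_nonneg
    positivity
  set a := Real.exp (2 * C / ε)
  have ha : 1 ≤ a := Real.one_le_exp hC
  have haa : 1 ≤ a * a := by nlinarith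
  have hNa : N ≤ N * (a * a) := le_mul_of_one_le_right hN haa
  have hinv : ∀ j t x, 1 / amp (l j) (l' j) t x ≤ a := by
    intro j t x
    rw [div_le_iff₀ (amp_pos _ _ _ _)]
    have := (H.speed j).le_amp t x
    calc (1 : ℝ) = a * Real.exp (-(2 * C / ε)) := by rw [← Real.exp_add]; simp
      _ ≤ _ := mul_le_mul_of_nonneg_left this (by linarith)
  have hc := fun j => (H.speed j).continuous_amp
  have hne : ∀ j (q : ℝ × ℝ), amp (l j) (l' j) q.1 q.2 ≠ 0 := fun j q => (amp_pos _ _ _ _).ne'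
  refine ⟨fun k j => (F.m_cont k j).mul ((hc k).div (hc j) (hne j)), fun k j t x => ?_,
    fun j t x => by rw [F.m_diag, zero_mul], fun j hj => (F.r_cont j hj).div (hc j) (hne j),
    fun j hj t x => ?_, F.h_cont, fun j t => (F.h_bound j t).trans hNa, F.b_cont,
    fun k j t => (F.b_bound k j t).trans hNa, F.b_zero⟩
  · rw [abs_mul]
    refine mul_le_mul (F.m_bound _ _ _ _) ?_ (abs_nonneg _) hN
    have h1 := amp_pos (l k) (l' k) t x
    have h2 := amp_pos (l j) (l' j) t x
    rw [abs_of_pos (div_pos h1 h2), div_eq_mul_one_div]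
    exact mul_le_mul ((H.speed k).amp_le t x) (hinv j t x) (by positivity) (by linarith)
  · have h2 := amp_pos (l j) (l' j) t x
    rw [abs_div, abs_of_pos h2, div_eq_mul_one_div]
    refine mul_le_mul (F.r_bound j hj t x) ?_ (by positivity) hN
    have := hinv j t x
    nlinarith

/-- With `k_j = amp_j * u_j`, the decay of `amp_j` along `j`-trajectories produces the term with `l'
j`, and the row `u` has coupling `m k j * amp_k / amp_j`, still with zero diagonal. Since `amp`
equals `1` at `ξ = 0`, the face data are unchanged. -/
theorem exists_isKernelRow : ∃ k, IsKernelRow ε i σ l l' m r h b k := by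
  set p : ι → ℝ × ℝ × ℝ → ℝ := fun j P => amp (l j) (l' j) P.1 P.2.2 with hp
  have hpc : ∀ j, Continuous (p j) := fun j =>
    (H.speed j).continuous_amp.comp (by fun_prop : Continuous fun P : ℝ × ℝ × ℝ => (P.1, P.2.2))
  have hp0 : ∀ j P, 0 < p j P := fun j P => amp_pos _ _ _ _
  have F' := H.rowData_amp F
  obtain ⟨u, hu, hfix⟩ := H.exists_row F'
  have hbdd : ∃ B, ∀ j P, |p j P * u (j, P)| ≤ B := by
    obtain ⟨B, hB⟩ := hu.bdd
    refine ⟨Real.exp (2 * C / ε) * B, fun j P => ?_⟩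
    rw [abs_mul, abs_of_pos (hp0 j P)]
    exact mul_le_mul ((H.speed j).amp_le _ _) (hB _) (abs_nonneg _) (Real.exp_pos _).le
  refine ⟨fun j P => p j P * u (j, P), hbdd, fun j hj => ?_, fun j hj hσ => ?_,
    fun j hj hσ => ?_, fun j hj hσ hcompat => ?_, ?_, fun j hj t x hx => ?_,
    fun j hj t x hx => ?_⟩
  · exact (hpc j).continuousOn.mul (continuousOn_of_not_split hu hj)
  · refine (hpc j).continuousOn.mul ((hu.low j).mono fun P hP => ⟨hP.1, ?_⟩)
    rw [mem_ofPred_eq, H.side_of_split hj hσ]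
    exact sub_nonneg.2 hP.2
  · obtain ⟨g, hg, hgu⟩ := H.row_split F' hfix hu hj
    refine ⟨fun P => p j P * g P, (hpc j).continuousOn.mul hg, fun P hP hlt => ?_⟩
    rw [hgu P hP (by rw [H.side_of_split hj hσ]; linarith)]
  · refine (hpc j).continuousOn.mul (H.continuousOn_of_compatible F' hfix hu hj hσ fun t => ?_)
    simp only [(H.speed _).amp_zero, div_one]
    exact hcompat t
  · intro j s₁ s₂ X Y hs hX hY hmem
    set P : ℝ × ℝ × ℝ := (s₁, X s₁, Y s₁) with hPdef
    have hpath : ∀ s, charPath l i j P s = (s, X s, Y s) := by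
      intro s
      simp only [charPath, hPdef]
      rw [(H.speed i).flow_eq hX, (H.speed j).flow_eq hY]
    have hYflow : flow (l j) P.1 P.2.2 = Y := (H.speed j).flow_eq hY s₁
    have hcurve : Continuous fun s => (s, X s, Y s) :=
      continuous_id.prodMk (hX.continuous.prodMk hY.continuous)
    have hkm : ∀ q, Measurable fun s => p q (s, X s, Y s) * u (q, (s, X s, Y s)) := fun q =>
      (((hpc q).measurable.mul (H.measurable_row hu q))).comp hcurve.measurable
    have hint : IntervalIntegrable (fun s => p j (s, X s, Y s) * u (j, (s, X s, Y s)) *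
        l' j s (Y s) + ∑ q, p q (s, X s, Y s) * u (q, (s, X s, Y s)) * m q j s (Y s))
        volume s₁ s₂ := by
      obtain ⟨B, hB⟩ := hbdd
      have hB0 : 0 ≤ B := (abs_nonneg _).trans (hB j 0)
      refine (intervalIntegrable_of_bounded (C := B * C)
        ((hkm j).mul ((H.speed j).measurable_deriv_traj hY.continuous)) (fun s => ?_) _ _).add ?_
      · rw [Pi.mul_apply, abs_mul]
        exact mul_le_mul (hB _ _) ((H.speed j).boundDeriv _ _) (abs_nonneg _) hB0
      · have hfun : (fun s => ∑ q, p q (s, X s, Y s) * u (q, (s, X s, Y s)) * m q j s (Y s)) =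
            ∑ q, fun s => p q (s, X s, Y s) * u (q, (s, X s, Y s)) * m q j s (Y s) := by
          funext s
          simp
        rw [hfun]
        refine IntervalIntegrable.sum _ fun q _ => ?_
        refine intervalIntegrable_of_bounded (C := B * N) ((hkm q).mul
          ((F.m_cont q j).comp (continuous_id.prodMk hY.continuous)).measurable) (fun s => ?_) _ _
        rw [Pi.mul_apply, abs_mul]
        exact mul_le_mul (hB _ _) (F.m_bound _ _ _ _) (abs_nonneg _) hB0
    refine ⟨hint, ?_⟩
    obtain ⟨Ku, hKu⟩ := (H.speed j).lipschitz_amp_traj hY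
    obtain ⟨Bu, hBu⟩ := hu.bdd
    -- The factor is only Lipschitz along the trajectory, with its derivative known almost
    -- everywhere, and `u` is only a primitive. The product rule for absolutely continuous functions
    -- covers this.
    have hprod := mul_sub_mul_eq_integral hs (g := fun s => amp (l j) (l' j) s (Y s))
      (g' := fun s => -l' j s (Y s) * amp (l j) (l' j) s (Y s))
      (v := fun s => u (j, charPath l i j P s)) (φ := rowSource l i _ u j P) hKu (by
        filter_upwards [(H.speed j).ae_traj_ne hY 0, (H.speed j).ae_traj_ne hY 1] with s h0 h1 _
        exact (H.speed j).hasDerivAt_amp_traj hY h0 h1)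
      (intervalIntegrable_of_bounded (H.measurable_source F' hu j P) (abs_source_le F' hBu j P) _ _)
      (fun s hs' => H.row_along F' hfix hu (by rw [hpath]; exact hmem _ ⟨le_rfl, hs⟩)
        (by rw [hpath]; exact hmem s hs'))
    simp only [hpath] at hprod
    have hneg : (∫ s in s₁..s₂, (-l' j s (Y s) * amp (l j) (l' j) s (Y s) *
        u (j, (s, X s, Y s)) - amp (l j) (l' j) s (Y s) * rowSource l i (fun k j t x =>
          m k j t x * (amp (l k) (l' k) t x / amp (l j) (l' j) t x)) u j P s)) =
        -∫ s in s₁..s₂, (p j (s, X s, Y s) * u (j, (s, X s, Y s)) * l' j s (Y s) +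
          ∑ q, p q (s, X s, Y s) * u (q, (s, X s, Y s)) * m q j s (Y s)) := by
      rw [← intervalIntegral.integral_neg]
      refine intervalIntegral.integral_congr fun s _ => ?_
      simp only [rowSource, hpath, hYflow, hp]
      rw [Finset.mul_sum, neg_add, ← Finset.sum_neg_distrib, sub_eq_add_neg,
        ← Finset.sum_neg_distrib]
      congr 1
      · ring
      · refine Finset.sum_congr rfl fun q _ => ?_
        have := (amp_pos (l j) (l' j) s (Y s)).ne'
        field_simp
    rw [hneg] at hprod
    simp only [hp] at hprod ⊢
    linarith
  · have := H.row_diag hfix hj (t := t) ⟨hx.1.le, hx.2⟩ (H.side_diag_neg hj hx.1)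
    simp only [this, hp]
    have := (amp_pos (l j) (l' j) t x).ne'
    field_simp
  · have := H.row_face hfix hj (t := t) hx
    simp only [hp, (H.speed _).amp_zero, one_mul]
    exact this

end RowSpeeds

end Row

/-! ### The interface -/

/-- The surface carried by the characteristics of `∂ₜ + a ∂ₓ + b ∂_ξ` that end on the edge
`x = ξ = 0`. -/
noncomputable def interface (a b : ℝ → ℝ → ℝ) (t x : ℝ) : ℝ := flow b (hit a t x) 0 t

section Interface

variable {ε C : ℝ} {a a' b b' : ℝ → ℝ → ℝ} (ha : Speed ε C (-1) a a') (hb : Speed ε C (-1) b b')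

include hb in
theorem hit_interface (t x : ℝ) : hit b t (interface a b t x) = hit a t x := by
  rw [interface, hb.hit_flow, hb.hit_zero]

include hb in
theorem le_interface_iff {t x ξ : ℝ} : ξ ≤ interface a b t x ↔ hit b t ξ ≤ hit a t x := by
  rw [← hit_interface (a := a) hb, (hb.hit_strictMono t).le_iff_le]

include ha hb

theorem contDiff_interface : ContDiff ℝ 1 fun q : ℝ × ℝ => interface a b q.1 q.2 :=
  hb.contDiff_flow.comp (ha.contDiff_hit.prodMk (contDiff_const.prodMk contDiff_fst))

theorem interface_zero (t : ℝ) : interface a b t 0 = 0 := by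
  rw [interface, ha.hit_zero, hb.flow_self]

theorem interface_nonneg {t x : ℝ} (hx : 0 ≤ x) : 0 ≤ interface a b t x := by
  rw [le_interface_iff hb, hb.hit_zero]
  exact ha.le_hit hx

/-- From a common starting point `x ≥ 0` the trajectory of `a`, the more negative speed, reaches `0`
no later than that of `b`. Equal hitting times therefore force the `b`-trajectory to start no
higher. -/
theorem interface_le (hab : ∀ t x, a t x + ε ≤ b t x) {t x : ℝ} (hx : 0 ≤ x) :
    interface a b t x ≤ x := by
  refine (hb.hit_strictMono t).le_iff_le.1 ?_
  rw [hit_interface hb]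
  have hmono := (ha.increasesAt_hit_of_gt hab (hb.isTraj_flow t x)).strictMono ha.sepRate_pos
  have := hmono.monotone (hb.le_hit (t := t) hx)
  simpa [hb.flow_self, hb.flow_hit, ha.hit_zero] using this

/-- Along an `a`-trajectory the hitting time is constant, so there the interface is the single
`b`-trajectory issued from `0` at that time. The equation is the chain rule for this identity. -/
theorem interface_equation {t x : ℝ} {I J : Set ℝ} (hI : UniqueDiffWithinAt ℝ I t)
    (hJ : UniqueDiffWithinAt ℝ J x) :
    derivWithin (fun s => interface a b s x) I t +
      a t x * derivWithin (fun y => interface a b t y) J x - b t (interface a b t x) = 0 := by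
  have hψ := ((contDiff_interface ha hb).differentiable one_ne_zero (t, x)).hasFDerivAt
  set D := fderiv ℝ (fun q : ℝ × ℝ => interface a b q.1 q.2) (t, x)
  have h1 : HasDerivAt (fun s => interface a b s x) (D (1, 0)) t :=
    hψ.comp_hasDerivAt (f := fun s => (s, x)) t ((hasDerivAt_id t).prodMk (hasDerivAt_const t x))
  have h2 : HasDerivAt (fun y => interface a b t y) (D (0, 1)) x :=
    hψ.comp_hasDerivAt (f := fun y => (t, y)) x ((hasDerivAt_const x t).prodMk (hasDerivAt_id x))
  have hX := ha.isTraj_flow t x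
  have h3 : HasDerivAt (fun s => interface a b s (flow a t x s)) (D (1, a t x)) t := by
    have hX' := hX t
    rw [ha.flow_self] at hX'
    have hψ' : HasFDerivAt (fun q : ℝ × ℝ => interface a b q.1 q.2) D (t, flow a t x t) := by
      rwa [ha.flow_self]
    exact hψ'.comp_hasDerivAt (f := fun s => (s, flow a t x s)) t ((hasDerivAt_id t).prodMk hX')
  have h4 : (fun s => interface a b s (flow a t x s)) = flow b (hit a t x) 0 := by
    funext s
    rw [interface, ha.hit_flow]
  rw [h4] at h3
  have h5 := h3.unique (hb.isTraj_flow (hit a t x) 0 t)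
  have h6 : ((1, a t x) : ℝ × ℝ) = (1, 0) + a t x • (0, 1) := by simp
  rw [h6, map_add, map_smul, smul_eq_mul] at h5
  rw [h1.hasDerivWithinAt.derivWithin hI, h2.hasDerivWithinAt.derivWithin hJ, h5]
  exact sub_self _

end Interface

theorem isInterface_interface {ε C : ℝ} {a a' b b' a₀ b₀ : ℝ → ℝ → ℝ} (ha : Speed ε C (-1) a a')
    (hb : Speed ε C (-1) b b') (hab : ∀ t x, a t x + ε ≤ b t x)
    (ha₀ : ∀ t x, (t, x) ∈ strip → a t x = a₀ t x) (hb₀ : ∀ t x, (t, x) ∈ strip → b t x = b₀ t x) :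
    IsInterface a₀ b₀ (interface a b) := by
  have hmem : ∀ t x : ℝ, (t, x) ∈ strip → interface a b t x ∈ Icc (0 : ℝ) 1 := fun t x h =>
    ⟨interface_nonneg ha hb h.2.1, (interface_le ha hb hab h.2.1).trans h.2.2⟩
  refine ⟨(contDiff_interface ha hb).contDiffOn, hmem, fun t x h => ?_,
    fun t _ => interface_zero ha hb t⟩
  rw [← ha₀ t x h, ← hb₀ t (interface a b t x) ⟨h.1, hmem t x h⟩]
  exact interface_equation ha hb (uniqueDiffOn_Ici 0 t h.1)
    (uniqueDiffOn_Icc zero_lt_one x h.2)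

/-! ### Time reversal -/

theorem Speed.reverse {ε C σ : ℝ} {l l' : ℝ → ℝ → ℝ} (hl : Speed ε C σ l l') :
    Speed ε C (-σ) (fun t x => -l (-t) x) (fun t x => -l' (-t) x) where
  pos := hl.pos
  sq := by simpa using hl.sq
  cont := (hl.cont.comp (by fun_prop : Continuous fun q : ℝ × ℝ => (-q.1, q.2))).neg
  bound t x := by rw [abs_neg]; exact hl.bound _ _
  lip t x y := by
    rw [neg_sub_neg, abs_sub_comm]
    exact hl.lip _ _ _
  sgn t x := by rw [neg_mul_neg]; exact hl.sgn _ _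
  hasDeriv t x h0 h1 := (hl.hasDeriv (-t) x h0 h1).neg
  contDeriv t x h0 h1 := (ContinuousAt.comp (g := fun q : ℝ × ℝ => l' q.1 q.2)
    (f := fun q : ℝ × ℝ => (-q.1, q.2)) (hl.contDeriv (-t) x h0 h1) (by fun_prop)).neg
  contOn := (hl.contOn.comp (by fun_prop : Continuous fun q : ℝ × ℝ => (-q.1, q.2)).continuousOn
    fun q hq => ⟨trivial, hq.2⟩).neg
  support t x hx := by rw [hl.support _ _ hx, neg_zero]
  boundDeriv t x := by rw [abs_neg]; exact hl.boundDeriv _ _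
  meas := (hl.meas.comp (by fun_prop : Measurable fun q : ℝ × ℝ => (-q.1, q.2))).neg

theorem IsTraj.reverse {l : ℝ → ℝ → ℝ} {X : ℝ → ℝ} (hX : IsTraj l X) :
    IsTraj (fun t x => -l (-t) x) fun s => X (-s) := by
  intro s
  have := (hX (-s)).scomp s (hasDerivAt_neg s)
  simpa [Function.comp_def] using this

/-! ### Extension of the speeds to all times and positions -/

/-- Projection of the line to `[0, 1]`. -/
noncomputable def clamp (x : ℝ) : ℝ := max 0 (min x 1)

theorem clamp_mem (x : ℝ) : clamp x ∈ Icc (0 : ℝ) 1 :=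
  ⟨le_max_left _ _, max_le zero_le_one (min_le_right _ _)⟩

theorem clamp_of_mem {x : ℝ} (hx : x ∈ Icc (0 : ℝ) 1) : clamp x = x := by
  rw [clamp, min_eq_left hx.2, max_eq_right hx.1]

theorem continuous_clamp : Continuous clamp := by
  unfold clamp; fun_prop

theorem abs_clamp_sub_le (x y : ℝ) : |clamp x - clamp y| ≤ |x - y| := by
  unfold clamp
  have h1 := abs_max_sub_max_le_max 0 (min x 1) 0 (min y 1)
  have h2 := abs_min_sub_min_le_max x 1 y 1
  simp only [sub_self, abs_zero, abs_nonneg, sup_of_le_right, sup_of_le_left] at h1 h2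
  exact h1.trans h2

/-- Extension of a function on the strip by projection. -/
noncomputable def extend {α : Type*} (f : ℝ → ℝ → α) (t x : ℝ) : α := f (max t 0) (clamp x)

theorem proj_mem_strip (t x : ℝ) : (max t 0, clamp x) ∈ strip :=
  ⟨mem_Ici.2 (le_max_right _ _), clamp_mem x⟩

theorem extend_of_mem {α : Type*} {f : ℝ → ℝ → α} {t x : ℝ} (h : (t, x) ∈ strip) :
    extend f t x = f t x := by
  have h1 : (0 : ℝ) ≤ t := h.1
  rw [extend, max_eq_left h1, clamp_of_mem h.2]

theorem continuous_extend {α : Type*} [TopologicalSpace α] {f : ℝ → ℝ → α}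
    (hf : ContinuousOn (fun q : ℝ × ℝ => f q.1 q.2) strip) :
    Continuous fun q : ℝ × ℝ => extend f q.1 q.2 := by
  have hc := continuous_clamp
  exact hf.comp_continuous (f := fun q : ℝ × ℝ => (max q.1 0, clamp q.2)) (by fun_prop)
    fun q => proj_mem_strip _ _

open Classical in
/-- Extension by zero in `x` of the space derivative of a function on the strip. -/
noncomputable def extendDeriv (f : ℝ → ℝ → ℝ) (t x : ℝ) : ℝ :=
  if x ∈ Icc (0 : ℝ) 1 then derivWithin (fun y => f (max t 0) y) (Icc 0 1) x else 0

theorem extendDeriv_of_mem {f : ℝ → ℝ → ℝ} {t x : ℝ} (h : (t, x) ∈ strip) :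
    extendDeriv f t x = derivWithin (fun y => f t y) (Icc 0 1) x := by
  have h1 : (0 : ℝ) ≤ t := h.1
  rw [extendDeriv, if_pos h.2, max_eq_left h1]

theorem uniqueDiffOn_strip : UniqueDiffOn ℝ strip :=
  (uniqueDiffOn_Ici 0).prod (uniqueDiffOn_Icc zero_lt_one)

theorem hasDerivWithinAt_slice {f : ℝ → ℝ → ℝ}
    (hf : ContDiffOn ℝ 1 (fun q : ℝ × ℝ => f q.1 q.2) strip) {t x : ℝ} (h : (t, x) ∈ strip) :
    HasDerivWithinAt (fun y => f t y)
      (fderivWithin ℝ (fun q : ℝ × ℝ => f q.1 q.2) strip (t, x) (0, 1)) (Icc 0 1) x := by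
  have h1 := (hf.differentiableOn one_ne_zero (t, x) h).hasFDerivWithinAt
  exact h1.comp_hasDerivWithinAt (f := fun y => (t, y)) x
    ((hasDerivAt_const x t).prodMk (hasDerivAt_id x)).hasDerivWithinAt fun y hy => ⟨h.1, hy⟩

theorem continuousOn_derivWithin_slice {f : ℝ → ℝ → ℝ}
    (hf : ContDiffOn ℝ 1 (fun q : ℝ × ℝ => f q.1 q.2) strip) :
    ContinuousOn (fun q : ℝ × ℝ => derivWithin (fun y => f q.1 y) (Icc 0 1) q.2) strip := by
  have h1 := (hf.continuousOn_fderivWithin uniqueDiffOn_strip le_rfl).clm_apply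
    (continuousOn_const (c := ((0, 1) : ℝ × ℝ)))
  refine h1.congr fun q hq => ?_
  exact (hasDerivWithinAt_slice hf (t := q.1) (x := q.2) hq).derivWithin
    (uniqueDiffOn_Icc zero_lt_one q.2 hq.2)

/-- Projection to the strip is `1`-Lipschitz in `x`, so bounds, sign and Lipschitz constant carry
over. Outside `[0, 1]` the extension is constant in `x`; its derivative can jump only at `0` and
`1`, the points that `Speed` excludes. -/
theorem speed_extend {ε C σ : ℝ} {f : ℝ → ℝ → ℝ} (hε : 0 < ε) (hσ : σ * σ = 1)
    (hf : ContDiffOn ℝ 1 (fun q : ℝ × ℝ => f q.1 q.2) strip)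
    (hC : ∀ t x : ℝ, (t, x) ∈ strip → |f t x| ≤ C ∧
      |derivWithin (fun y => f t y) (Icc 0 1) x| ≤ C)
    (hs : ∀ t x : ℝ, (t, x) ∈ strip → ε ≤ σ * f t x) :
    Speed ε C σ (extend f) (extendDeriv f) := by
  have hC0 : 0 ≤ C := (abs_nonneg _).trans (hC 0 0 ⟨mem_Ici.2 le_rfl, ⟨le_rfl, zero_le_one⟩⟩).1
  have hdiff : ∀ t : ℝ, 0 ≤ t → DifferentiableOn ℝ (fun y => f t y) (Icc 0 1) := fun t ht x hx =>
    (hasDerivWithinAt_slice hf (t := t) (x := x) ⟨ht, hx⟩).differentiableWithinAt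
  have hout : ∀ x : ℝ, x ∉ Icc (0 : ℝ) 1 → ∀ᶠ y in 𝓝 x, y ∉ Icc (0 : ℝ) 1 := fun x hx =>
    isClosed_Icc.isOpen_compl.mem_nhds hx
  have hD : ContinuousOn (fun q : ℝ × ℝ => extendDeriv f q.1 q.2) (univ ×ˢ Icc 0 1) := by
    have := (continuousOn_derivWithin_slice hf).comp (s := univ ×ˢ Icc (0 : ℝ) 1)
      (f := fun q : ℝ × ℝ => (max q.1 0, q.2))
      (by fun_prop) fun q hq => ⟨mem_Ici.2 (le_max_right _ _), hq.2⟩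
    refine this.congr fun q hq => ?_
    simp only [extendDeriv]
    rw [if_pos hq.2]
    rfl
  refine ⟨hε, hσ, continuous_extend hf.continuousOn, fun t x => (hC _ _ (proj_mem_strip t x)).1,
    fun t x y => ?_, fun t x => hs _ _ (proj_mem_strip t x), fun t x h0 h1 => ?_,
    fun t x h0 h1 => ?_, hD, fun t x hx => if_neg hx, fun t x => ?_, ?_⟩
  · have := Convex.norm_image_sub_le_of_norm_derivWithin_le (C := C)
      (hdiff (max t 0) (le_max_right _ _))
      (fun z hz => (hC _ z ⟨mem_Ici.2 (le_max_right _ _), hz⟩).2)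
      (convex_Icc 0 1) (clamp_mem y) (clamp_mem x)
    exact this.trans (mul_le_mul_of_nonneg_left (abs_clamp_sub_le x y) hC0)
  · by_cases hx : x ∈ Icc (0 : ℝ) 1
    · have hx' : x ∈ Ioo (0 : ℝ) 1 := ⟨lt_of_le_of_ne hx.1 h0.symm, lt_of_le_of_ne hx.2 h1⟩
      have hn := Icc_mem_nhds hx'.1 hx'.2
      rw [extendDeriv, if_pos hx]
      have := ((hdiff (max t 0) (le_max_right _ _) x hx).hasDerivWithinAt).hasDerivAt hn
      refine this.congr_of_eventuallyEq ?_
      filter_upwards [hn] with y hy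
      rw [extend, clamp_of_mem hy]
    · rw [extendDeriv, if_neg hx]
      rcases lt_or_ge x 0 with h | h
      · refine (hasDerivAt_const x (f (max t 0) 0)).congr_of_eventuallyEq ?_
        filter_upwards [gt_mem_nhds h] with y hy
        rw [extend, clamp, max_eq_left ((min_le_left _ _).trans hy.le)]
      · have h' : 1 < x := by
          by_contra h2
          exact hx ⟨h, not_lt.1 h2⟩
        refine (hasDerivAt_const x (f (max t 0) 1)).congr_of_eventuallyEq ?_
        filter_upwards [lt_mem_nhds h'] with y hy
        rw [extend, clamp, min_eq_right hy.le, max_eq_right zero_le_one]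
  · by_cases hx : x ∈ Icc (0 : ℝ) 1
    · have hx' : x ∈ Ioo (0 : ℝ) 1 := ⟨lt_of_le_of_ne hx.1 h0.symm, lt_of_le_of_ne hx.2 h1⟩
      exact hD.continuousAt (prod_mem_nhds univ_mem (Icc_mem_nhds hx'.1 hx'.2))
    · have hev : ∀ᶠ q : ℝ × ℝ in 𝓝 (t, x), extendDeriv f q.1 q.2 = 0 := by
        have hsnd : Tendsto Prod.snd (𝓝 (t, x)) (𝓝 x) := continuous_snd.tendsto (t, x)
        filter_upwards [hsnd.eventually (hout x hx)] with q hq using if_neg hq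
      exact (continuousAt_const (y := (0 : ℝ))).congr (hev.mono fun q hq => hq.symm)
  · unfold extendDeriv
    split_ifs with hx
    · exact (hC _ _ ⟨mem_Ici.2 (le_max_right _ _), hx⟩).2
    · simpa using hC0
  · classical
    have hm := hD.measurable_piecewise (continuousOn_const (c := (0 : ℝ)))
      (MeasurableSet.univ.prod measurableSet_Icc)
    convert! hm using 1
    funext q
    by_cases hq : q.2 ∈ Icc (0 : ℝ) 1
    · rw [piecewise_eq_of_mem _ _ _ (show q ∈ univ ×ˢ Icc (0 : ℝ) 1 from ⟨trivial, hq⟩)]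
    · rw [piecewise_eq_of_notMem _ _ _ (fun h => hq h.2)]
      exact if_neg hq

/-! ### Rows of positive speed, by time reversal. -/

section Rows

variable {ι : Type*} [Fintype ι]

/-- The part of the kernel equations that concerns a single row. -/
structure IsBroadRow (i : ι) (l l' : ι → ℝ → ℝ → ℝ) (m : ι → ι → ℝ → ℝ → ℝ)
    (r : ι → ℝ → ℝ → ℝ) (k : ι → ℝ × ℝ × ℝ → ℝ) : Prop where
  bdd : ∃ B, ∀ j P, |k j P| ≤ B
  along : ∀ (j : ι) (s₁ s₂ : ℝ) (X Y : ℝ → ℝ), s₁ ≤ s₂ → IsTraj (l i) X → IsTraj (l j) Y →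
    (∀ s ∈ Icc s₁ s₂, (s, X s, Y s) ∈ wedge) →
    IntervalIntegrable (fun s => k j (s, X s, Y s) * l' j s (Y s) +
      ∑ q, k q (s, X s, Y s) * m q j s (Y s)) volume s₁ s₂ ∧
    k j (s₂, X s₂, Y s₂) = k j (s₁, X s₁, Y s₁) - ∫ s in s₁..s₂,
      (k j (s, X s, Y s) * l' j s (Y s) + ∑ q, k q (s, X s, Y s) * m q j s (Y s))
  diag : ∀ j, j ≠ i → ∀ t, ∀ x ∈ Ioc (0 : ℝ) 1, k j (t, x, x) = r j t x

theorem IsKernelRow.isBroadRow {ε : ℝ} {i : ι} {σ : ι → ℝ} {l l' : ι → ℝ → ℝ → ℝ}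
    {m : ι → ι → ℝ → ℝ → ℝ} {r : ι → ℝ → ℝ → ℝ} {h : ι → ℝ → ℝ} {b : ι → ι → ℝ → ℝ}
    {k : ι → ℝ × ℝ × ℝ → ℝ} (hk : IsKernelRow ε i σ l l' m r h b k) :
    IsBroadRow i l l' m r k :=
  ⟨hk.bdd, hk.along, hk.diag⟩

theorem IsBroadRow.reverse {i : ι} {l l' : ι → ℝ → ℝ → ℝ}
    {m : ι → ι → ℝ → ℝ → ℝ} {r : ι → ℝ → ℝ → ℝ} {k : ι → ℝ × ℝ × ℝ → ℝ}
    (hk : IsBroadRow i (fun j t x => -l j (-t) x) (fun j t x => -l' j (-t) x)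
      (fun q j t x => -m q j (-t) x) (fun j t x => r j (-t) x) k) :
    IsBroadRow i l l' m r fun j P => k j (-P.1, P.2) := by
  obtain ⟨B, hB⟩ := hk.bdd
  refine ⟨⟨B, fun j P => hB j _⟩, fun j s₁ s₂ X Y hs hX hY hmem => ?_, fun j hj t x hx => ?_⟩
  · obtain ⟨h1, h2⟩ := hk.along j (-s₂) (-s₁) _ _ (neg_le_neg hs) hX.reverse hY.reverse
      fun s hs' => hmem (-s) ⟨le_neg.1 hs'.2, neg_le.1 hs'.1⟩
    have h3 := ((IntervalIntegrable.iff_comp_neg (by simp)).1 h1).symm.neg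
    have h4 := intervalIntegral.integral_comp_neg (a := s₁) (b := s₂) (fun s =>
      k j (s, X (-s), Y (-s)) * -l' j (-s) (Y (-s)) +
        ∑ q, k q (s, X (-s), Y (-s)) * -m q j (-s) (Y (-s)))
    rw [← h4] at h2
    simp only [neg_neg, mul_neg, Finset.sum_neg_distrib, ← neg_add,
      intervalIntegral.integral_neg] at h2 h3
    refine ⟨?_, ?_⟩
    · convert! h3 using 1
      funext s
      simp
    · simp only
      linarith
  · rw [hk.diag j hj (-t) x hx, neg_neg]

variable {ε C N : ℝ} {i : ι} {σ : ι → ℝ} {l l' : ι → ℝ → ℝ → ℝ}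

/-- Rows of positive speed: all the entries can be chosen continuous. -/
theorem exists_isBroadRow_of_pos (hl : ∀ j, Speed ε C (σ j) (l j) (l' j))
    (hgap : ∀ j k, j ≠ k → IsAbove ε l j k ∨ IsAbove ε l k j) (hi : σ i = 1)
    {m : ι → ι → ℝ → ℝ → ℝ} {r : ι → ℝ → ℝ → ℝ}
    (hm : ∀ q j, Continuous fun z : ℝ × ℝ => m q j z.1 z.2) (hmN : ∀ q j t x, |m q j t x| ≤ N)
    (hmd : ∀ j t x, m j j t x = 0)
    (hr : ∀ j, j ≠ i → Continuous fun z : ℝ × ℝ => r j z.1 z.2)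
    (hrN : ∀ j, j ≠ i → ∀ t x, |r j t x| ≤ N) :
    ∃ k, IsBroadRow i l l' m r k ∧ ∀ j, ContinuousOn (k j) wedge := by
  classical
  have hN : 0 ≤ N := (abs_nonneg _).trans (hmN i i 0 0)
  have hneg : Continuous fun z : ℝ × ℝ => (-z.1, z.2) := by fun_prop
  have H : RowSpeeds ε C i (fun j => -σ j) (fun j t x => -l j (-t) x)
      (fun j t x => -l' j (-t) x) := by
    refine ⟨fun j => (hl j).reverse, by rw [hi], fun j k hjk => ?_⟩
    rcases hgap j k hjk with h | h
    · exact Or.inr fun t x => by linarith [h (-t) x]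
    · exact Or.inl fun t x => by linarith [h (-t) x]
  -- The face data are free in such a row. Taking the diagonal data at the corner, with no coupling
  -- on the face, is what makes `compat` applicable.
  have F : RowData N i (fun j => -σ j) (fun q j t x => -m q j (-t) x) (fun j t x => r j (-t) x)
      (fun j t => if j = i then 0 else r j (-t) 0) (fun _ _ _ => 0) := by
    refine ⟨fun q j => ((hm q j).comp hneg).neg, fun q j t x => by rw [abs_neg]; exact hmN _ _ _ _,
      fun j t x => by rw [hmd, neg_zero], fun j hj => (hr j hj).comp hneg,
      fun j hj t x => hrN j hj _ _, fun j => ?_, fun j t => ?_, fun _ _ => continuous_const,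
      fun _ _ _ => by simpa using hN, fun _ _ _ _ => rfl⟩
    · split_ifs with hj
      · exact continuous_const
      · exact (hr j hj).comp (by fun_prop : Continuous fun t : ℝ => (-t, (0 : ℝ)))
    · split_ifs with hj
      · simpa using hN
      · exact hrN j hj _ _
  obtain ⟨k, hk⟩ := H.exists_isKernelRow F
  refine ⟨_, hk.isBroadRow.reverse, fun j => ?_⟩
  have hkj : ContinuousOn (k j) wedge := by
    by_cases hj : IsAbove ε (fun j t x => -l j (-t) x) i j ∧ -σ j = -1
    · refine hk.compat j hj.1 hj.2 fun t => ?_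
      rw [if_neg (H.ne_of_isAbove hj.1).symm]
      simp
    · exact hk.cont j hj
  exact hkj.comp (by fun_prop : Continuous fun P : ℝ × ℝ × ℝ => (-P.1, P.2)).continuousOn
    fun P hP => hP

end Rows

/-! ### The rows for the given speeds and couplings. -/

section Speeds

variable {m p : ℕ}

/-- The sign of the `j`-th speed. -/
noncomputable def speedSign (m : ℕ) {n : ℕ} (j : Fin n) : ℝ := if (j : ℕ) < m then -1 else 1

theorem speedSign_castAdd (i : Fin m) : speedSign m (Fin.castAdd p i) = -1 := by
  simp [speedSign]

theorem speedSign_natAdd (i : Fin p) : speedSign m (Fin.natAdd m i) = 1 := by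
  simp [speedSign]

theorem AdmissibleSpeeds.exists_speed {ε : ℝ} (hε : 0 < ε) {lam : Fin (m + p) → ℝ → ℝ → ℝ}
    (hlam : AdmissibleSpeeds ε lam) :
    ∃ C, ∀ j, Speed ε C (speedSign m j) (extend (lam j)) (extendDeriv (lam j)) := by
  obtain ⟨C, hC⟩ := hlam.bounded
  refine ⟨C, fun j => ?_⟩
  refine speed_extend hε ?_ (hlam.contDiffOn j) (hC j) fun t x h => ?_
  · unfold speedSign
    split_ifs <;> norm_num
  · refine Fin.addCases (fun i => ?_) (fun i => ?_) j
    · rw [speedSign_castAdd]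
      linarith [hlam.neg i t x h]
    · rw [speedSign_natAdd, one_mul]
      exact (hlam.pos i t x h).le

theorem AdmissibleSpeeds.isAbove {ε : ℝ} {lam : Fin (m + p) → ℝ → ℝ → ℝ}
    (hlam : AdmissibleSpeeds ε lam) {i j : Fin (m + p)} (hij : i < j) :
    IsAbove ε (fun j => extend (lam j)) i j := fun t x => by
  have := hlam.gap i j hij _ _ (proj_mem_strip t x)
  simp only [extend]
  linarith

theorem AdmissibleSpeeds.isAbove_or {ε : ℝ} {lam : Fin (m + p) → ℝ → ℝ → ℝ}
    (hlam : AdmissibleSpeeds ε lam) {i j : Fin (m + p)} (hij : i ≠ j) :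
    IsAbove ε (fun j => extend (lam j)) i j ∨ IsAbove ε (fun j => extend (lam j)) j i :=
  (lt_or_gt_of_ne hij).imp hlam.isAbove hlam.isAbove

theorem AdmissibleSpeeds.lt_of_isAbove {ε : ℝ} (hε : 0 < ε) {lam : Fin (m + p) → ℝ → ℝ → ℝ}
    (hlam : AdmissibleSpeeds ε lam) {i j : Fin (m + p)}
    (h : IsAbove ε (fun j => extend (lam j)) i j) : i < j := by
  have h0 := h 0 0
  by_contra hij
  rcases (not_lt.1 hij).lt_or_eq with hlt | rfl
  · have := hlam.isAbove hlt 0 0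
    linarith
  · linarith

/-- The coefficients of the boundary condition on `ξ = 0`. -/
noncomputable def faceCoeff (lam : Fin (m + p) → ℝ → ℝ → ℝ) (Q : ℝ → Matrix (Fin p) (Fin m) ℝ)
    (q j : Fin (m + p)) (t : ℝ) : ℝ :=
  Fin.addCases (motive := fun _ => ℝ) (fun _ => 0) (fun a => Fin.addCases (motive := fun _ => ℝ)
    (fun c => -(extend (lam (Fin.natAdd m a)) t 0 * Q (max t 0) a c) /
      extend (lam (Fin.castAdd p c)) t 0) (fun _ => 0) j) q

theorem continuous_and_bounded_faceCoeff {ε C : ℝ} {lam : Fin (m + p) → ℝ → ℝ → ℝ}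
    (hl : ∀ j, Speed ε C (speedSign m j) (extend (lam j)) (extendDeriv (lam j)))
    {Q : ℝ → Matrix (Fin p) (Fin m) ℝ} (hQ : ContinuousOn Q (Ici 0)) {B : ℝ} (hB0 : 0 ≤ B)
    (hB : ∀ t : ℝ, 0 ≤ t → ∀ i j, |Q t i j| ≤ B) {A : ℝ} (hA : C * B / ε ≤ A) (hA0 : 0 ≤ A)
    (q j : Fin (m + p)) : Continuous (faceCoeff lam Q q j) ∧ ∀ t, |faceCoeff lam Q q j t| ≤ A := by
  unfold faceCoeff
  refine Fin.addCases (fun a => ?_) (fun a => ?_) q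
  · simpa using ⟨continuous_const, hA0⟩
  refine Fin.addCases (fun c => ?_) (fun c => ?_) j
  · simp only [Fin.addCases_left, Fin.addCases_right]
    have h1 : ∀ j, Continuous fun t => extend (lam j) t 0 := fun j =>
      (hl j).cont.comp (by fun_prop : Continuous fun t : ℝ => (t, (0 : ℝ)))
    have h2 : Continuous fun t => Q (max t 0) a c :=
      (continuous_apply_apply a c).comp
        (hQ.comp_continuous (by fun_prop) fun t => mem_Ici.2 (le_max_right t 0))
    refine ⟨(((h1 _).mul h2).neg).div (h1 _) fun t => (hl _).ne_zero t 0, fun t => ?_⟩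
    rw [abs_div, abs_neg, abs_mul]
    refine le_trans ?_ hA
    have hε := (hl (Fin.natAdd m a)).pos
    refine div_le_div₀ (mul_nonneg (hl (Fin.natAdd m a)).C_nonneg hB0) ?_ hε
      ((hl (Fin.castAdd p c)).eps_le t 0)
    exact mul_le_mul ((hl _).bound _ _) (hB _ (le_max_right _ _) _ _) (abs_nonneg _)
      (hl (Fin.natAdd m a)).C_nonneg
  · simpa using ⟨continuous_const, hA0⟩

theorem faceCoeff_eq_zero (lam : Fin (m + p) → ℝ → ℝ → ℝ) (Q : ℝ → Matrix (Fin p) (Fin m) ℝ)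
    (q j : Fin (m + p)) (t : ℝ) (hq : speedSign m q ≠ 1) : faceCoeff lam Q q j t = 0 := by
  revert hq
  refine Fin.addCases (fun a _ => ?_) (fun a ha => ?_) q
  · simp [faceCoeff]
  · exact absurd (speedSign_natAdd a) ha

/-- The value of the off-diagonal entry `k i j` on `ξ = x`. -/
noncomputable def diagValue (lam : Fin (m + p) → ℝ → ℝ → ℝ)
    (M : ℝ → ℝ → Matrix (Fin (m + p)) (Fin (m + p)) ℝ) (i j : Fin (m + p)) (t x : ℝ) : ℝ :=
  extend (fun t x => M t x i j) t x / (extend (lam i) t x - extend (lam j) t x)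

/-- Rows of negative speed are solved with zero face data and coupling `faceCoeff`, which encodes
the vanishing of the gain. Rows of positive speed come from `exists_isBroadRow_of_pos`. -/
theorem exists_rows {ε : ℝ} (hε : 0 < ε) {lam : Fin (m + p) → ℝ → ℝ → ℝ}
    (hlam : AdmissibleSpeeds ε lam) {M : ℝ → ℝ → Matrix (Fin (m + p)) (Fin (m + p)) ℝ}
    (hM : AdmissibleCoupling M) {Q : ℝ → Matrix (Fin p) (Fin m) ℝ} (hQ : AdmissibleBoundary Q) :
    ∃ k : Fin (m + p) → Fin (m + p) → ℝ × ℝ × ℝ → ℝ,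
      (∀ i, IsBroadRow i (fun j => extend (lam j)) (fun j => extendDeriv (lam j))
        (fun q j => extend fun t x => M t x q j) (diagValue lam M i) (k i)) ∧
      (∀ i : Fin m, IsKernelRow ε (Fin.castAdd p i) (speedSign m) (fun j => extend (lam j))
        (fun j => extendDeriv (lam j)) (fun q j => extend fun t x => M t x q j)
        (diagValue lam M (Fin.castAdd p i)) (fun _ _ => 0) (faceCoeff lam Q)
        (k (Fin.castAdd p i))) ∧
      ∀ (i : Fin p) (j : Fin (m + p)), ContinuousOn (k (Fin.natAdd m i) j) wedge := by
  obtain ⟨C, hl⟩ := hlam.exists_speed hε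
  obtain ⟨A, hA⟩ := hM.bounded
  obtain ⟨B, hB⟩ := hQ.bounded
  -- One constant for the coupling (`|A|`), the diagonal values (`|A| / ε`, by the speed gap) and
  -- the face coefficients (`C * |B| / ε`, by the lower bound on the speeds).
  set N := |A| * (1 + 1 / ε) + |C| * |B| / ε with hN
  have hAN : |A| ≤ N := by
    have : 0 ≤ |A| * (1 / ε) + |C| * |B| / ε := by positivity
    rw [hN]; linarith
  have hAεN : |A| / ε ≤ N := by
    have : 0 ≤ |A| + |C| * |B| / ε := by positivity
    rw [hN, mul_add, mul_one_div]; linarith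
  have hBN : C * |B| / ε ≤ N := by
    have : 0 ≤ |A| * (1 + 1 / ε) := by positivity
    have h2 : C * |B| / ε ≤ |C| * |B| / ε := by
      gcongr
      exact le_abs_self C
    rw [hN]; linarith
  have hN0 : 0 ≤ N := (abs_nonneg A).trans hAN
  have hm : ∀ q j, Continuous fun z : ℝ × ℝ => extend (fun t x => M t x q j) z.1 z.2 := fun q j =>
    continuous_extend ((continuous_apply_apply q j).comp_continuousOn hM.continuousOn)
  have hmA : ∀ q j t x, |extend (fun t x => M t x q j) t x| ≤ |A| := fun q j t x =>
    (hA _ _ (proj_mem_strip t x) q j).trans (le_abs_self A)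
  have hmN : ∀ q j t x, |extend (fun t x => M t x q j) t x| ≤ N := fun q j t x =>
    (hmA q j t x).trans hAN
  have hmd : ∀ j t x, extend (fun t x => M t x j j) t x = 0 := fun j t x =>
    hM.diag_zero _ _ (proj_mem_strip t x) j
  have hgap : ∀ i j, i ≠ j → ∀ t x, ε ≤ |extend (lam i) t x - extend (lam j) t x| := by
    intro i j hij t x
    rcases hlam.isAbove_or hij with h | h
    · rw [abs_sub_comm]
      exact le_trans (by linarith [h t x]) (le_abs_self _)
    · exact le_trans (by linarith [h t x]) (le_abs_self _)
  have hr : ∀ i j, j ≠ i → Continuous fun z : ℝ × ℝ => diagValue lam M i j z.1 z.2 := by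
    intro i j hij
    refine (hm i j).div ((hl i).cont.sub (hl j).cont) fun z => ?_
    exact abs_pos.1 (hε.trans_le (hgap i j hij.symm z.1 z.2))
  have hrN : ∀ i j, j ≠ i → ∀ t x, |diagValue lam M i j t x| ≤ N := by
    intro i j hij t x
    refine le_trans ?_ hAεN
    rw [diagValue, abs_div]
    exact div_le_div₀ (abs_nonneg A) (hmA i j t x) hε (hgap i j hij.symm t x)
  have hb := continuous_and_bounded_faceCoeff hl hQ.continuousOn (abs_nonneg B)
    (fun t ht i j => (hB t ht i j).trans (le_abs_self B)) hBN hN0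
  have hrow : ∀ i : Fin m, ∃ k, IsKernelRow ε (Fin.castAdd p i) (speedSign m)
      (fun j => extend (lam j)) (fun j => extendDeriv (lam j))
      (fun q j => extend fun t x => M t x q j) (diagValue lam M (Fin.castAdd p i)) (fun _ _ => 0)
      (faceCoeff lam Q) k := by
    intro i
    have H : RowSpeeds ε C (Fin.castAdd p i) (speedSign m) (fun j => extend (lam j))
      (fun j => extendDeriv (lam j)) :=
      ⟨hl, speedSign_castAdd i, fun j k hjk => hlam.isAbove_or hjk⟩
    exact H.exists_isKernelRow (N := N) ⟨hm, hmN, hmd, hr _, hrN _, fun _ => continuous_const,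
      fun _ _ => by simpa using hN0, fun q j => (hb q j).1, fun q j => (hb q j).2,
      faceCoeff_eq_zero lam Q⟩
  choose k₁ hk₁ using hrow
  choose k₂ hk₂ hk₂c using fun i : Fin p => exists_isBroadRow_of_pos (i := Fin.natAdd m i) hl
    (fun j k hjk => hlam.isAbove_or hjk) (speedSign_natAdd i) hm hmN hmd
    (hr (Fin.natAdd m i)) (hrN _)
  let k : Fin (m + p) → Fin (m + p) → ℝ × ℝ × ℝ → ℝ := fun i =>
    Fin.addCases (motive := fun _ => Fin (m + p) → ℝ × ℝ × ℝ → ℝ) k₁ k₂ i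
  have e₁ : ∀ a, k (Fin.castAdd p a) = k₁ a := fun a => Fin.addCases_left a
  have e₂ : ∀ a, k (Fin.natAdd m a) = k₂ a := fun a => Fin.addCases_right a
  refine ⟨k, fun i => ?_, fun i => ?_, fun i j => ?_⟩
  · refine Fin.addCases (fun a => ?_) (fun a => ?_) i
    · rw [e₁]; exact (hk₁ a).isBroadRow
    · rw [e₂]; exact hk₂ a
  · rw [e₁]; exact hk₁ i
  · rw [e₂]; exact hk₂c i j

end Speeds

/-! ### The closed prism -/

theorem closure_prism_subset : closure prism ⊆ {q | 0 ≤ q.1} ∩ wedge := by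
  refine closure_minimal (fun q hq => ⟨hq.1.le, hq.2.2.1.1.le, hq.2.2.2.le, hq.2.1.2.le⟩) ?_
  have : IsClosed {q : ℝ × ℝ × ℝ | 0 ≤ q.1} := isClosed_le (by fun_prop) (by fun_prop)
  exact this.inter isClosed_wedge

theorem mem_strip_of_mem_prism {t x ξ : ℝ} (h : (t, x, ξ) ∈ closure prism) :
    (t, x) ∈ strip ∧ (t, ξ) ∈ strip := by
  obtain ⟨h0, h1, h2, h3⟩ := closure_prism_subset h
  exact ⟨⟨h0, h1.trans h2, h3⟩, ⟨h0, h1, h2.trans h3⟩⟩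

/-- A characteristic is a piece of a global trajectory of the extended speed. -/
theorem IsCharacteristic.eqOn_flow {ε C σ : ℝ} {f f' : ℝ → ℝ → ℝ}
    (hl : Speed ε C σ (extend f) f') {s₁ s₂ : ℝ} (h0 : 0 ≤ s₁) {X : ℝ → ℝ}
    (hX : IsCharacteristic f s₁ s₂ X) : EqOn X (flow (extend f) s₁ (X s₁)) (Icc s₁ s₂) := by
  have hF := hl.isTraj_flow s₁ (X s₁)
  refine ODE_solution_unique (v := extend f) (K := C.toNNReal) hl.lipschitzWith
    (fun s hs => (hX s hs).2.continuousWithinAt) (fun s hs => ?_) hF.continuous.continuousOn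
    (fun s _ => (hF s).hasDerivWithinAt) (hl.flow_self _ _).symm
  obtain ⟨h1, h2⟩ := hX s (Ico_subset_Icc_self hs)
  rw [extend_of_mem (⟨mem_Ici.2 (h0.trans hs.1), h1⟩ : (s, X s) ∈ strip)]
  exact h2.mono_of_mem_nhdsWithin (Icc_mem_nhdsGE_of_mem hs)

theorem closure_prismBelow_subset {ψ : ℝ → ℝ → ℝ} {S : Set (ℝ × ℝ × ℝ)} (hS : IsClosed S)
    (h : ∀ P ∈ prism, P.2.2 ≤ ψ P.1 P.2.1 → P ∈ S) : closure (prismBelow ψ) ⊆ wedge ∩ S :=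
  closure_minimal (fun P hP => ⟨(closure_prism_subset (subset_closure hP.1)).2, h P hP.1 hP.2.le⟩)
    (isClosed_wedge.inter hS)

theorem closure_prismAbove_subset {ψ : ℝ → ℝ → ℝ} : closure (prismAbove ψ) ⊆ wedge :=
  closure_minimal (fun _ hP => (closure_prism_subset (subset_closure hP.1)).2) isClosed_wedge

section Row

variable {ι : Type*} [Fintype ι] {ε C : ℝ} {i j : ι} {σ : ι → ℝ} {l l' : ι → ℝ → ℝ → ℝ}
  {m : ι → ι → ℝ → ℝ → ℝ} {r : ι → ℝ → ℝ → ℝ} {h : ι → ℝ → ℝ} {b : ι → ι → ℝ → ℝ}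
  {k : ι → ℝ × ℝ × ℝ → ℝ}

/-- Monotonicity of the hitting time turns `ξ ≤ ψ` into a comparison of hitting times, a closed
condition. Below the surface the entry is its own trace; above, the extension from `high` is used.
-/
theorem IsKernelRow.piecewiseContinuous (hk : IsKernelRow ε i σ l l' m r h b k)
    (hi : Speed ε C (-1) (l i) (l' i)) (hj : Speed ε C (-1) (l j) (l' j)) (hij : IsAbove ε l i j)
    (hσ : σ j = -1) :
    PiecewiseContinuous (interface (l i) (l j)) fun t x ξ => k j (t, x, ξ) := by
  obtain ⟨g, hg, hkg⟩ := hk.high j hij hσ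
  have hS : IsClosed {P : ℝ × ℝ × ℝ | hit (l j) P.1 P.2.2 ≤ hit (l i) P.1 P.2.1} := by
    have h1 : Continuous fun q : ℝ × ℝ => hit (l i) q.1 q.2 := hi.contDiff_hit.continuous
    have h2 : Continuous fun q : ℝ × ℝ => hit (l j) q.1 q.2 := hj.contDiff_hit.continuous
    exact isClosed_le (h2.comp (by fun_prop : Continuous fun P : ℝ × ℝ × ℝ => (P.1, P.2.2)))
      (h1.comp (by fun_prop : Continuous fun P : ℝ × ℝ × ℝ => (P.1, P.2.1)))
  refine ⟨k j, g, (hk.low j hij hσ).mono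
    (closure_prismBelow_subset hS fun P _ hP => (le_interface_iff hj).1 hP),
    hg.mono closure_prismAbove_subset, fun P hP => ⟨fun _ => rfl, fun hlt => ?_⟩⟩
  exact hkg P (closure_prism_subset hP).2
    (not_le.1 fun hle => hlt.not_ge ((le_interface_iff hj).2 hle))

end Row

/-! ### From rows to the matrix equations and the gain. -/

theorem mul_speedMatrixDeriv_add_apply {n : ℕ} (lam : Fin n → ℝ → ℝ → ℝ)
    (A B : Matrix (Fin n) (Fin n) ℝ) (t x : ℝ) (i j : Fin n) :
    (A * (speedMatrixDeriv lam t x + B)) i j =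
      A i j * derivWithin (fun y => lam j t y) (Icc 0 1) x + ∑ q, A i q * B q j := by
  rw [mul_add, Matrix.add_apply, speedMatrixDeriv, Matrix.mul_diagonal, Matrix.mul_apply]

theorem gainMM_apply {m p : ℕ} (lam : Fin (m + p) → ℝ → ℝ → ℝ) (Q : ℝ → Matrix (Fin p) (Fin m) ℝ)
    (K : ℝ → ℝ → ℝ → Matrix (Fin (m + p)) (Fin (m + p)) ℝ) (t x : ℝ) (i j : Fin m) :
    gainMM lam Q K t x i j =
      -(K t x 0 (Fin.castAdd p i) (Fin.castAdd p j) * lam (Fin.castAdd p j) t 0) -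
        ∑ a, K t x 0 (Fin.castAdd p i) (Fin.natAdd m a) * lam (Fin.natAdd m a) t 0 * Q t a j := by
  have h1 : blockMM (speedMatrix lam t 0) = Matrix.diagonal fun c => lam (Fin.castAdd p c) t 0 :=
    Matrix.submatrix_diagonal _ _ (Fin.castAdd_injective m p)
  have h2 : blockPP (speedMatrix lam t 0) = Matrix.diagonal fun c => lam (Fin.natAdd m c) t 0 :=
    Matrix.submatrix_diagonal _ _ (Fin.natAdd_injective p m)
  rw [gainMM, h1, h2, Matrix.sub_apply, Matrix.neg_apply, Matrix.mul_diagonal, Matrix.mul_apply]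
  simp only [Matrix.mul_diagonal]
  rfl

section Rows

variable {m p : ℕ} {ε C : ℝ} {lam : Fin (m + p) → ℝ → ℝ → ℝ}
  {M : ℝ → ℝ → Matrix (Fin (m + p)) (Fin (m + p)) ℝ} {Q : ℝ → Matrix (Fin p) (Fin m) ℝ}
  {k : Fin (m + p) → Fin (m + p) → ℝ × ℝ × ℝ → ℝ}

theorem sum_mul_faceCoeff (lam : Fin (m + p) → ℝ → ℝ → ℝ) (Q : ℝ → Matrix (Fin p) (Fin m) ℝ)
    (v : Fin (m + p) → ℝ) {t : ℝ} (ht : 0 ≤ t) (j : Fin m) :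
    ∑ q, v q * faceCoeff lam Q q (Fin.castAdd p j) t =
      -(∑ a, v (Fin.natAdd m a) * lam (Fin.natAdd m a) t 0 * Q t a j) /
        lam (Fin.castAdd p j) t 0 := by
  have h0 : (t, (0 : ℝ)) ∈ strip := ⟨ht, le_rfl, zero_le_one⟩
  rw [Fin.sum_univ_add]
  simp only [faceCoeff, Fin.addCases_left, Fin.addCases_right, extend_of_mem h0, max_eq_left ht,
    mul_zero, Finset.sum_const_zero, zero_add]
  rw [← Finset.sum_neg_distrib, Finset.sum_div]
  exact Finset.sum_congr rfl fun a _ => by ring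

/-- Characteristics in the closed prism are pieces of global trajectories, and there the extended
coefficients are the original ones. On the diagonal the commutator has entries `k_ij * (λ_j - λ_i)`,
which `diagValue` inverts off the diagonal; diagonal entries vanish on both sides. -/
theorem isBroadSolution_of_rows (hε : 0 < ε) (hlam : AdmissibleSpeeds ε lam)
    (hM : AdmissibleCoupling M)
    (hk : ∀ i, IsBroadRow i (fun j => extend (lam j)) (fun j => extendDeriv (lam j))
      (fun q j => extend fun t x => M t x q j) (diagValue lam M i) (k i)) :
    IsBroadSolution lam M fun t x ξ => Matrix.of fun i j => k i j (t, x, ξ) := by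
  obtain ⟨C, hl⟩ := hlam.exists_speed hε
  refine ⟨fun i j s₁ s₂ X Y hs hX hY hmem => ?_, fun t x ht hx => ?_⟩
  · have h0 : 0 ≤ s₁ := (closure_prism_subset (hmem s₁ (left_mem_Icc.2 hs))).1
    have hX' := hX.eqOn_flow (hl i) h0
    have hY' := hY.eqOn_flow (hl j) h0
    obtain ⟨h1, h2⟩ := (hk i).along j s₁ s₂ _ _ hs ((hl i).isTraj_flow s₁ (X s₁))
      ((hl j).isTraj_flow s₁ (Y s₁)) fun s hs' => by
        rw [← hX' hs', ← hY' hs']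
        exact (closure_prism_subset (hmem s hs')).2
    have heq : EqOn (fun s => k i j (s, flow (extend (lam i)) s₁ (X s₁) s,
          flow (extend (lam j)) s₁ (Y s₁) s) *
          extendDeriv (lam j) s (flow (extend (lam j)) s₁ (Y s₁) s) +
        ∑ q, k i q (s, flow (extend (lam i)) s₁ (X s₁) s, flow (extend (lam j)) s₁ (Y s₁) s) *
          extend (fun t x => M t x q j) s (flow (extend (lam j)) s₁ (Y s₁) s))
        (fun s => ((Matrix.of fun i j => k i j (s, X s, Y s)) *
          (speedMatrixDeriv lam s (Y s) + M s (Y s))) i j) (uIcc s₁ s₂) := by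
      rw [uIcc_of_le hs]
      intro s hs'
      have hst := (mem_strip_of_mem_prism (hmem s hs')).2
      simp only [← hX' hs', ← hY' hs', mul_speedMatrixDeriv_add_apply, extendDeriv_of_mem hst,
        extend_of_mem hst, Matrix.of_apply]
    refine ⟨h1.congr (heq.mono uIoc_subset_uIcc), ?_⟩
    rw [← intervalIntegral.integral_congr heq]
    simpa only [← hX' (right_mem_Icc.2 hs), ← hY' (right_mem_Icc.2 hs), ← hX' (left_mem_Icc.2 hs),
      ← hY' (left_mem_Icc.2 hs), Matrix.of_apply] using h2
  · have hst : (t, x) ∈ strip := ⟨ht, hx.1.le, hx.2⟩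
    ext i j
    rw [Matrix.sub_apply, speedMatrix, Matrix.mul_diagonal, Matrix.diagonal_mul, Matrix.neg_apply,
      Matrix.of_apply]
    rcases eq_or_ne j i with rfl | hij
    · rw [hM.diag_zero t x hst]
      ring
    · have hne : lam i t x - lam j t x ≠ 0 := by
        rcases lt_or_gt_of_ne hij with h | h
        · linarith [hlam.gap j i h t x hst]
        · linarith [hlam.gap i j h t x hst]
      rw [(hk i).diag j hij t x hx, diagValue, extend_of_mem hst, extend_of_mem hst,
        extend_of_mem hst]
      field_simp
      ring

variable
  (hk : ∀ i : Fin m, IsKernelRow ε (Fin.castAdd p i) (speedSign m) (fun j => extend (lam j))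
    (fun j => extendDeriv (lam j)) (fun q j => extend fun t x => M t x q j)
    (diagValue lam M (Fin.castAdd p i)) (fun _ _ => 0) (faceCoeff lam Q) (k (Fin.castAdd p i)))

include hk in
theorem continuousOn_castAdd (hε : 0 < ε) (hlam : AdmissibleSpeeds ε lam) (i : Fin m)
    (j : Fin (m + p)) (hij : ¬ (Fin.castAdd p i < j ∧ (j : ℕ) < m)) :
    ContinuousOn (k (Fin.castAdd p i) j) wedge := by
  refine (hk i).cont j fun h => hij ⟨hlam.lt_of_isAbove hε h.1, ?_⟩
  by_contra hj
  have := h.2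
  rw [speedSign, if_neg hj] at this
  norm_num at this

include hk in
theorem gainMM_eq_zero_of_rows (hε : 0 < ε) (hlam : AdmissibleSpeeds ε lam) {t x : ℝ}
    (h : (t, x) ∈ strip) {i j : Fin m} (hij : i ≤ j) :
    gainMM lam Q (fun t x ξ => Matrix.of fun i j => k i j (t, x, ξ)) t x i j = 0 := by
  have ht : 0 ≤ t := h.1
  have hne : lam (Fin.castAdd p j) t 0 ≠ 0 := by
    linarith [hlam.neg j t 0 ⟨ht, le_rfl, zero_le_one⟩]
  have hface := (hk i).face (Fin.castAdd p j) (by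
    rcases hij.eq_or_lt with rfl | hlt
    · exact Or.inl rfl
    · exact Or.inr ⟨hlam.isAbove hlt, speedSign_castAdd j⟩) t x h.2
  rw [sum_mul_faceCoeff lam Q (fun q => k (Fin.castAdd p i) q (t, x, 0)) ht, zero_add,
    eq_div_iff hne] at hface
  simp only [gainMM_apply, Matrix.of_apply]
  rw [hface]
  ring

include hk in
-- Entries with `i ≤ j` are identically zero. Those with `j < i` involve only `k_ij` and the entries
-- with positive second speed, none of which has an interface.
theorem continuousOn_gainMM_of_rows (hε : 0 < ε) (hlam : AdmissibleSpeeds ε lam)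
    (hQ : AdmissibleBoundary Q) :
    ContinuousOn (fun q : ℝ × ℝ =>
      gainMM lam Q (fun t x ξ => Matrix.of fun i j => k i j (t, x, ξ)) q.1 q.2) strip := by
  refine continuousOn_pi.2 fun i => continuousOn_pi.2 fun j => ?_
  rcases le_or_gt i j with hij | hij
  · exact continuousOn_const.congr fun q hq => gainMM_eq_zero_of_rows hk hε hlam hq hij
  have hface : MapsTo (fun q : ℝ × ℝ => (q.1, q.2, (0 : ℝ))) strip wedge := fun q hq =>
    ⟨le_rfl, hq.2.1, hq.2.2⟩
  have hlam0 : ∀ c, ContinuousOn (fun q : ℝ × ℝ => lam c q.1 0) strip := fun c =>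
    (hlam.contDiffOn c).continuousOn.comp (f := fun q : ℝ × ℝ => (q.1, (0 : ℝ))) (by fun_prop)
      fun q hq => ⟨hq.1, le_rfl, zero_le_one⟩
  have hk0 : ∀ j : Fin (m + p), ¬ (Fin.castAdd p i < j ∧ (j : ℕ) < m) →
      ContinuousOn (fun q : ℝ × ℝ => k (Fin.castAdd p i) j (q.1, q.2, 0)) strip := fun j hj =>
    (continuousOn_castAdd hk hε hlam i j hj).comp (by fun_prop) hface
  have hQ0 : ∀ a, ContinuousOn (fun q : ℝ × ℝ => Q q.1 a j) strip := fun a =>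
    (continuous_apply_apply a j).comp_continuousOn
      (hQ.continuousOn.comp continuousOn_fst fun q hq => hq.1)
  simp only [gainMM_apply, Matrix.of_apply]
  refine (((hk0 _ fun h => ?_).mul (hlam0 _)).neg).sub
    (continuousOn_finsetSum _ fun a _ => ((hk0 _ fun h => ?_).mul (hlam0 _)).mul (hQ0 a))
  · exact hij.not_gt h.1
  · simpa using h.2

end Rows

end VolterraKernel

open VolterraKernel

theorem theorem2p3 (m p : ℕ) (hm : 1 ≤ m) (hp : 1 ≤ p)
    (ε : ℝ) (hε : 0 < ε)
    (lam : Fin (m + p) → ℝ → ℝ → ℝ) (hlam : AdmissibleSpeeds ε lam)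
    (M : ℝ → ℝ → Matrix (Fin (m + p)) (Fin (m + p)) ℝ) (hM : AdmissibleCoupling M)
    (Q : ℝ → Matrix (Fin p) (Fin m) ℝ) (hQ : AdmissibleBoundary Q) :
    ∃ (K : ℝ → ℝ → ℝ → Matrix (Fin (m + p)) (Fin (m + p)) ℝ)
      (ψ : Fin m → Fin m → ℝ → ℝ → ℝ),
      -- `K` is bounded
      (∃ C : ℝ, ∀ q ∈ closure prism, ∀ i j, |K q.1 q.2.1 q.2.2 i j| ≤ C) ∧
      -- the entries `k_ij` with `j ∉ {i+1, …, m}` are continuous on the closed prism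
      (∀ i j : Fin (m + p), ¬ (i < j ∧ (j : ℕ) < m) →
        ContinuousOn (fun q : ℝ × ℝ × ℝ => K q.1 q.2.1 q.2.2 i j) (closure prism)) ∧
      -- the entries `k_ij` with `i < j ≤ m` are continuous up to the boundary on both sides of
      -- the surface `ξ = ψ_ij(t, x)`
      (∀ i j : Fin m, i < j →
        IsInterface (lam (Fin.castAdd p i)) (lam (Fin.castAdd p j)) (ψ i j) ∧
        PiecewiseContinuous (ψ i j)
          (fun t x ξ => K t x ξ (Fin.castAdd p i) (Fin.castAdd p j))) ∧
      -- `K` is a broad solution of the kernel equations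
      IsBroadSolution lam M K ∧
      -- `G₋₋` is continuous and strictly lower triangular
      (ContinuousOn (fun q : ℝ × ℝ => gainMM lam Q K q.1 q.2) strip ∧
        ∀ t x : ℝ, (t, x) ∈ strip → ∀ i j : Fin m, i ≤ j → gainMM lam Q K t x i j = 0) := by
  obtain ⟨k, hbroad, hneg, hpos⟩ := exists_rows hε hlam hM hQ
  obtain ⟨C, hl⟩ := hlam.exists_speed hε
  refine ⟨fun t x ξ => Matrix.of fun i j => k i j (t, x, ξ), fun i j =>
    interface (extend (lam (Fin.castAdd p i))) (extend (lam (Fin.castAdd p j))), ?_,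
    fun i j hij => ?_, fun i j hij => ?_, isBroadSolution_of_rows hε hlam hM hbroad,
    continuousOn_gainMM_of_rows hneg hε hlam hQ,
    fun t x h i j hij => gainMM_eq_zero_of_rows hneg hε hlam h hij⟩
  · choose B hB using fun i => (hbroad i).bdd
    refine ⟨∑ i, |B i|, fun q _ i j => ?_⟩
    exact ((hB i j q).trans (le_abs_self _)).trans
      (Finset.single_le_sum (f := fun i => |B i|) (fun _ _ => abs_nonneg _) (Finset.mem_univ i))
  · refine ContinuousOn.mono ?_ (closure_prism_subset.trans inter_subset_right)
    revert hij
    refine Fin.addCases (fun a h => ?_) (fun a _ => ?_) i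
    · exact continuousOn_castAdd hneg hε hlam a j h
    · exact hpos a j
  · have hs : ∀ c : Fin m, Speed ε C (-1) (extend (lam (Fin.castAdd p c)))
        (extendDeriv (lam (Fin.castAdd p c))) := fun c =>
      speedSign_castAdd (p := p) c ▸ hl (Fin.castAdd p c)
    have hab := hlam.isAbove (i := Fin.castAdd p i) (j := Fin.castAdd p j) hij
    exact ⟨isInterface_interface (hs i) (hs j) hab (fun t x => extend_of_mem)
      fun t x => extend_of_mem, (hneg i).piecewiseContinuous (hs i) (hs j) hab
        (speedSign_castAdd j)⟩
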